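/- **Setting.** Let $f_{abc}$ be the totally antisymmetric structure constants of a real Lie algebra with orthonormal generators, $[\xi_a,\xi_b]=if_{abc}\xi_c$, $\langle\xi_a|\xi_b\rangle=\delta_{ab}$ (in particular of a simple non-abelian one), $\pi$ a representation on $\mathbb C^d$, and $\gamma^\mu$ Dirac matrices. Let $u$ be a timelike unit vector and $c(e)$ a smearing function of total weight one on spacelike unit vectors $e\perp u$. Write $(I_c^\nu f)(x)=\int d\sigma(e)\,c(e)e^\nu\int_0^\infty ds\,f(x+se)$ and $(I_u^\nu f)(x)=u^\nu\int_0^\infty ds\,f(x+su)$, and $\delta_{xx'}=\delta(x-x')$. Primes on fields and operators refer to the points $x',x''$, and $I^{\pm\nu}_{xx'}=(I_c\pm I_u')^\nu\delta_{xx'}$. The free fields are the Lie-algebra valued fields $F^{\mu\nu}$, $A^\mu(c)$, $A^\mu$, $\phi$ with $$F^{\mu\nu}=\partial^\mu A^\nu-\partial^\nu A^\mu=\partial^\mu A^\nu(c)-\partial^\nu A^\mu(c),\quad \partial_\mu F^{\mu\nu}=\partial_\mu A^\mu=\partial_\mu A^\mu(c)=0,\quad \partial^\mu\phi=A^\mu(c)-A^\mu,$$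 and massless Dirac fields $\psi,\bar\psi$, with currents $j_a^\mu=\bar\psi\gamma^\mu\pi(\xi_a)\psi$. Put $S_\mu=A_\mu(c)+A_\mu$, $D_\mu=A_\mu(c)-A_\mu$, $\sigma_\nu=i[\phi,S_\nu]$, $A_{\mu\nu}(c)=i[A_\mu(c),A_\nu(c)]$, $A_{\mu\nu}=i[A_\mu,A_\nu]$, $S_{\mu\nu}=A_{\mu\nu}(c)+A_{\mu\nu}$. All products are Wick products. The densities of string-localized QCD in the $L$-$V$ approach (with $c_F=0$) are $$L_1=\tfrac12\langle F^{\mu\nu}|A_{\mu\nu}(c)\rangle+\langle A_\mu(c)|j^\mu\rangle,\quad K_1=\tfrac12\langle F^{\mu\nu}|A_{\mu\nu}\rangle+\langle A_\mu|j^\mu\rangle,\quad U_1^\mu=\tfrac12\langle F^{\mu\nu}|\sigma_\nu\rangle+\langle\phi|j^\mu\rangle,$$ $$L_2=-\tfrac12\langle A^{\mu\nu}(c)|A_{\mu\nu}(c)\rangle,\qquad K_2=-\tfrac12\langle A^{\mu\nu}|A_{\mu\nu}\rangle,$$ $$U_2^\mu(x;x')=\tfrac12\langle\sigma'_\nu|j^\mu\rangle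 I^{-\nu}_{xx'}-\tfrac14\langle i[F^{\mu\nu},S_\nu]|\sigma'_\kappa\rangle I^{-\kappa}_{xx'}-\tfrac14\langle i[F^{\mu\nu},D_\nu]|\sigma'_\kappa\rangle I^{+\kappa}_{xx'}-\tfrac12\langle S^{\mu\nu}|\sigma_\nu\rangle\delta_{xx'}-\tfrac13\langle F^{\mu\nu}|i[\phi,i[\phi,D_\nu]]\rangle\delta_{xx'}.$$ The tree-level obstruction maps are $O_Y(X')=\sum_{\varphi,\chi}\frac{\partial Y^\mu}{\partial\varphi}\,O_\mu(\varphi,\chi')\,\frac{\partial X'}{\partial\chi'}$ with the two-point obstructions $$O_\mu(F^{\mu\nu},F'^{\kappa\lambda})=-(\eta^{\nu\kappa}\partial^\lambda-\eta^{\nu\lambda}\partial^\kappa)\,i\delta_{xx'},\qquad O_\mu(F^{\mu\nu},A'^\kappa(c))=-(\eta^{\nu\kappa}-I_c'^\nu\partial^\kappa)\,i\delta_{xx'},$$ $$O_\mu(F^{\mu\nu},A'^\kappa)=-(\eta^{\nu\kappa}+I_u^\nu\partial^\kappa)\,i\delta_{xx'},\qquad O_\mu(F^{\mu\nu},\phi')=-(I_c'^\nu+I_u^\nu)\,i\delta_{xx'}$$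 (times $\delta_{ab}$ in the Lie-algebra indices), the Ward identities $O_\mu(j_a^\mu,\psi')=\pi(\xi_a)\psi\,\delta_{xx'}$, $O_\mu(j_a^\mu,\bar\psi')=-\bar\psi\pi(\xi_a)\,\delta_{xx'}$, and the prescription that all two-point obstructions $O_\mu(A_\nu(c),\cdot)$, $O_\mu(A_\nu,\cdot)$, $O_\mu(\phi,\cdot)$ vanish. A term $Y^\mu\delta_{xx'}$ of $U_2^\mu$ contributes $\tfrac12O_Y(X'')\,\delta_{xx'}$ to the symmetrized obstruction. The third-order obstruction is $$P^{(3)}=\mathfrak S_{xx'x''}\Big(\tfrac12O_{U_1}O_{U_1'}(L_1''-K_1'')-\tfrac{3i}2\big(O_{U_2}(L_1''+K_1'')+O_{U_1}((L_2'+K_2')\delta_{x'x''})\big)\Big),$$ and $L_3$, $K_3$, $U_3$ are sought such that $P^{(3)}=(L_3-K_3)\,\delta_{xx'x''}-\mathfrak S_{xx'x''}\partial^x_\mu U_3^\mu(x;x',x'')$. Here $\mathfrak S$ is the average over permutations, and $|_{\rm qu}$ denotes the part consisting of all terms with quark fields. Equalities are equalities of Wick polynomials, modulo the free field equations, with distributional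 coefficients in three points. In the quark sector, "total derivative" means $\mathfrak S_{xx'x''}\,\partial^x_\mu\langle\xi(x;x',x'')|j^\mu(x)\rangle$ with a purely gluonic $\xi$. **Proposition.** Let $$B=\tfrac34\langle i[\sigma'_\nu,D_\kappa]|j^\kappa\rangle\,I^{+\nu}_{xx'}\,\delta_{xx''}-\tfrac12\langle i[\phi,i[\phi,D_\kappa]]|j^\kappa\rangle\,\delta_{xx'}\delta_{xx''}.$$ After symmetrization, the following hold. 1. $\tfrac12O_{U_1}O_{U_1'}(L_1''-K_1'')|_{\rm qu}$ equals $B$ up to a total derivative. 2. $-\tfrac{3i}2O_{U_2}(L_1''+K_1'')|_{\rm qu}$ equals $-B$ up to a total derivative. 3. $-\tfrac{3i}2O_{U_1}((L_2'+K_2')\delta_{x'x''})|_{\rm qu}=0$. Thus the bulk (non-derivative) quark terms of the third-order obstruction cancel, and the third-order condition in the quark sector is solved with $$L_3|_{\rm qu}=K_3|_{\rm qu}=0$$ and some $U_3^\mu|_{\rm qu}=\langle\xi_3(x;x',x'')|j^\mu(x)\rangle$ with purely gluonic $\xi_3$. -/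

import Mathlib

open MeasureTheory
open scoped ContDiff

noncomputable section

namespace SQCD

/-- Minkowski space, signature `(+,-,-,-)`. -/
abbrev M : Type := Fin 4 → ℝ

/-- Diagonal entries of the Minkowski metric; they raise and lower Lorentz indices. -/
def eta (μ : Fin 4) : ℝ := if μ = 0 then 1 else -1

def mdot (x y : M) : ℝ := ∑ μ, eta μ * x μ * y μ

/-! ### Algebraic data of the model -/

/-- Structure constants `f` of a real Lie algebra with orthonormal generators `ξ_a`,
`[ξ_a, ξ_b] = i f_{abc} ξ_c` (so `f` is totally antisymmetric and satisfies the Jacobi identity),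
a representation `π` of it on `ℂ^d`, and the Dirac matrices `γ^μ`. -/
structure GaugeData (N d : ℕ) where
  f : Fin N → Fin N → Fin N → ℝ
  antisymm_left : ∀ a b c, f a b c = -f b a c
  antisymm_right : ∀ a b c, f a b c = -f a c b
  jacobi : ∀ a b c e, ∑ k, (f a b k * f k c e + f b c k * f k a e + f c a k * f k b e) = 0
  π : Fin N → Matrix (Fin d) (Fin d) ℂ
  π_comm : ∀ a b, π a * π b - π b * π a = Complex.I • ∑ c, (f a b c : ℂ) • π c
  γ : Fin 4 → Matrix (Fin 4) (Fin 4) ℂ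
  clifford : ∀ μ ν, γ μ * γ ν + γ ν * γ μ =
    if μ = ν then ((2 * eta μ : ℝ) : ℂ) • (1 : Matrix (Fin 4) (Fin 4) ℂ) else 0

/-! ### Wick polynomials and distributional kernels in three points `x, x', x''` -/

/-- The components of the linear free fields (all Lorentz indices are upper indices):
`φ(c)`, `A^κ(c)`, `A^κ`, `F^{κλ}` with colour index `a`, and the quark fields `ψ`, `ψ̄` with
spinor index `s` and representation index `m`. -/
inductive Fld (N d : ℕ) : Type
  | phi (a : Fin N)
  | Ac (a : Fin N) (κ : Fin 4)
  | A (a : Fin N) (κ : Fin 4)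
  | F (a : Fin N) (κ l : Fin 4)
  | psi (s : Fin 4) (m : Fin d)
  | psibar (s : Fin 4) (m : Fin d)

def Fld.isQuark {N d : ℕ} : Fld N d → Bool
  | .psi _ _ => true
  | .psibar _ _ => true
  | _ => false

/-- Wick polynomials in the fields at the three points `x = 0`, `x' = 1`, `x'' = 2`.
The quark fields enter only through Wick-ordered bilinears `ψ̄ … ψ`, which commute
under Wick ordering; such a bilinear is written in the order `ψ̄ … ψ`. -/
abbrev Wick (N d : ℕ) : Type := MvPolynomial (Fin 3 × Fld N d) ℂ

/-- The two-point kernels: `δ_{pq} = δ(x_p - x_q)`, its string integrals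
`I_c^ν δ_{pq}` and `I_u^ν δ_{pq}`, where the string integration acts on the first point `x_p`. -/
inductive Ker : Type
  | delta
  | Ic (ν : Fin 4)
  | Iu (ν : Fin 4)

/-- A kernel `k` between the points `x_src` and `x_dst`, or (if `der = some κ`) its derivative
`∂_κ` with respect to `x_src`. -/
structure Edge where
  src : Fin 3
  dst : Fin 3
  ker : Ker
  der : Option (Fin 4)

/-- Linear combinations of Wick polynomials multiplied by products of kernels. -/
abbrev Expr (N d : ℕ) : Type := MonoidAlgebra (Wick N d) (FreeMonoid Edge)

section Basic
variable {N d : ℕ}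

def wick (w : Wick N d) : Expr N d := MonoidAlgebra.single 1 w

/-- The field `χ` at the point `p`. -/
def fld (p : Fin 3) (χ : Fld N d) : Expr N d := wick (MvPolynomial.X (p, χ))

def edge (e : Edge) : Expr N d := MonoidAlgebra.single (FreeMonoid.of e) 1

/-- `k_{pq}`. -/
def K (k : Ker) (p q : Fin 3) : Expr N d := edge ⟨p, q, k, none⟩

/-- `∂^κ k_{pq}` with the derivative acting on the first point `x_p`, upper index `κ`. -/
def dK (k : Ker) (p q : Fin 3) (κ : Fin 4) : Expr N d :=
  (eta κ : ℂ) • edge ⟨p, q, k, some κ⟩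

def delta (p q : Fin 3) : Expr N d := K Ker.delta p q

/-- `I^{+ν}_{pq} = (I_c + I'_u)^ν δ_{pq}`: `I_c` acts on `x_p`, and `I'_u` acts on `x_q`. -/
def Iplus (ν : Fin 4) (p q : Fin 3) : Expr N d := K (Ker.Ic ν) p q + K (Ker.Iu ν) q p

/-- `I^{-ν}_{pq} = (I_c - I'_u)^ν δ_{pq}`. -/
def Iminus (ν : Fin 4) (p q : Fin 3) : Expr N d := K (Ker.Ic ν) p q - K (Ker.Iu ν) q p

/-- Partial derivative `∂/∂χ(x_p)` of the Wick polynomials; kernels are `c`-numbers. -/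
def pdv (p : Fin 3) (χ : Fld N d) (X : Expr N d) : Expr N d :=
  X.coeff.sum fun w P => MonoidAlgebra.single w (MvPolynomial.pderiv (p, χ) P)

/-- The purely gluonic part: all terms without quark fields. -/
def gluonPart (X : Expr N d) : Expr N d :=
  X.coeff.sum fun w P => MonoidAlgebra.single w
    (MvPolynomial.aeval
      (fun v : Fin 3 × Fld N d => if v.2.isQuark then (0 : Wick N d) else MvPolynomial.X v) P)

/-- The quark part `X|_qu`: all terms containing quark fields. -/
def quarkPart (X : Expr N d) : Expr N d := X - gluonPart X

/-! ### Lie-algebra valued fields -/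

/-- `⟨X|Y⟩` for Lie-algebra valued `X`, `Y`. -/
def pair (X Y : Fin N → Expr N d) : Expr N d := ∑ a, X a * Y a

/-- `i[X,Y] = -f_{abc} X_a Y_b ξ_c`. -/
def br (G : GaugeData N d) (X Y : Fin N → Expr N d) (c : Fin N) : Expr N d :=
  -∑ a, ∑ b, (G.f a b c : ℂ) • (X a * Y b)

def phi (p : Fin 3) (a : Fin N) : Expr N d := fld p (.phi a)
def Ac (p : Fin 3) (κ : Fin 4) (a : Fin N) : Expr N d := fld p (.Ac a κ)
def A (p : Fin 3) (κ : Fin 4) (a : Fin N) : Expr N d := fld p (.A a κ)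
def F (p : Fin 3) (κ l : Fin 4) (a : Fin N) : Expr N d := fld p (.F a κ l)

/-- The quark current `j_a^μ = ψ̄ γ^μ π(ξ_a) ψ`. -/
def j (G : GaugeData N d) (p : Fin 3) (μ : Fin 4) (a : Fin N) : Expr N d :=
  ∑ s, ∑ t, ∑ m, ∑ n, (G.γ μ s t * G.π a m n) • (fld p (.psibar s m) * fld p (.psi t n))

/-- `S^κ = A^κ(c) + A^κ`. -/
def S (p : Fin 3) (κ : Fin 4) (a : Fin N) : Expr N d := Ac p κ a + A p κ a

/-- `D^κ = A^κ(c) - A^κ`. -/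
def D (p : Fin 3) (κ : Fin 4) (a : Fin N) : Expr N d := Ac p κ a - A p κ a

/-- `A^{κλ}(c) = i[A^κ(c), A^λ(c)]`. -/
def Ac2 (G : GaugeData N d) (p : Fin 3) (κ l : Fin 4) : Fin N → Expr N d :=
  br G (Ac p κ) (Ac p l)

/-- `A^{κλ} = i[A^κ, A^λ]`. -/
def A2 (G : GaugeData N d) (p : Fin 3) (κ l : Fin 4) : Fin N → Expr N d :=
  br G (A p κ) (A p l)

/-- `S^{κλ} = A^{κλ}(c) + A^{κλ}`. -/
def S2 (G : GaugeData N d) (p : Fin 3) (κ l : Fin 4) : Fin N → Expr N d :=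
  Ac2 G p κ l + A2 G p κ l

/-- `σ_ν = i[φ, S_ν]`, lower index. -/
def sig (G : GaugeData N d) (p : Fin 3) (ν : Fin 4) (a : Fin N) : Expr N d :=
  (eta ν : ℂ) • br G (phi p) (S p ν) a

/-! ### The interaction densities of the `L`-`V` pair, first and second order -/

/-- `L_1 = ½⟨F^{μν}|i[A_μ(c),A_ν(c)]⟩ + ⟨A_μ(c)|j^μ⟩`. -/
def L1 (G : GaugeData N d) (p : Fin 3) : Expr N d :=
  (1 / 2 : ℂ) • (∑ μ, ∑ ν, (eta μ * eta ν : ℂ) • pair (F p μ ν) (Ac2 G p μ ν)) +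
    ∑ μ, (eta μ : ℂ) • pair (Ac p μ) (j G p μ)

/-- `K_1 = ½⟨F^{μν}|i[A_μ,A_ν]⟩ + ⟨A_μ|j^μ⟩`. -/
def K1 (G : GaugeData N d) (p : Fin 3) : Expr N d :=
  (1 / 2 : ℂ) • (∑ μ, ∑ ν, (eta μ * eta ν : ℂ) • pair (F p μ ν) (A2 G p μ ν)) +
    ∑ μ, (eta μ : ℂ) • pair (A p μ) (j G p μ)

/-- `L_2 = -½⟨A^{μν}(c)|A_{μν}(c)⟩`. -/
def L2 (G : GaugeData N d) (p : Fin 3) : Expr N d :=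
  -((1 / 2 : ℂ) • ∑ μ, ∑ ν, (eta μ * eta ν : ℂ) • pair (Ac2 G p μ ν) (Ac2 G p μ ν))

/-- `K_2 = -½⟨A^{μν}|A_{μν}⟩`. -/
def K2 (G : GaugeData N d) (p : Fin 3) : Expr N d :=
  -((1 / 2 : ℂ) • ∑ μ, ∑ ν, (eta μ * eta ν : ℂ) • pair (A2 G p μ ν) (A2 G p μ ν))

/-- A vector field `Y^μ = ⟨F^{μν}|T_ν⟩ + ⟨R|j^μ⟩ + Z^μ`, with `F` and `j` taken at the point `pt`
and `T_ν`, `R`, `Z^μ` free of `F` and of quark fields: thus `T_ν = ∂Y^μ/∂F^{μν}` and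
`R = ∂Y^μ/∂j^μ`. The coefficients may depend on further points and may involve kernels. -/
structure Current (N d : ℕ) where
  pt : Fin 3
  T : Fin 4 → Fin N → Expr N d
  R : Fin N → Expr N d
  Z : Fin 4 → Expr N d

/-- The components `Y^μ`. -/
def Current.comp (G : GaugeData N d) (Y : Current N d) (μ : Fin 4) : Expr N d :=
  ∑ ν, pair (F Y.pt μ ν) (Y.T ν) + pair Y.R (j G Y.pt μ) + Y.Z μ

/-- `U_1^μ = ½⟨F^{μν}|σ_ν⟩ + ⟨φ|j^μ⟩` at the point `p`. -/
def U1 (G : GaugeData N d) (p : Fin 3) : Current N d where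
  pt := p
  T ν a := (1 / 2 : ℂ) • sig G p ν a
  R := phi p
  Z _ := 0

/-- The part of `U_2^μ(x;x')` with string-integrated delta functions,
`½⟨σ'_ν|j^μ⟩ I^{-ν}_{xx'} - ¼⟨i[F^{μν},S_ν]|σ'_κ⟩ I^{-κ}_{xx'}
  - ¼⟨i[F^{μν},D_ν]|σ'_κ⟩ I^{+κ}_{xx'}`,
where `⟨i[F^{μν},S_ν]|σ'_κ⟩ = ⟨F^{μν}|i[S_ν,σ'_κ]⟩` by invariance of the inner product. -/
def U2string (G : GaugeData N d) : Current N d where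
  pt := 0
  T ν a := -((1 / 4 : ℂ) • ∑ κ, (eta ν : ℂ) •
    (br G (S 0 ν) (sig G 1 κ) a * Iminus κ 0 1 + br G (D 0 ν) (sig G 1 κ) a * Iplus κ 0 1))
  R a := (1 / 2 : ℂ) • ∑ ν, sig G 1 ν a * Iminus ν 0 1
  Z _ := 0

/-- The local field `Y^μ = -½⟨S^{μν}|σ_ν⟩ - ⅓⟨F^{μν}|i[φ,i[φ,D_ν]]⟩`; the remaining part of
`U_2^μ(x;x')` is `Y^μ(x) δ_{xx'}`. -/
def U2local (G : GaugeData N d) : Current N d where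
  pt := 0
  T ν a := -((1 / 3 : ℂ) • (eta ν : ℂ) • br G (phi 0) (br G (phi 0) (D 0 ν)) a)
  R _ := 0
  Z μ := -((1 / 2 : ℂ) • ∑ ν, pair (S2 G 0 μ ν) (sig G 0 ν))

/-! ### Two-point obstructions and obstruction maps -/

/-- `O_μ(F^{μν}(x), φ(p)) = -(I'_c + I_u)^ν iδ_{xp}` (primed operators act on the point `p`). -/
def oF_phi (x p : Fin 3) (ν : Fin 4) : Expr N d :=
  -(Complex.I • (K (Ker.Ic ν) p x + K (Ker.Iu ν) x p))

/-- `O_μ(F^{μν}(x), A^κ(c)(p)) = -(η^{νκ} - I'_c^ν ∂^κ) iδ_{xp}`, where `∂ = ∂_x`; since kernels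
depend on differences only, `∂_x^κ I'_c^ν δ_{xp} = -∂_p^κ I'_c^ν δ_{xp}`. -/
def oF_Ac (x p : Fin 3) (ν κ : Fin 4) : Expr N d :=
  -(Complex.I • ((if ν = κ then (eta ν : ℂ) • delta x p else 0) + dK (Ker.Ic ν) p x κ))

/-- `O_μ(F^{μν}(x), A^κ(p)) = -(η^{νκ} + I_u^ν ∂^κ) iδ_{xp}`. -/
def oF_A (x p : Fin 3) (ν κ : Fin 4) : Expr N d :=
  -(Complex.I • ((if ν = κ then (eta ν : ℂ) • delta x p else 0) + dK (Ker.Iu ν) x p κ))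

/-- `O_μ(F^{μν}(x), F^{κλ}(p)) = -(η^{νκ}∂^λ - η^{νλ}∂^κ) iδ_{xp}`. -/
def oF_F (x p : Fin 3) (ν κ l : Fin 4) : Expr N d :=
  -(Complex.I • ((if ν = κ then (eta ν : ℂ) • dK Ker.delta x p l else 0) -
    (if ν = l then (eta ν : ℂ) • dK Ker.delta x p κ else 0)))

/-- Charged Ward identity `O_μ(j_a^μ(x), ψ(p)) = (π(ξ_a)ψ)(x) δ_{xp}`. -/
def oj_psi (G : GaugeData N d) (x p : Fin 3) (a : Fin N) (s : Fin 4) (m : Fin d) : Expr N d :=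
  (∑ n, G.π a m n • fld x (.psi s n)) * delta x p

/-- Charged Ward identity `O_μ(j_a^μ(x), ψ̄(p)) = -(ψ̄π(ξ_a))(x) δ_{xp}`. -/
def oj_psibar (G : GaugeData N d) (x p : Fin 3) (a : Fin N) (s : Fin 4) (m : Fin d) :
    Expr N d :=
  -((∑ n, G.π a n m • fld x (.psibar s n)) * delta x p)

/-- The tree-level obstruction map
`O_Y(X) = ∑_{ϕ,χ} (∂Y^μ/∂ϕ) O_μ(ϕ,χ) (∂X/∂χ)`, for `X` not containing fields at the point of `Y`.
All two-point obstructions `O_μ(ϕ,·)` with `ϕ = φ, A(c), A` vanish, so that only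
`ϕ = F` and `ϕ = j` contribute. -/
def obst (G : GaugeData N d) (Y : Current N d) (X : Expr N d) : Expr N d :=
  ∑ p : Fin 3,
    ((∑ a, ∑ ν, Y.T ν a *
        (oF_phi Y.pt p ν * pdv p (.phi a) X
          + ∑ κ, oF_Ac Y.pt p ν κ * pdv p (.Ac a κ) X
          + ∑ κ, oF_A Y.pt p ν κ * pdv p (.A a κ) X
          + ∑ κ, ∑ l, oF_F Y.pt p ν κ l * pdv p (.F a κ l) X))
      + ∑ a, Y.R a *
        (∑ s, ∑ m, (oj_psi G Y.pt p a s m * pdv p (.psi s m) X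
          + oj_psibar G Y.pt p a s m * pdv p (.psibar s m) X)))

/-- `O_{U_2(x;x')}(X'')` under symmetrization in `x, x'`. For the part `Y^μ δ_{xx'}` of `U_2` the
symmetrized obstruction is `½ [T, ∂_x + ∂_{x'}] Y^μ δ_{xx'} X''`, and since `∂_x + ∂_{x'}`
annihilates `δ_{xx'}` this equals `½ O_Y(X'') δ_{xx'}`. -/
def obstU2 (G : GaugeData N d) (X : Expr N d) : Expr N d :=
  obst G (U2string G) X + (1 / 2 : ℂ) • (delta 0 1 * obst G (U2local G) X)

/-! ### The third-order obstruction -/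

/-- `½ O_{U_1}(O_{U_1'}(L_1'' - K_1''))`. -/
def P3a (G : GaugeData N d) : Expr N d :=
  (1 / 2 : ℂ) • obst G (U1 G 0) (obst G (U1 G 1) (L1 G 2 - K1 G 2))

/-- `-(3i/2) O_{U_2}(L_1'' + K_1'')`. -/
def P3b (G : GaugeData N d) : Expr N d :=
  (-(3 * Complex.I / 2)) • obstU2 G (L1 G 2 + K1 G 2)

/-- `-(3i/2) O_{U_1}((L_2' + K_2') δ_{x'x''})`. -/
def P3c (G : GaugeData N d) : Expr N d :=
  (-(3 * Complex.I / 2)) • obst G (U1 G 0) ((L2 G 1 + K2 G 1) * delta 1 2)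

/-- The third-order obstruction `P^{(3)}` before symmetrization. -/
def P3 (G : GaugeData N d) : Expr N d := P3a G + P3b G + P3c G

/-- The non-derivative quark terms
`¾⟨i[σ'_ν,D_κ]|j^κ⟩ I^{+ν}_{xx'} δ_{xx''} - ½⟨i[φ,i[φ,D_κ]]|j^κ⟩ δ_{xx'} δ_{xx''}`. -/
def bulk (G : GaugeData N d) : Expr N d :=
  (3 / 4 : ℂ) • (∑ ν, ∑ κ, (eta κ : ℂ) •
      (pair (br G (sig G 1 ν) (D 0 κ)) (j G 0 κ) * Iplus ν 0 1 * delta 0 2))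
    - (1 / 2 : ℂ) • (∑ κ, (eta κ : ℂ) •
      (pair (br G (phi 0) (br G (phi 0) (D 0 κ))) (j G 0 κ) * delta 0 1 * delta 0 2))

end Basic

/-! ### Evaluation as distributions in three points -/

/-- A timelike unit vector `u`, and a smearing function `c` of total weight one (with respect to a
measure `σ` of string directions) supported on spacelike unit vectors orthogonal to `u`. -/
structure Strings where
  u : M
  u_unit : mdot u u = 1
  σ : Measure M
  c : M → ℝ
  integrable_c : Integrable c σ
  weight_c : ∫ e, c e ∂σ = 1
  support_c : ∀ e, c e ≠ 0 → mdot e e = -1 ∧ mdot e u = 0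

/-- The kernels as distributions in `y = x_dst - x_src`:
`δ(x_src - x_dst)`, `∫ dσ(e) c(e) e^ν ∫₀^∞ ds δ(x_src + se - x_dst)` and
`u^ν ∫₀^∞ ds δ(x_src + su - x_dst)`. -/
def kerVal (s : Strings) : Ker → (M → ℂ) → ℂ
  | .delta, g => g 0
  | .Ic ν, g => ∫ e, ((s.c e * e ν : ℝ) : ℂ) * (∫ t in Set.Ioi (0 : ℝ), g (t • e)) ∂s.σ
  | .Iu ν, g => ((s.u ν : ℝ) : ℂ) * ∫ t in Set.Ioi (0 : ℝ), g (t • s.u)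

/-- `∂_κ g`, or `g` itself. -/
def derVal : Option (Fin 4) → (M → ℂ) → M → ℂ
  | none, g => g
  | some κ, g => fun y => fderiv ℝ g y (Pi.single κ 1)

/-- The three points, when `x_{a.src} = z` and the difference variables of the kernels
`a` and `b` are `y` and `y'`. -/
def place (a b : Edge) (z y y' : M) : Fin 3 → M :=
  let pos : Fin 3 → M := fun q => if q = a.src then z else z + y
  fun p => if p = a.src then z else if p = a.dst then z + y
    else if p = b.dst then pos b.src + y' else pos b.dst - y'

open Classical in
/-- The distribution in three points given by a product of two kernels which connect the three
points: `∫ dz` over the position, and the two kernels in their difference variables `y`, `y'`.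
(Derivative kernels: `∂_{src} k(x_dst - x_src)` pairs with `g` as `k` with `∂_y g`.)
All products of kernels at third order are of this form; other products are not used. -/
def wordVal (s : Strings) (w : FreeMonoid Edge) (g : (Fin 3 → M) → ℂ) : ℂ :=
  match w.toList with
  | [a, b] =>
    if a.src ≠ a.dst ∧ b.src ≠ b.dst ∧ s(a.src, a.dst) ≠ s(b.src, b.dst) then
      kerVal s a.ker fun y => kerVal s b.ker fun y' =>
        ∫ z : M, derVal a.der (fun y₁ => derVal b.der (fun y₂ => g (place a b z y₁ y₂)) y') y
    else 0
  | _ => 0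

section Eval
variable {N d : ℕ}

/-- A classical field configuration. -/
abbrev Config (N d : ℕ) : Type := Fld N d → M → ℂ

/-- Partial derivative with lower index. -/
def par (μ : Fin 4) (g : M → ℂ) (x : M) : ℂ := fderiv ℝ g x (Pi.single μ 1)

/-- Smooth solutions of the free field equations. Wick polynomials of the free fields are
represented by their classical symbols: two of them are identified if they agree on all
solutions of these equations. -/
structure OnShell (G : GaugeData N d) (C : Config N d) : Prop where
  smooth : ∀ χ, ContDiff ℝ ∞ (C χ)
  F_A : ∀ a μ ν x, C (.F a μ ν) x =
    (eta μ : ℂ) * par μ (C (.A a ν)) x - (eta ν : ℂ) * par ν (C (.A a μ)) x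
  F_Ac : ∀ a μ ν x, C (.F a μ ν) x =
    (eta μ : ℂ) * par μ (C (.Ac a ν)) x - (eta ν : ℂ) * par ν (C (.Ac a μ)) x
  div_F : ∀ a ν x, ∑ μ, par μ (C (.F a μ ν)) x = 0
  div_A : ∀ a x, ∑ μ, par μ (C (.A a μ)) x = 0
  div_Ac : ∀ a x, ∑ μ, par μ (C (.Ac a μ)) x = 0
  grad_phi : ∀ a μ x, (eta μ : ℂ) * par μ (C (.phi a)) x = C (.Ac a μ) x - C (.A a μ) x
  dirac : ∀ s m x, ∑ μ, ∑ t, G.γ μ s t * par μ (C (.psi t m)) x = 0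
  dirac_bar : ∀ t m x, ∑ μ, ∑ s, par μ (C (.psibar s m)) x * G.γ μ s t = 0

/-- The three-point distribution defined by `X` in the configuration `C`, at the test function
`h`. -/
def evalAt (s : Strings) (C : Config N d) (X : Expr N d) (h : (Fin 3 → M) → ℂ) : ℂ :=
  X.coeff.sum fun w P =>
    wordVal s w fun x => MvPolynomial.eval (fun v : Fin 3 × Fld N d => C v.2 (x v.1)) P * h x

/-- `∂_μ` with respect to the first of the three points. -/
def par₀ (μ : Fin 4) (h : (Fin 3 → M) → ℂ) (x : Fin 3 → M) : ℂ :=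
  fderiv ℝ h x (Pi.single 0 (Pi.single μ 1))

/-- The distribution `∂^x_μ U^μ`. -/
def divAt (s : Strings) (C : Config N d) (U : Fin 4 → Expr N d) (h : (Fin 3 → M) → ℂ) : ℂ :=
  -∑ μ, evalAt s C (U μ) (par₀ μ h)

/-- Symmetrization `𝔖_{xx'x''}` (the average over all permutations) of a distribution. -/
def symm (Φ : ((Fin 3 → M) → ℂ) → ℂ) (h : (Fin 3 → M) → ℂ) : ℂ :=
  (1 / 6 : ℂ) * ∑ τ : Equiv.Perm (Fin 3), Φ fun x => h (x ∘ τ)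

/-- `U^μ(x;x',x'') = ⟨ξ(x;x',x'')|j^μ(x)⟩`. -/
def quarkU (G : GaugeData N d) (ξ : Fin N → Expr N d) (μ : Fin 4) : Expr N d :=
  pair ξ (j G 0 μ)

/-- `X` and `Y` agree, after symmetrization and as distributions on all solutions of the free field
equations, up to a total derivative `𝔖 ∂^x_μ ⟨ξ|j^μ(x)⟩` with `ξ` purely gluonic. -/
def EqModDer (G : GaugeData N d) (X Y : Expr N d) : Prop :=
  ∃ ξ : Fin N → Expr N d, (∀ a, quarkPart (ξ a) = 0) ∧
    ∀ (s : Strings) (C : Config N d), OnShell G C →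
      ∀ h : (Fin 3 → M) → ℂ, ContDiff ℝ ∞ h → HasCompactSupport h →
        symm (evalAt s C X) h = symm (evalAt s C Y) h + symm (divAt s C (quarkU G ξ)) h

/-- The third-order condition in the quark sector,
`P^{(3)}|_qu = (L_3 - K_3)|_qu δ_{xx'x''} - 𝔖 ∂^x U_3|_qu`, for quark parts `L₃`, `K₃`
(Wick polynomials at `x`) and `U₃` of the third-order densities. -/
def ThirdOrderQuark (G : GaugeData N d) (L₃ K₃ : Wick N d) (U₃ : Fin 4 → Expr N d) : Prop :=
  ∀ (s : Strings) (C : Config N d), OnShell G C →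
    ∀ h : (Fin 3 → M) → ℂ, ContDiff ℝ ∞ h → HasCompactSupport h →
      symm (evalAt s C (quarkPart (P3 G))) h =
        evalAt s C (wick (L₃ - K₃) * delta 0 1 * delta 0 2) h - symm (divAt s C U₃) h

end Eval

end SQCD

end

namespace SQCD

/-! ### String integrals of continuous functions of compact support -/

/-! The computation takes place in the quotient of the expressions by the total derivatives
(`totalDer`, projection `cls`). Points may be relabelled there (`cls_perm`), and two rules of
integration by parts hold. First, if a derivative kernel ends at x'', is contracted with a current
at x'', and all other factors are gluonic and live at x and x', then current conservation makes the
term vanish (`cls_outer`). Second, if the other kernel is δ_{xx''}, the derivative acts along the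
diagonal x = x''; moved onto φ(x) j(x) it sees only φ, because j is conserved, and turns it into ∂φ
= D (`cls_diagDer`).

Obstruction maps are derivations which ignore kernels (`IsObst`), and those of U_1 and U_2 commute
with taking quark parts (`quarkPart_obst`). Hence L_1 - K_1 enters only through ⟨D|j⟩ and L_1 + K_1
only through ⟨S|j⟩, while L_2 + K_2 contributes nothing. The local pieces of the obstructions of
A(c) and A cancel in D (`obst_DW`) and add up in S (`obst_SW`).

Write P and Λ for the classes of ⟨i[σ'_ν,D_κ]|j^κ⟩ I^{+ν} δ_{xx''} and of ⟨i[φ,i[φ,D_κ]]|j^κ⟩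
δ_{xx'} δ_{xx''} (`bulkPlus`, `bulkLocal`). The inner map of the iterated obstruction yields a term
with σ', a derivative kernel and j'', and a term with D'', φ' and a commutator of representation
matrices. The outer map hits σ' (an outer divergence, which vanishes), j'' in the first term (½P),
D'' (½P), φ' (½P), or the current in the second term (a double commutator, -Λ). With the prefactor ½
this is ¾P - ½Λ (`cls_quarkPart_P3a`).

For U_2 the derivative kernels drop out by the first rule. With Q the class of ⟨i[S_κ,σ'_ν]|j^κ⟩
I^{-ν} δ_{xx''}, the F-coefficient of the string part gives (i/2)(Q - P) and its j-coefficient gives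
-(i/2)Q; the local part gives (2i/3)Λ with weight ½. Multiplication by -3i/2 leaves -¾P + ½Λ
(`cls_quarkPart_P3b`).

The analysis at the beginning legitimises these rules: string integrals of test functions converge
uniformly, because the directions e stay bounded and away from zero. -/

theorem Strings.u_ne_zero (s : Strings) : s.u ≠ 0 := by
  intro h
  have := s.u_unit
  simp [h, mdot] at this

/-- Orthogonality to `u` reads e⁰u⁰ = e⃗·u⃗. Cauchy–Schwarz with e⃗² = 1 + (e⁰)² and u⃗² = (u⁰)² - 1
gives (e⁰)² ≤ (u⁰)² - 1, hence a bound on every component. Orthogonality thus makes the support of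
`c` bounded. -/
theorem Strings.coord_le (s : Strings) {e : M} (he : s.c e ≠ 0) (ν : Fin 4) :
    |e ν| ≤ |s.u 0| := by
  obtain ⟨h1, h2⟩ := s.support_c e he
  have h3 := s.u_unit
  simp only [mdot, Fin.sum_univ_four, eta] at h1 h2 h3
  simp at h1 h2 h3
  have hcs : (e 0 * s.u 0) ^ 2 ≤
      (e 1 ^ 2 + e 2 ^ 2 + e 3 ^ 2) * (s.u 1 ^ 2 + s.u 2 ^ 2 + s.u 3 ^ 2) := by
    have : e 0 * s.u 0 = e 1 * s.u 1 + e 2 * s.u 2 + e 3 * s.u 3 := by linarith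
    rw [this]
    -- These are the squares in Lagrange's identity.
    nlinarith [sq_nonneg (e 1 * s.u 2 - e 2 * s.u 1), sq_nonneg (e 1 * s.u 3 - e 3 * s.u 1),
      sq_nonneg (e 2 * s.u 3 - e 3 * s.u 2)]
  have ha : e 1 ^ 2 + e 2 ^ 2 + e 3 ^ 2 = 1 + e 0 ^ 2 := by nlinarith
  have hb : s.u 1 ^ 2 + s.u 2 ^ 2 + s.u 3 ^ 2 = s.u 0 ^ 2 - 1 := by nlinarith
  rw [ha, hb] at hcs
  have h0 : e 0 ^ 2 ≤ s.u 0 ^ 2 - 1 := by nlinarith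
  apply sq_le_sq.mp
  fin_cases ν <;> simp <;> nlinarith [sq_nonneg (e 1), sq_nonneg (e 2), sq_nonneg (e 3)]

/-- The spatial squares add up to at least 1, so some component is at least 1/√3 > 1/2 in modulus.
The distance from zero bounds the time that a ray spends in a compact set. -/
theorem Strings.half_le_norm (s : Strings) {e : M} (he : s.c e ≠ 0) : 1 / 2 ≤ ‖e‖ := by
  obtain ⟨h1, -⟩ := s.support_c e he
  simp only [mdot, Fin.sum_univ_four, eta] at h1
  simp at h1
  by_contra! h
  have hk : ∀ i, e i ^ 2 ≤ 1 / 4 := fun i => by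
    have h2 : |e i| < 1 / 2 := (norm_le_pi_norm e i).trans_lt h
    nlinarith [abs_nonneg (e i), sq_abs (e i)]
  nlinarith [hk 1, hk 2, hk 3, sq_nonneg (e 0)]

section Ray
variable {P : Type*} [TopologicalSpace P]

theorem exists_ball_of_hasCompactSupport {Φ : P × M → ℂ} (hc : HasCompactSupport Φ) :
    ∃ R : ℝ, 0 < R ∧ ∀ y e, R < ‖e‖ → Φ (y, e) = 0 := by
  have hb : Bornology.IsBounded (Prod.snd '' tsupport Φ) :=
    (hc.isCompact.image continuous_snd).isBounded
  obtain ⟨R, hR0, hR⟩ := hb.exists_pos_norm_le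
  refine ⟨R, hR0, fun y e h => ?_⟩
  by_contra h0
  exact absurd (hR e ⟨(y, e), subset_tsupport _ h0, rfl⟩) (not_le.mpr h)

/-- A ray whose direction has norm at least `ε` leaves the ball of radius `R` by the parameter value
`R / ε`, uniformly in `y` and `e`. -/
theorem exists_bound_ray {Φ : P × M → ℂ} (hΦ : Continuous Φ) (hc : HasCompactSupport Φ) {ε : ℝ}
    (hε : 0 < ε) :
    ∃ C : ℝ, 0 ≤ C ∧ ∀ y e, ε ≤ ‖e‖ → ‖∫ t in Set.Ioi (0 : ℝ), Φ (y, t • e)‖ ≤ C := by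
  obtain ⟨R, hR0, hR⟩ := exists_ball_of_hasCompactSupport hc
  obtain ⟨C, hC⟩ := hΦ.bounded_above_of_compact_support hc
  refine ⟨|C| * (R / ε), by positivity, fun y e he => ?_⟩
  have h1 : ∫ t in Set.Ioi (0 : ℝ), Φ (y, t • e) = ∫ t in Set.Ioc 0 (R / ε), Φ (y, t • e) := by
    refine (setIntegral_eq_of_subset_of_forall_sdiff_eq_zero measurableSet_Ioi
      Set.Ioc_subset_Ioi_self ?_)
    rintro t ⟨ht, ht'⟩
    apply hR
    have ht0 : (0 : ℝ) < t := ht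
    have h2 : R / ε < t := by
      by_contra! h
      exact ht' ⟨ht0, h⟩
    rw [norm_smul, Real.norm_of_nonneg ht0.le]
    calc R = R / ε * ε := by field_simp
      _ < t * ε := by gcongr
      _ ≤ t * ‖e‖ := by gcongr
  rw [h1]
  refine (norm_setIntegral_le_of_norm_le_const (C := |C|) (by simp)
    (fun t _ => (hC _).trans (le_abs_self C))).trans ?_
  simp [measureReal_def, ENNReal.toReal_ofReal (div_pos hR0 hε).le]

theorem continuous_ray {Φ : P × M → ℂ} (hΦ : Continuous Φ) (hc : HasCompactSupport Φ) {e : M}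
    (he : e ≠ 0) : Continuous fun y => ∫ t in Set.Ioi (0 : ℝ), Φ (y, t • e) := by
  obtain ⟨R, -, hR⟩ := exists_ball_of_hasCompactSupport hc
  have he' : 0 < ‖e‖ := norm_pos_iff.mpr he
  rw [← continuousOn_univ]
  apply continuousOn_integral_of_compact_support (f := fun y (t : ℝ) => Φ (y, t • e))
    (isCompact_closedBall (0 : ℝ) (R / ‖e‖))
  · apply Continuous.continuousOn
    change Continuous fun p : P × ℝ => Φ (p.1, p.2 • e)
    fun_prop
  · intro y t _ ht
    apply hR
    rw [mem_closedBall_zero_iff, not_le, div_lt_iff₀ he'] at ht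
    rwa [norm_smul]

theorem integrableOn_ray {g : M → ℂ} (hg : Continuous g) (hc : HasCompactSupport g) {e : M}
    (he : e ≠ 0) : IntegrableOn (fun t : ℝ => g (t • e)) (Set.Ioi 0) := by
  apply Integrable.integrableOn
  apply Continuous.integrable_of_hasCompactSupport (by fun_prop)
  exact hc.comp_isClosedEmbedding (isClosedEmbedding_smul_left he)

/-- The right-hand side is the dominating function for the integral over string directions, both for
integrability and for continuity in parameters. -/
theorem norm_c_smul_le (s : Strings) (ν : Fin 4) {C : ℝ} {z : M → ℂ}
    (hC : ∀ e, 1 / 2 ≤ ‖e‖ → ‖z e‖ ≤ C) (e : M) :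
    ‖((s.c e * e ν : ℝ) : ℂ) * z e‖ ≤ ‖s.c e‖ * (|s.u 0| * C) := by
  by_cases h : s.c e = 0
  · simp [h]
  · rw [norm_mul, Complex.norm_real, norm_mul, mul_assoc]
    gcongr
    · exact s.coord_le h ν
    · exact hC e (s.half_le_norm h)

theorem aestronglyMeasurable_string (s : Strings) (ν : Fin 4) {g : M → ℂ} (hg : Continuous g) :
    AEStronglyMeasurable (fun e : M =>
      ((s.c e * e ν : ℝ) : ℂ) * ∫ t in Set.Ioi (0 : ℝ), g (t • e)) s.σ := by
  apply AEStronglyMeasurable.mul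
  · exact Complex.continuous_ofReal.comp_aestronglyMeasurable
      (s.integrable_c.aestronglyMeasurable.mul (continuous_apply ν).aestronglyMeasurable)
  · apply StronglyMeasurable.aestronglyMeasurable
    have h : StronglyMeasurable fun p : M × ℝ => g (p.2 • p.1) :=
      (hg.comp (continuous_snd.smul continuous_fst)).stronglyMeasurable
    exact h.integral_prod_right' (ν := volume.restrict (Set.Ioi (0 : ℝ)))

theorem kerVal_zero (s : Strings) (k : Ker) : kerVal s k (fun _ => 0) = 0 := by
  cases k <;> simp [kerVal]

theorem kerVal_const_mul (s : Strings) (k : Ker) (r : ℂ) (g : M → ℂ) :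
    kerVal s k (fun y => r * g y) = r * kerVal s k g := by
  cases k with
  | delta => rfl
  | Ic ν =>
    simp only [kerVal]
    rw [← integral_const_mul]
    congr 1 with e
    rw [integral_const_mul]; ring
  | Iu ν =>
    simp only [kerVal]
    rw [integral_const_mul]; ring

/-- The Bochner integral is additive only on integrable functions, so both the ray integral and the
integral over directions have to converge. -/
theorem kerVal_add (s : Strings) (k : Ker) {g₁ g₂ : M → ℂ} (h₁ : Continuous g₁)
    (c₁ : HasCompactSupport g₁) (h₂ : Continuous g₂) (c₂ : HasCompactSupport g₂) :
    kerVal s k (fun y => g₁ y + g₂ y) = kerVal s k g₁ + kerVal s k g₂ := by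
  cases k with
  | delta => rfl
  | Ic ν =>
    have hint : ∀ {g : M → ℂ}, Continuous g → HasCompactSupport g → Integrable (fun e : M =>
        ((s.c e * e ν : ℝ) : ℂ) * ∫ t in Set.Ioi (0 : ℝ), g (t • e)) s.σ := by
      intro g hg cg
      -- There is no parameter here, so a one-point parameter space is inserted.
      obtain ⟨C, -, hC⟩ := exists_bound_ray (P := Unit) (Φ := fun p => g p.2) (by fun_prop)
        (cg.comp_isClosedEmbedding (Homeomorph.punitProd M).isClosedEmbedding)
        (ε := 1 / 2) (by norm_num)
      exact (s.integrable_c.norm.mul_const (|s.u 0| * C)).mono'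
        (aestronglyMeasurable_string s ν hg)
        (Filter.Eventually.of_forall (norm_c_smul_le s ν fun e he => hC () e he))
    simp only [kerVal]
    rw [← integral_add (hint h₁ c₁) (hint h₂ c₂)]
    congr 1 with e
    by_cases h : s.c e = 0
    · simp [h]
    · have he : e ≠ 0 := by
        intro h0
        have := s.half_le_norm h
        simp [h0] at this
        linarith
      rw [integral_add (integrableOn_ray h₁ c₁ he) (integrableOn_ray h₂ c₂ he)]
      ring
  | Iu ν =>
    simp only [kerVal]
    rw [integral_add (integrableOn_ray h₁ c₁ s.u_ne_zero) (integrableOn_ray h₂ c₂ s.u_ne_zero)]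
    ring

/-- Together with `hasCompactSupport_kerVal` this allows a second kernel to act on the result of the
first. -/
theorem continuous_kerVal [FirstCountableTopology P] (s : Strings) (k : Ker) {Φ : P × M → ℂ}
    (hΦ : Continuous Φ) (hc : HasCompactSupport Φ) :
    Continuous fun y => kerVal s k fun y' => Φ (y, y') := by
  cases k with
  | delta => simp only [kerVal]; fun_prop
  | Ic ν =>
    obtain ⟨C, hC0, hC⟩ := exists_bound_ray hΦ hc (ε := 1 / 2) (by norm_num)
    simp only [kerVal]
    apply continuous_of_dominated (bound := fun e => ‖s.c e‖ * (|s.u 0| * C))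
    · intro y
      exact aestronglyMeasurable_string s ν (g := fun y' => Φ (y, y')) (by fun_prop)
    · intro y
      exact Filter.Eventually.of_forall (norm_c_smul_le s ν fun e he => hC y e he)
    · exact s.integrable_c.norm.mul_const _
    · refine Filter.Eventually.of_forall fun e => ?_
      by_cases h : s.c e = 0
      · simp only [h, zero_mul, Complex.ofReal_zero]; exact continuous_const
      · refine continuous_const.mul (continuous_ray hΦ hc ?_)
        intro h0
        have := s.half_le_norm h
        simp [h0] at this
        linarith
  | Iu ν =>
    simp only [kerVal]
    exact continuous_const.mul (continuous_ray hΦ hc s.u_ne_zero)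

theorem hasCompactSupport_kerVal [T2Space P] (s : Strings) (k : Ker) {Φ : P × M → ℂ}
    (hc : HasCompactSupport Φ) :
    HasCompactSupport fun y => kerVal s k fun y' => Φ (y, y') := by
  apply HasCompactSupport.intro (hc.isCompact.image continuous_fst)
  intro y hy
  have : (fun y' => Φ (y, y')) = fun _ => 0 := by
    funext y'
    by_contra h0
    exact hy ⟨(y, y'), subset_tsupport _ h0, rfl⟩
  rw [this, kerVal_zero]

end Ray

end SQCD

namespace SQCD

/-! ### Products of two kernels -/

/-- Two edges which connect the three points. -/
def Linked (a b : Edge) : Prop :=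
  a.src ≠ a.dst ∧ b.src ≠ b.dst ∧ s(a.src, a.dst) ≠ s(b.src, b.dst)

/-- Smooth functions of compact support. -/
structure IsTest (g : (Fin 3 → M) → ℂ) : Prop where
  smooth : ContDiff ℝ ∞ g
  compact : HasCompactSupport g

/-- The word of two edges. -/
def word (a b : Edge) : FreeMonoid Edge := FreeMonoid.of a * FreeMonoid.of b

/-- `place` as a continuous linear map. -/
noncomputable def placeL (a b : Edge) : M × M × M →L[ℝ] (Fin 3 → M) :=
  LinearMap.toContinuousLinearMap
    { toFun := fun q => place a b q.1 q.2.1 q.2.2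
      map_add' := by
        intro q q'
        funext p
        simp only [place, Prod.fst_add, Prod.snd_add, Pi.add_apply]
        split_ifs <;> abel
      map_smul' := by
        intro r q
        funext p
        simp only [place, Prod.smul_fst, Prod.smul_snd, Pi.smul_apply, RingHom.id_apply]
        split_ifs <;> simp [smul_add, smul_sub] }

@[simp] theorem placeL_apply (a b : Edge) (z y y' : M) :
    placeL a b (z, y, y') = place a b z y y' := rfl

theorem place_src (a b : Edge) (z y y' : M) : place a b z y y' a.src = z := by simp [place]

theorem place_dst {a b : Edge} (h : Linked a b) (z y y' : M) :
    place a b z y y' a.dst = z + y := by simp [place, h.1.symm]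

theorem place_sub {a b : Edge} (h : Linked a b) (z y y' : M) :
    place a b z y y' b.dst - place a b z y y' b.src = y' := by
  obtain ⟨sa, ta, ka, da⟩ := a
  obtain ⟨sb, tb, kb, db⟩ := b
  obtain ⟨h1, h2, h3⟩ := h
  simp only [ne_eq, Sym2.eq_iff] at h1 h2 h3
  simp only [place]
  fin_cases sa <;> fin_cases ta <;> fin_cases sb <;> fin_cases tb <;> simp_all

/-- For linked edges the base point and the two difference variables are recovered continuously from
the three points, so compactness of the support survives the change of variables. -/
theorem IsTest.comp_placeL {a b : Edge} (h : Linked a b) {g : (Fin 3 → M) → ℂ} (hg : IsTest g) :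
    HasCompactSupport fun q => g (placeL a b q) := by
  let inv : (Fin 3 → M) → M × M × M := fun x => (x a.src, x a.dst - x a.src, x b.dst - x b.src)
  have hinv : Continuous inv := by fun_prop
  apply HasCompactSupport.intro (hg.compact.isCompact.image hinv)
  rintro ⟨z, y, y'⟩ hq
  by_contra h0
  refine hq ⟨place a b z y y', subset_tsupport _ h0, ?_⟩
  simp only [inv, place_src, place_dst h, place_sub h, add_sub_cancel_left]

/-- The derivative in the direction `v`. -/
noncomputable def dirD (v : Fin 3 → M) (g : (Fin 3 → M) → ℂ) (x : Fin 3 → M) : ℂ := fderiv ℝ g x v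

theorem IsTest.dirD {g : (Fin 3 → M) → ℂ} (hg : IsTest g) (v : Fin 3 → M) : IsTest (dirD v g) :=
  ⟨(hg.smooth.fderiv_right (m := ∞) (by simp)).clm_apply contDiff_const,
    hg.compact.fderiv_apply ℝ v⟩

theorem IsTest.differentiable {g : (Fin 3 → M) → ℂ} (hg : IsTest g) : Differentiable ℝ g :=
  hg.smooth.differentiable (by simp)

theorem IsTest.add {g₁ g₂ : (Fin 3 → M) → ℂ} (h₁ : IsTest g₁) (h₂ : IsTest g₂) :
    IsTest fun x => g₁ x + g₂ x :=
  ⟨h₁.smooth.add h₂.smooth, h₁.compact.add h₂.compact⟩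

theorem IsTest.const_mul {g : (Fin 3 → M) → ℂ} (h : IsTest g) (r : ℂ) :
    IsTest fun x => r * g x :=
  ⟨contDiff_const.mul h.smooth, h.compact.mul_left⟩

theorem dirD_add {g₁ g₂ : (Fin 3 → M) → ℂ} (h₁ : IsTest g₁) (h₂ : IsTest g₂) (v : Fin 3 → M) :
    dirD v (fun x => g₁ x + g₂ x) = fun x => dirD v g₁ x + dirD v g₂ x := by
  funext x
  simp only [dirD]
  rw [fderiv_fun_add h₁.differentiable.differentiableAt h₂.differentiable.differentiableAt]
  rfl

theorem dirD_const_mul {g : (Fin 3 → M) → ℂ} (h : IsTest g) (r : ℂ) (v : Fin 3 → M) :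
    dirD v (fun x => r * g x) = fun x => r * dirD v g x := by
  funext x
  simp only [dirD]
  rw [fderiv_const_mul h.differentiable.differentiableAt]
  rfl

/-- Derivative along the image of an optional unit vector under `v`. -/
noncomputable def optD (v : M → Fin 3 → M) :
    Option (Fin 4) → ((Fin 3 → M) → ℂ) → (Fin 3 → M) → ℂ
  | none, g => g
  | some κ, g => dirD (v (Pi.single κ 1)) g

theorem IsTest.optD {g : (Fin 3 → M) → ℂ} (hg : IsTest g) (v : M → Fin 3 → M)
    (o : Option (Fin 4)) : IsTest (optD v o g) := by
  cases o with
  | none => exact hg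
  | some κ => exact hg.dirD _

theorem optD_add {g₁ g₂ : (Fin 3 → M) → ℂ} (h₁ : IsTest g₁) (h₂ : IsTest g₂)
    (v : M → Fin 3 → M) (o : Option (Fin 4)) :
    optD v o (fun x => g₁ x + g₂ x) = fun x => optD v o g₁ x + optD v o g₂ x := by
  cases o with
  | none => rfl
  | some κ => exact dirD_add h₁ h₂ _

theorem optD_const_mul {g : (Fin 3 → M) → ℂ} (h : IsTest g) (r : ℂ) (v : M → Fin 3 → M)
    (o : Option (Fin 4)) : optD v o (fun x => r * g x) = fun x => r * optD v o g x := by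
  cases o with
  | none => rfl
  | some κ => exact dirD_const_mul h r _

theorem derVal_snd (a b : Edge) {g : (Fin 3 → M) → ℂ} (hg : Differentiable ℝ g)
    (o : Option (Fin 4)) (z y y' : M) :
    derVal o (fun y₂ => g (place a b z y y₂)) y' =
      optD (fun v => placeL a b (0, 0, v)) o g (place a b z y y') := by
  cases o with
  | none => rfl
  | some κ =>
    have h1 : HasFDerivAt (fun y₂ : M => (z, y, y₂))
        ((0 : M →L[ℝ] M).prod ((0 : M →L[ℝ] M).prod (ContinuousLinearMap.id ℝ M))) y' :=
      (hasFDerivAt_const z y').prodMk ((hasFDerivAt_const y y').prodMk (hasFDerivAt_id y'))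
    have h2 := (hg (placeL a b (z, y, y'))).hasFDerivAt.comp y'
      ((placeL a b).hasFDerivAt.comp y' h1)
    exact congrArg (fun L => L (Pi.single κ 1)) h2.fderiv

theorem derVal_fst (a b : Edge) {g : (Fin 3 → M) → ℂ} (hg : Differentiable ℝ g)
    (o : Option (Fin 4)) (z y y' : M) :
    derVal o (fun y₁ => g (place a b z y₁ y')) y =
      optD (fun v => placeL a b (0, v, 0)) o g (place a b z y y') := by
  cases o with
  | none => rfl
  | some κ =>
    have h1 : HasFDerivAt (fun y₁ : M => (z, y₁, y'))
        ((0 : M →L[ℝ] M).prod ((ContinuousLinearMap.id ℝ M).prod (0 : M →L[ℝ] M))) y :=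
      (hasFDerivAt_const z y).prodMk ((hasFDerivAt_id y).prodMk (hasFDerivAt_const y' y))
    have h2 := (hg (placeL a b (z, y, y'))).hasFDerivAt.comp y
      ((placeL a b).hasFDerivAt.comp y h1)
    exact congrArg (fun L => L (Pi.single κ 1)) h2.fderiv

/-- The pairing of two kernels without derivatives. -/
noncomputable def linkVal (s : Strings) (a b : Edge) (g : (Fin 3 → M) → ℂ) : ℂ :=
  kerVal s a.ker fun y => kerVal s b.ker fun y' => ∫ z : M, g (place a b z y y')

theorem wordVal_eq (s : Strings) {a b : Edge} (h : Linked a b) (g : (Fin 3 → M) → ℂ) :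
    wordVal s (word a b) g = kerVal s a.ker fun y => kerVal s b.ker fun y' =>
        ∫ z : M, derVal a.der (fun y₁ => derVal b.der (fun y₂ => g (place a b z y₁ y₂)) y') y :=
  if_pos h

theorem wordVal_of_not_linked (s : Strings) {a b : Edge} (h : ¬ Linked a b)
    (g : (Fin 3 → M) → ℂ) : wordVal s (word a b) g = 0 := if_neg h

/-- By the chain rule the derivatives in the difference variables are directional derivatives of the
test function itself, which leaves a pairing with underived kernels. -/
theorem wordVal_eq_linkVal (s : Strings) {a b : Edge} (h : Linked a b) {g : (Fin 3 → M) → ℂ}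
    (hg : IsTest g) :
    wordVal s (word a b) g = linkVal s a b (optD (fun v => placeL a b (0, v, 0)) a.der
      (optD (fun v => placeL a b (0, 0, v)) b.der g)) := by
  rw [wordVal_eq s h, linkVal]
  simp only [derVal_snd a b hg.differentiable, derVal_fst a b (hg.optD _ _).differentiable]

section LinkVal
variable {a b : Edge} {g : (Fin 3 → M) → ℂ}

theorem IsTest.continuous_slice (hg : IsTest g) (h : Linked a b) :
    Continuous fun p : M × M => ∫ z : M, g (place a b z p.1 p.2) := by
  have hc := hg.comp_placeL h
  rw [← continuousOn_univ]
  apply continuousOn_integral_of_compact_support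
    (f := fun (p : M × M) (z : M) => g (place a b z p.1 p.2)) (hc.isCompact.image continuous_fst)
  · apply Continuous.continuousOn
    have : Continuous fun q : (M × M) × M => g (placeL a b (q.2, q.1.1, q.1.2)) :=
      hg.smooth.continuous.comp ((placeL a b).continuous.comp (by fun_prop))
    exact this
  · intro p z _ hz
    by_contra h0
    exact hz ⟨(z, p.1, p.2), subset_tsupport _ h0, rfl⟩

theorem IsTest.compact_slice (hg : IsTest g) (h : Linked a b) :
    HasCompactSupport fun p : M × M => ∫ z : M, g (place a b z p.1 p.2) := by
  have hc := hg.comp_placeL h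
  apply HasCompactSupport.intro (hc.isCompact.image continuous_snd)
  intro p hp
  have : (fun z => g (place a b z p.1 p.2)) = fun _ => 0 := by
    funext z
    by_contra h0
    exact hp ⟨(z, p.1, p.2), subset_tsupport _ h0, rfl⟩
  rw [this, integral_zero]

theorem IsTest.integrable_translate (hg : IsTest g) (c : Fin 3 → M) :
    Integrable fun z : M => g fun p => z + c p := by
  apply Continuous.integrable_of_hasCompactSupport
  · exact hg.smooth.continuous.comp (by fun_prop)
  · apply HasCompactSupport.intro
      (hg.compact.isCompact.image (f := fun x : Fin 3 → M => x 0 - c 0) (by fun_prop))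
    intro z hz
    by_contra h0
    exact hz ⟨_, subset_tsupport _ h0, by simp⟩

/-- Translation covariance: the base point shifts all three points together. -/
theorem place_eq_add (a b : Edge) (z y y' : M) :
    place a b z y y' = fun p => z + place a b 0 y y' p := by
  have h := (placeL a b).map_add (z, 0, 0) (0, y, y')
  simp only [Prod.mk_add_mk, add_zero, zero_add, placeL_apply] at h
  rw [h]
  funext p
  simp only [Pi.add_apply]
  congr 1
  simp only [place]
  split_ifs <;> simp

theorem IsTest.integrable_place (hg : IsTest g) (y y' : M) :
    Integrable fun z : M => g (place a b z y y') := by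
  have : (fun z : M => g (place a b z y y')) = fun z => g fun p => z + place a b 0 y y' p := by
    funext z
    rw [place_eq_add]
  rw [this]
  exact hg.integrable_translate _

theorem hasCompactSupport_slice {Φ : M × M → ℂ} (hc : HasCompactSupport Φ) (y : M) :
    HasCompactSupport fun y' => Φ (y, y') := by
  apply HasCompactSupport.intro (hc.isCompact.image continuous_snd)
  intro y' hy
  by_contra h0
  exact hy ⟨(y, y'), subset_tsupport _ h0, rfl⟩

theorem linkVal_add (s : Strings) (h : Linked a b) {g₁ g₂ : (Fin 3 → M) → ℂ} (h₁ : IsTest g₁)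
    (h₂ : IsTest g₂) :
    linkVal s a b (fun x => g₁ x + g₂ x) = linkVal s a b g₁ + linkVal s a b g₂ := by
  have hs : ∀ {g : (Fin 3 → M) → ℂ}, IsTest g → ∀ y,
      Continuous (fun y' => ∫ z : M, g (place a b z y y')) ∧
      HasCompactSupport (fun y' => ∫ z : M, g (place a b z y y')) := fun {g} hg y =>
    ⟨(hg.continuous_slice h).comp (by fun_prop : Continuous fun y' : M => (y, y')),
      hasCompactSupport_slice (Φ := fun p => ∫ z : M, g (place a b z p.1 p.2))
        (hg.compact_slice h) y⟩
  have ht : ∀ {g : (Fin 3 → M) → ℂ}, IsTest g →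
      Continuous (fun y => kerVal s b.ker fun y' => ∫ z : M, g (place a b z y y')) ∧
      HasCompactSupport (fun y => kerVal s b.ker fun y' => ∫ z : M, g (place a b z y y')) :=
    fun {g} hg =>
    ⟨continuous_kerVal s b.ker (Φ := fun p : M × M => ∫ z : M, g (place a b z p.1 p.2))
        (hg.continuous_slice h) (hg.compact_slice h),
      hasCompactSupport_kerVal s b.ker (Φ := fun p : M × M => ∫ z : M, g (place a b z p.1 p.2))
        (hg.compact_slice h)⟩
  simp only [linkVal]
  rw [← kerVal_add s a.ker (ht h₁).1 (ht h₁).2 (ht h₂).1 (ht h₂).2]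
  congr 1
  funext y
  rw [← kerVal_add s b.ker (hs h₁ y).1 (hs h₁ y).2 (hs h₂ y).1 (hs h₂ y).2]
  congr 1
  funext y'
  exact integral_add (h₁.integrable_place y y') (h₂.integrable_place y y')

theorem linkVal_const_mul (s : Strings) (a b : Edge) (r : ℂ) (g : (Fin 3 → M) → ℂ) :
    linkVal s a b (fun x => r * g x) = r * linkVal s a b g := by
  simp only [linkVal, integral_const_mul, kerVal_const_mul]

end LinkVal

/-- Other words evaluate to zero by definition, so linearity has to be checked only for linked
pairs. -/
theorem wordVal_cases (s : Strings) (w : FreeMonoid Edge) :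
    (∃ a b, w = word a b ∧ Linked a b) ∨ ∀ g, wordVal s w g = 0 := by
  by_cases h : ∃ a b, w = word a b ∧ Linked a b
  · exact Or.inl h
  · right
    intro g
    by_contra h0
    apply h
    unfold wordVal at h0
    split at h0
    · rename_i a b hw
      split_ifs at h0 with hl
      · exact ⟨a, b, FreeMonoid.toList.injective hw, hl⟩
      · exact absurd rfl h0
    · exact absurd rfl h0

theorem wordVal_add (s : Strings) (w : FreeMonoid Edge) {g₁ g₂ : (Fin 3 → M) → ℂ}
    (h₁ : IsTest g₁) (h₂ : IsTest g₂) :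
    wordVal s w (fun x => g₁ x + g₂ x) = wordVal s w g₁ + wordVal s w g₂ := by
  rcases wordVal_cases s w with ⟨a, b, rfl, h⟩ | h0
  · rw [wordVal_eq_linkVal s h h₁, wordVal_eq_linkVal s h h₂,
      wordVal_eq_linkVal s h (h₁.add h₂), optD_add h₁ h₂,
      optD_add (h₁.optD _ _) (h₂.optD _ _), linkVal_add s h ((h₁.optD _ _).optD _ _)
        ((h₂.optD _ _).optD _ _)]
  · simp [h0]

theorem wordVal_const_mul (s : Strings) (w : FreeMonoid Edge) (r : ℂ) {g : (Fin 3 → M) → ℂ}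
    (hg : IsTest g) : wordVal s w (fun x => r * g x) = r * wordVal s w g := by
  rcases wordVal_cases s w with ⟨a, b, rfl, h⟩ | h0
  · rw [wordVal_eq_linkVal s h hg, wordVal_eq_linkVal s h (hg.const_mul r), optD_const_mul hg,
      optD_const_mul (hg.optD _ _), linkVal_const_mul]
  · simp [h0]

theorem wordVal_zero (s : Strings) (w : FreeMonoid Edge) : wordVal s w (fun _ => 0) = 0 := by
  have : IsTest fun _ => 0 := ⟨contDiff_const, HasCompactSupport.zero⟩
  simpa using wordVal_const_mul s w 0 this

theorem wordVal_neg (s : Strings) (w : FreeMonoid Edge) {g : (Fin 3 → M) → ℂ}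
    (hg : IsTest g) : wordVal s w (fun x => -g x) = -wordVal s w g := by
  simpa using wordVal_const_mul s w (-1) hg

theorem IsTest.sum {ι : Type*} (t : Finset ι) {g : ι → (Fin 3 → M) → ℂ}
    (hg : ∀ i ∈ t, IsTest (g i)) : IsTest fun x => ∑ i ∈ t, g i x := by
  classical
  induction t using Finset.induction_on with
  | empty => exact ⟨by simpa using contDiff_const, HasCompactSupport.zero⟩
  | insert i t hi ih =>
    simp only [Finset.sum_insert hi]
    exact (hg i (by simp)).add (ih fun j hj => hg j (by simp [hj]))

theorem wordVal_sum (s : Strings) (w : FreeMonoid Edge) {ι : Type*} (t : Finset ι)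
    {g : ι → (Fin 3 → M) → ℂ} (hg : ∀ i ∈ t, IsTest (g i)) :
    wordVal s w (fun x => ∑ i ∈ t, g i x) = ∑ i ∈ t, wordVal s w (g i) := by
  classical
  induction t using Finset.induction_on with
  | empty => simpa using wordVal_zero s w
  | insert i t hi ih =>
    simp only [Finset.sum_insert hi]
    rw [wordVal_add s w (hg i (by simp)) (IsTest.sum t fun j hj => hg j (by simp [hj])),
      ih fun j hj => hg j (by simp [hj])]

/-! ### Derivative kernels at the third point -/

/-- When `b` ends at the point that `a` does not touch, its difference variable moves that point
alone. If `b` starts there instead, the point moves in the opposite direction. -/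
theorem place_single_dst {a b : Edge} (h : Linked a b) (h₁ : b.dst ≠ a.src) (h₂ : b.dst ≠ a.dst)
    (v : M) : place a b 0 0 v = Pi.single b.dst v := by
  obtain ⟨sa, ta, ka, da⟩ := a
  obtain ⟨sb, tb, kb, db⟩ := b
  obtain ⟨h3, h4, h5⟩ := h
  simp only [ne_eq, Sym2.eq_iff] at *
  funext p
  simp only [place]
  fin_cases sa <;> fin_cases ta <;> fin_cases tb <;> fin_cases p <;> simp_all

theorem place_single_src {a b : Edge} (h : Linked a b) (h₁ : b.src ≠ a.src) (h₂ : b.src ≠ a.dst)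
    (v : M) : place a b 0 0 v = Pi.single b.src (-v) := by
  obtain ⟨sa, ta, ka, da⟩ := a
  obtain ⟨sb, tb, kb, db⟩ := b
  obtain ⟨h3, h4, h5⟩ := h
  simp only [ne_eq, Sym2.eq_iff] at *
  funext p
  simp only [place]
  fin_cases sa <;> fin_cases ta <;> fin_cases sb <;> fin_cases tb <;> fin_cases p <;> simp_all

/-- The derivative `∂_κ` with respect to the point `x_r`. -/
noncomputable def ptD (r : Fin 3) (κ : Fin 4) : ((Fin 3 → M) → ℂ) → (Fin 3 → M) → ℂ :=
  dirD (Pi.single r (Pi.single κ 1))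

theorem IsTest.ptD {g : (Fin 3 → M) → ℂ} (hg : IsTest g) (r : Fin 3) (κ : Fin 4) :
    IsTest (ptD r κ g) := hg.dirD _

/-- The difference variable of the second kernel moves only `r`. The sign is positive because the
derivative at the source is minus the one in the difference variable, and integration by parts
brings another minus; if `r` is the source, one more sign appears. -/
theorem wordVal_der_dst (s : Strings) (a : Edge) (p r : Fin 3) (k : Ker) (κ : Fin 4)
    {g : (Fin 3 → M) → ℂ} (hg : IsTest g) (h₁ : r ≠ a.src) (h₂ : r ≠ a.dst) :
    wordVal s (word a ⟨p, r, k, some κ⟩) g =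
      wordVal s (word a ⟨p, r, k, none⟩) (ptD r κ g) := by
  by_cases h : Linked a ⟨p, r, k, none⟩
  · have h' : Linked a ⟨p, r, k, some κ⟩ := h
    rw [wordVal_eq s h, wordVal_eq s h']
    simp only [derVal_snd a _ hg.differentiable, derVal_snd a _ (hg.dirD _).differentiable, optD,
      placeL_apply, ptD]
    rw [place_single_dst h' h₁ h₂]
    rfl
  · rw [wordVal_of_not_linked s h, wordVal_of_not_linked s (a := a) (b := ⟨p, r, k, some κ⟩) h]

theorem wordVal_der_src (s : Strings) (a : Edge) (p r : Fin 3) (k : Ker) (κ : Fin 4)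
    {g : (Fin 3 → M) → ℂ} (hg : IsTest g) (h₁ : r ≠ a.src) (h₂ : r ≠ a.dst) :
    wordVal s (word a ⟨r, p, k, some κ⟩) g =
      -wordVal s (word a ⟨r, p, k, none⟩) (ptD r κ g) := by
  by_cases h : Linked a ⟨r, p, k, none⟩
  · have h' : Linked a ⟨r, p, k, some κ⟩ := h
    have e : optD (fun v => placeL a ⟨r, p, k, some κ⟩ (0, 0, v)) (some κ) g =
        fun x => -ptD r κ g x := by
      funext x
      simp only [optD, placeL_apply, ptD, dirD]
      rw [place_single_src h' h₁ h₂, Pi.single_neg, map_neg]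
    rw [← wordVal_neg s _ (g := ptD r κ g) (hg.dirD _), wordVal_eq s h, wordVal_eq s h']
    simp only [derVal_snd a _ hg.differentiable, e]
    rfl
  · rw [wordVal_of_not_linked s h, wordVal_of_not_linked s (a := a) (b := ⟨r, p, k, some κ⟩) h,
      neg_zero]

/-! ### Relabelling of the points -/

/-- Relabelling of the end points of an edge. -/
def Edge.map (τ : Equiv.Perm (Fin 3)) (e : Edge) : Edge := ⟨τ e.src, τ e.dst, e.ker, e.der⟩

theorem place_map (τ : Equiv.Perm (Fin 3)) (a b : Edge) (z y y' : M) :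
    place (a.map τ) (b.map τ) z y y' = place a b z y y' ∘ τ.symm := by
  funext p
  simp only [place, Edge.map, Function.comp_apply, Equiv.symm_apply_eq, τ.injective.eq_iff,
    eq_comm (a := p)]

theorem wordVal_map (s : Strings) (τ : Equiv.Perm (Fin 3)) (w : FreeMonoid Edge)
    (g : (Fin 3 → M) → ℂ) :
    wordVal s (FreeMonoid.map (Edge.map τ) w) g = wordVal s w fun x => g (x ∘ τ.symm) := by
  unfold wordVal
  rw [FreeMonoid.toList_map]
  generalize w.toList = l
  match l with
  | [] => rfl
  | [_] => rfl
  | [a, b] =>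
    simp only [List.map, place_map]
    simp only [Edge.map, ne_eq, Sym2.eq_iff, τ.injective.eq_iff]
  | _ :: _ :: _ :: _ => rfl

/-! ### Words with a local kernel -/

/-- A common translation of the three points is a translation of the integration variable, so this
is the integral of a derivative, evaluated by parts against the constant function 1. -/
theorem IsTest.integral_dirD_const {g : (Fin 3 → M) → ℂ} (hg : IsTest g) (v : M) (c : Fin 3 → M) :
    ∫ z : M, SQCD.dirD (fun _ => v) g (fun p => z + c p) = 0 := by
  have hd : ∀ z : M, HasFDerivAt (fun z : M => g fun p => z + c p)
      ((fderiv ℝ g fun p => z + c p).comp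
        (ContinuousLinearMap.pi fun _ => ContinuousLinearMap.id ℝ M)) z := by
    intro z
    apply (hg.differentiable _).hasFDerivAt.comp z
    rw [hasFDerivAt_pi']
    intro p
    exact (hasFDerivAt_id z).add_const _
  have he : (fun z : M => SQCD.dirD (fun _ => v) g (fun p => z + c p)) =
      fun z => fderiv ℝ (fun z : M => g fun p => z + c p) z v := by
    funext z
    rw [(hd z).fderiv]
    rfl
  have h := integral_mul_fderiv_eq_neg_fderiv_mul_of_integrable (μ := (volume : Measure M))
    (f := fun _ : M => (1 : ℂ)) (g := fun z : M => g fun p => z + c p) (v := v)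
    (by simp) (by simpa [← he] using (hg.dirD _).integrable_translate c)
    (by simpa using hg.integrable_translate c) (fun _ _ => by fun_prop)
    (fun z _ => (hd z).differentiableAt)
  simpa [← he] using h

theorem integral_translate_add (f : (Fin 3 → M) → ℂ) (c : Fin 3 → M) (w : M) :
    ∫ z : M, f (fun p => z + (c p + w)) = ∫ z : M, f (fun p => z + c p) := by
  rw [← integral_add_right_eq_self (fun z : M => f (fun p => z + c p)) w]
  congr 1 with z
  congr 1 with p : 1
  abel

/-- `∂_κ` along the diagonal `x₀ = x₂`. -/
noncomputable def diagD (κ : Fin 4) (g : (Fin 3 → M) → ℂ) : (Fin 3 → M) → ℂ :=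
  fun x => ptD 0 κ g x + ptD 2 κ g x

theorem IsTest.diagD {g : (Fin 3 → M) → ℂ} (hg : IsTest g) (κ : Fin 4) : IsTest (diagD κ g) :=
  (hg.dirD _).add (hg.dirD _)

theorem dirD_const_eq (κ : Fin 4) (g : (Fin 3 → M) → ℂ) (x : Fin 3 → M) :
    dirD (fun _ => Pi.single κ 1) g x = diagD κ g x + ptD 1 κ g x := by
  simp only [diagD, ptD, dirD, ← map_add]
  congr 1
  funext p
  fin_cases p <;> simp

/-- The three point derivatives add up to the derivative of a common translation, whose integral
vanishes. A derivative at x' is thereby traded for one along x = x''. -/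
theorem IsTest.integral_ptD_one {g : (Fin 3 → M) → ℂ} (hg : IsTest g) (κ : Fin 4)
    (c : Fin 3 → M) :
    ∫ z : M, SQCD.ptD 1 κ g (fun p => z + c p) = -∫ z : M, SQCD.diagD κ g (fun p => z + c p) := by
  have h := hg.integral_dirD_const (Pi.single κ 1) c
  simp only [dirD_const_eq] at h
  rw [integral_add ((hg.diagD κ).integrable_translate c) ((hg.ptD 1 κ).integrable_translate c)] at h
  rw [eq_neg_iff_add_eq_zero, add_comm, ← h]

end SQCD

namespace SQCD

/-- `δ_{xx''}`. -/
def d02 : Edge := ⟨0, 2, .delta, none⟩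

section Local
variable (s : Strings) (k : Ker) {g : (Fin 3 → M) → ℂ}

theorem linked_delta : Linked ⟨0, 1, k, none⟩ d02 ∧ Linked ⟨1, 0, k, none⟩ d02 ∧
    (∀ o, Linked ⟨2, 1, k, o⟩ d02) ∧ (∀ o, Linked ⟨1, 2, k, o⟩ d02) ∧
    (∀ o, Linked d02 ⟨2, 1, k, o⟩) ∧ (∀ o, Linked d02 ⟨1, 2, k, o⟩) := by
  simp [Linked, d02]

theorem wordVal_delta_out (g : (Fin 3 → M) → ℂ) :
    wordVal s (word ⟨0, 1, k, none⟩ d02) g =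
      kerVal s k fun y => ∫ z : M, g fun p => z + (![0, y, 0] : Fin 3 → M) p := by
  rw [wordVal_eq s (linked_delta k).1]
  simp only [d02, kerVal, derVal]
  congr 1 with y
  congr 1 with z
  congr 1 with p : 1
  fin_cases p <;> simp [place]

theorem wordVal_delta_in (g : (Fin 3 → M) → ℂ) :
    wordVal s (word ⟨1, 0, k, none⟩ d02) g =
      kerVal s k fun y => ∫ z : M, g fun p => z + (![y, 0, y] : Fin 3 → M) p := by
  rw [wordVal_eq s (linked_delta k).2.1]
  simp only [d02, kerVal, derVal]
  congr 1 with y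
  congr 1 with z
  congr 1 with p : 1
  fin_cases p <;> simp [place]

theorem integral_in_eq (f : (Fin 3 → M) → ℂ) (y : M) :
    ∫ z : M, f (fun p => z + (![0, -y, 0] : Fin 3 → M) p) =
      ∫ z : M, f fun p => z + (![y, 0, y] : Fin 3 → M) p := by
  rw [← integral_translate_add f _ y]
  congr 1 with z
  congr 1 with p : 1
  fin_cases p <;> simp

variable {k} in
theorem kerVal_neg_integral (hg : IsTest g) (κ : Fin 4) (c : M → Fin 3 → M) :
    (kerVal s k fun y => ∫ z : M, ptD 1 κ g fun p => z + c y p) =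
      -kerVal s k fun y => ∫ z : M, diagD κ g fun p => z + c y p := by
  simp only [hg.integral_ptD_one]
  simpa using kerVal_const_mul s k (-1) fun y => ∫ z : M, diagD κ g fun p => z + c y p

/-- The derivative first falls on the test function at x', the end point touched by no other kernel.
Translation invariance then converts it into minus the derivative along the diagonal. -/
theorem wordVal_delta_der_out (hg : IsTest g) (κ : Fin 4) :
    wordVal s (word d02 ⟨2, 1, k, some κ⟩) g =
      -wordVal s (word ⟨0, 1, k, none⟩ d02) (diagD κ g) := by
  rw [wordVal_der_dst s d02 2 1 k κ hg (by decide) (by decide), wordVal_delta_out,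
    ← kerVal_neg_integral s hg, wordVal_eq s ((linked_delta k).2.2.2.2.1 none)]
  simp only [d02, kerVal, derVal]
  congr 1 with y
  congr 1 with z
  congr 1 with p : 1
  fin_cases p <;> simp [place]

theorem wordVal_delta_der_in (hg : IsTest g) (κ : Fin 4) :
    wordVal s (word d02 ⟨1, 2, k, some κ⟩) g =
      wordVal s (word ⟨1, 0, k, none⟩ d02) (diagD κ g) := by
  rw [wordVal_der_src s d02 2 1 k κ hg (by decide) (by decide), wordVal_delta_in, neg_eq_iff_eq_neg,
    ← kerVal_neg_integral s hg, wordVal_eq s ((linked_delta k).2.2.2.2.2 none)]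
  simp only [d02, kerVal, derVal, ← integral_in_eq]
  congr 1 with y
  congr 1 with z
  congr 1 with p : 1
  fin_cases p <;> simp [place, sub_eq_add_neg]

/-- Words are ordered, and `place` treats its two edges differently, so the product with δ_{xx''} as
second factor needs its own argument. With this order the first difference variable moves x' alone.
-/
theorem wordVal_der_out_delta (hg : IsTest g) (κ : Fin 4) :
    wordVal s (word ⟨2, 1, k, some κ⟩ d02) g =
      -wordVal s (word ⟨0, 1, k, none⟩ d02) (diagD κ g) := by
  rw [wordVal_delta_out, ← kerVal_neg_integral s hg, wordVal_eq s ((linked_delta k).2.2.1 _)]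
  have hv : ∀ v : M, place ⟨2, 1, k, some κ⟩ d02 0 v 0 = Pi.single 1 v := by
    intro v
    funext p
    fin_cases p <;> simp [place, d02]
  have e : ∀ z y, derVal (some κ) (fun y₁ => g (place ⟨2, 1, k, some κ⟩ d02 z y₁ 0)) y =
      ptD 1 κ g fun p => z + (![0, y, 0] : Fin 3 → M) p := by
    intro z y
    rw [derVal_fst _ _ hg.differentiable]
    simp only [optD, placeL_apply, hv, ptD]
    congr 1 with p : 1
    fin_cases p <;> simp [place, d02]
  exact congrArg (kerVal s k) (funext fun y => integral_congr_ae (.of_forall fun z => e z y))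

/-- Here the difference variable moves x and x'' together, so the derivative along the diagonal
appears directly, without translation invariance. -/
theorem wordVal_der_in_delta (hg : IsTest g) (κ : Fin 4) :
    wordVal s (word ⟨1, 2, k, some κ⟩ d02) g =
      wordVal s (word ⟨1, 0, k, none⟩ d02) (diagD κ g) := by
  rw [wordVal_delta_in, wordVal_eq s ((linked_delta k).2.2.2.1 _)]
  have hv : ∀ v : M, place ⟨1, 2, k, some κ⟩ d02 0 v 0 = Pi.single 0 v + Pi.single 2 v := by
    intro v
    funext p
    fin_cases p <;> simp [place, d02]
  have e : ∀ z y, derVal (some κ) (fun y₁ => g (place ⟨1, 2, k, some κ⟩ d02 z y₁ 0)) y =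
      diagD κ g fun p => z + (![y, 0, y] : Fin 3 → M) p := by
    intro z y
    rw [derVal_fst _ _ hg.differentiable]
    simp only [optD, placeL_apply, hv, diagD, ptD, dirD, map_add]
    have : place ⟨1, 2, k, some κ⟩ d02 z y 0 = fun p => z + (![y, 0, y] : Fin 3 → M) p := by
      funext p
      fin_cases p <;> simp [place, d02]
    rw [this]
  exact congrArg (kerVal s k) (funext fun y => integral_congr_ae (.of_forall fun z => e z y))

variable {g₁ g₂ : (Fin 3 → M) → ℂ}

theorem wordVal_delta_out_congr (h : ∀ x, x 0 = x 2 → g₁ x = g₂ x) :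
    wordVal s (word ⟨0, 1, k, none⟩ d02) g₁ = wordVal s (word ⟨0, 1, k, none⟩ d02) g₂ := by
  rw [wordVal_delta_out, wordVal_delta_out]
  congr 1 with y
  congr 1 with z
  exact h _ (by simp)

theorem wordVal_delta_in_congr (h : ∀ x, x 0 = x 2 → g₁ x = g₂ x) :
    wordVal s (word ⟨1, 0, k, none⟩ d02) g₁ = wordVal s (word ⟨1, 0, k, none⟩ d02) g₂ := by
  rw [wordVal_delta_in, wordVal_delta_in]
  congr 1 with y
  congr 1 with z
  exact h _ (by simp)

/-- The direction of differentiation is tangent to x = x'', so only the restriction to this diagonal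
matters. -/
theorem diagD_congr (h₁ : Differentiable ℝ g₁) (h₂ : Differentiable ℝ g₂)
    (h : ∀ x, x 0 = x 2 → g₁ x = g₂ x) (κ : Fin 4) (x : Fin 3 → M) (hx : x 0 = x 2) :
    diagD κ g₁ x = diagD κ g₂ x := by
  set v : Fin 3 → M := Pi.single 0 (Pi.single κ 1) + Pi.single 2 (Pi.single κ 1) with hv
  have hd : ∀ {g : (Fin 3 → M) → ℂ}, Differentiable ℝ g →
      diagD κ g x = deriv (fun t : ℝ => g (x + t • v)) 0 := by
    intro g hg
    have hl := ((hg x).hasFDerivAt.hasLineDerivAt v).deriv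
    rw [hl, hv, map_add]
    rfl
  rw [hd h₁, hd h₂]
  congr 1
  funext t
  apply h
  simp [hv, hx]

end Local

theorem wordVal_delta_delta (s : Strings) (p q r t : Fin 3)
    (h : Linked ⟨p, q, .delta, none⟩ ⟨r, t, .delta, none⟩) (g : (Fin 3 → M) → ℂ) :
    wordVal s (word ⟨p, q, .delta, none⟩ ⟨r, t, .delta, none⟩) g = ∫ z : M, g fun _ => z := by
  rw [wordVal_eq s h]
  simp only [kerVal, derVal]
  congr 1 with z
  congr 1 with i : 1
  simp [place]

/-! ### Total derivatives on the diagonal -/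

theorem hasFDerivAt_comp_apply {f : M → ℂ} (hf : Differentiable ℝ f) (r : Fin 3)
    (x : Fin 3 → M) : HasFDerivAt (fun x : Fin 3 → M => f (x r))
      ((fderiv ℝ f (x r)).comp (ContinuousLinearMap.proj r)) x :=
  (hf (x r)).hasFDerivAt.comp x
    (ContinuousLinearMap.proj (R := ℝ) (φ := fun _ : Fin 3 => M) r).hasFDerivAt

theorem ptD_comp_apply {f : M → ℂ} (hf : Differentiable ℝ f) (r q : Fin 3) (κ : Fin 4)
    (x : Fin 3 → M) : ptD r κ (fun x => f (x q)) x = if q = r then par κ f (x q) else 0 := by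
  simp only [ptD, dirD]
  rw [(hasFDerivAt_comp_apply hf q x).fderiv]
  by_cases h : q = r
  · subst h; simp [par]
  · simp [h]

theorem ptD_mul {g₁ g₂ : (Fin 3 → M) → ℂ} (h₁ : Differentiable ℝ g₁) (h₂ : Differentiable ℝ g₂)
    (r : Fin 3) (κ : Fin 4) (x : Fin 3 → M) :
    ptD r κ (fun x => g₁ x * g₂ x) x = ptD r κ g₁ x * g₂ x + g₁ x * ptD r κ g₂ x := by
  simp only [ptD, dirD]
  rw [fderiv_fun_mul (h₁ x) (h₂ x)]
  simp only [add_apply, smul_apply, smul_eq_mul]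
  ring

end SQCD

namespace SQCD

variable {N d : ℕ}

/-! ### Evaluation of expressions -/

/-- The classical symbol of a Wick polynomial. -/
noncomputable def evalW (C : Config N d) (P : Wick N d) (x : Fin 3 → M) : ℂ :=
  MvPolynomial.eval (fun v : Fin 3 × Fld N d => C v.2 (x v.1)) P

section EvalW
variable {C : Config N d} (hC : ∀ χ, ContDiff ℝ ∞ (C χ)) (x : Fin 3 → M)

include hC in
theorem contDiff_evalW (P : Wick N d) : ContDiff ℝ ∞ (evalW C P) := by
  unfold evalW
  induction P using MvPolynomial.induction_on with
  | C r => simpa using contDiff_const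
  | add P Q hP hQ => simpa using hP.add hQ
  | mul_X P v hP =>
    have : ContDiff ℝ ∞ fun x : Fin 3 → M => C v.2 (x v.1) := (hC v.2).comp (contDiff_apply ℝ M v.1)
    simpa using hP.mul this

include hC in
theorem IsTest.evalW_mul (P : Wick N d) {h : (Fin 3 → M) → ℂ} (hh : IsTest h) :
    IsTest fun x => evalW C P x * h x :=
  ⟨(contDiff_evalW hC P).mul hh.smooth, hh.compact.mul_left⟩

variable (C)

theorem evalW_add (P Q : Wick N d) : evalW C (P + Q) x = evalW C P x + evalW C Q x := by
  simp [evalW]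

theorem evalW_mul (P Q : Wick N d) : evalW C (P * Q) x = evalW C P x * evalW C Q x := by
  simp [evalW]

theorem evalW_smul (r : ℂ) (P : Wick N d) : evalW C (r • P) x = r * evalW C P x := by
  simp [evalW]

theorem evalW_sum {ι : Type*} (t : Finset ι) (P : ι → Wick N d) :
    evalW C (∑ i ∈ t, P i) x = ∑ i ∈ t, evalW C (P i) x := by
  simp [evalW]

theorem evalW_X (p : Fin 3) (χ : Fld N d) : evalW C (MvPolynomial.X (p, χ)) x = C χ (x p) := by
  simp [evalW]

end EvalW

/-- Relabelling of the points of a Wick polynomial. -/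
noncomputable def reindex (f : Fin 3 → Fin 3) : Wick N d →ₐ[ℂ] Wick N d :=
  MvPolynomial.rename (Prod.map f id)

@[simp] theorem reindex_X (f : Fin 3 → Fin 3) (p : Fin 3) (χ : Fld N d) :
    reindex f (MvPolynomial.X (p, χ)) = MvPolynomial.X (f p, χ) := by simp [reindex]

theorem evalW_reindex (C : Config N d) (f : Fin 3 → Fin 3) (P : Wick N d) (x : Fin 3 → M) :
    evalW C (reindex f P) x = evalW C P (x ∘ f) := by
  simp only [evalW, reindex, MvPolynomial.eval_rename]
  rfl

open MonoidAlgebra in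
theorem evalAt_single (s : Strings) (C : Config N d) (w : FreeMonoid Edge) (P : Wick N d)
    (h : (Fin 3 → M) → ℂ) :
    evalAt s C (single w P) h = wordVal s w fun x => evalW C P x * h x := by
  unfold evalAt
  rw [coeff_single, Finsupp.sum_single_index]
  · rfl
  · simpa using wordVal_zero s w

section EvalAt
variable (s : Strings) {C : Config N d} (hC : ∀ χ, ContDiff ℝ ∞ (C χ)) {h : (Fin 3 → M) → ℂ}
  (hh : IsTest h)

theorem evalAt_zero (C : Config N d) (h : (Fin 3 → M) → ℂ) : evalAt s C 0 h = 0 := by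
  simp [evalAt]

include hC hh

theorem evalAt_add (X Y : Expr N d) :
    evalAt s C (X + Y) h = evalAt s C X h + evalAt s C Y h := by
  unfold evalAt
  rw [MonoidAlgebra.coeff_add]
  apply Finsupp.sum_add_index'
  · intro w
    simpa using wordVal_zero s w
  · intro w P Q
    have := wordVal_add s w (hh.evalW_mul hC P) (hh.evalW_mul hC Q)
    simpa only [evalW, map_add, add_mul] using this

theorem evalAt_smul (r : ℂ) (X : Expr N d) : evalAt s C (r • X) h = r * evalAt s C X h := by
  induction X using MonoidAlgebra.induction_linear with
  | zero => simp [evalAt_zero]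
  | add X Y hX hY => rw [smul_add, evalAt_add s hC hh, evalAt_add s hC hh, hX, hY, mul_add]
  | single w P =>
    rw [MonoidAlgebra.smul_single, evalAt_single, evalAt_single,
      ← wordVal_const_mul s w r (hh.evalW_mul hC P)]
    simp only [evalW_smul, mul_assoc]

theorem evalAt_sum {ι : Type*} (t : Finset ι) (X : ι → Expr N d) :
    evalAt s C (∑ i ∈ t, X i) h = ∑ i ∈ t, evalAt s C (X i) h := by
  classical
  induction t using Finset.induction_on with
  | empty => simp [evalAt_zero]
  | insert i t hi ih => rw [Finset.sum_insert hi, Finset.sum_insert hi, evalAt_add s hC hh, ih]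

theorem divAt_add (U V : Fin 4 → Expr N d) :
    divAt s C (fun μ => U μ + V μ) h = divAt s C U h + divAt s C V h := by
  simp only [divAt]
  rw [← neg_add, ← Finset.sum_add_distrib]
  congr 1
  refine Finset.sum_congr rfl fun μ _ => evalAt_add s hC (hh.ptD 0 μ) _ _

theorem divAt_smul (r : ℂ) (U : Fin 4 → Expr N d) :
    divAt s C (fun μ => r • U μ) h = r * divAt s C U h := by
  simp only [divAt]
  rw [mul_neg, Finset.mul_sum]
  congr 1
  refine Finset.sum_congr rfl fun μ _ => evalAt_smul s hC (hh.ptD 0 μ) _ _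

end EvalAt

theorem IsTest.comp_perm {h : (Fin 3 → M) → ℂ} (hh : IsTest h) (τ : Equiv.Perm (Fin 3)) :
    IsTest fun x => h (x ∘ τ) := by
  refine ⟨hh.smooth.comp ?_, ?_⟩
  · rw [contDiff_pi]
    exact fun p => contDiff_apply ℝ M (τ p)
  · have hτ : Continuous fun x : Fin 3 → M => x ∘ τ.symm := by fun_prop
    apply HasCompactSupport.intro (hh.compact.isCompact.image hτ)
    intro x hx
    by_contra h0
    exact hx ⟨x ∘ τ, subset_tsupport _ h0, by funext p; simp⟩

theorem symm_add (Φ Ψ : ((Fin 3 → M) → ℂ) → ℂ) (h : (Fin 3 → M) → ℂ) :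
    symm (fun h => Φ h + Ψ h) h = symm Φ h + symm Ψ h := by
  simp [symm, Finset.sum_add_distrib, mul_add]

theorem symm_const_mul (r : ℂ) (Φ : ((Fin 3 → M) → ℂ) → ℂ) (h : (Fin 3 → M) → ℂ) :
    symm (fun h => r * Φ h) h = r * symm Φ h := by
  simp [symm, ← Finset.mul_sum]; ring

theorem symm_congr {Φ Ψ : ((Fin 3 → M) → ℂ) → ℂ} (H : ∀ h, IsTest h → Φ h = Ψ h)
    {h : (Fin 3 → M) → ℂ} (hh : IsTest h) : symm Φ h = symm Ψ h := by
  unfold symm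
  congr 1
  exact Finset.sum_congr rfl fun τ _ => H _ (hh.comp_perm τ)

theorem symm_comp_perm (τ : Equiv.Perm (Fin 3)) (Φ : ((Fin 3 → M) → ℂ) → ℂ)
    (h : (Fin 3 → M) → ℂ) : symm (fun h => Φ fun x => h (x ∘ τ)) h = symm Φ h := by
  unfold symm
  congr 1
  exact Equiv.sum_comp (Equiv.mulLeft τ) fun σ : Equiv.Perm (Fin 3) => Φ fun x => h (x ∘ σ)

open MonoidAlgebra in
/-- Relabelling of the points of an expression. -/
noncomputable def perm (τ : Equiv.Perm (Fin 3)) : Expr N d →ₐ[ℂ] Expr N d :=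
  (mapDomainAlgHom ℂ (Wick N d) (FreeMonoid.map (Edge.map τ))).comp
    (mapAlgHom (FreeMonoid Edge) (reindex τ))

theorem perm_single (τ : Equiv.Perm (Fin 3)) (w : FreeMonoid Edge) (P : Wick N d) :
    perm τ (MonoidAlgebra.single w P) =
      MonoidAlgebra.single (FreeMonoid.map (Edge.map τ) w) (reindex τ P) := by
  simp [perm]

theorem evalAt_perm (s : Strings) {C : Config N d} (hC : ∀ χ, ContDiff ℝ ∞ (C χ))
    {h : (Fin 3 → M) → ℂ} (hh : IsTest h) (τ : Equiv.Perm (Fin 3)) (X : Expr N d) :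
    evalAt s C (perm τ X) h = evalAt s C X fun x => h (x ∘ τ.symm) := by
  induction X using MonoidAlgebra.induction_linear with
  | zero => simp [evalAt_zero]
  | add X Y hX hY =>
    rw [map_add, evalAt_add s hC hh, evalAt_add s hC (hh.comp_perm τ.symm), hX, hY]
  | single w P =>
    rw [perm_single, evalAt_single, evalAt_single, wordVal_map]
    congr 1
    funext x
    rw [evalW_reindex]
    congr 2
    funext p
    simp

theorem ptD_comp_perm {h : (Fin 3 → M) → ℂ} (hh : IsTest h) (τ : Equiv.Perm (Fin 3)) (r : Fin 3)
    (κ : Fin 4) (x : Fin 3 → M) :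
    ptD r κ (fun x => h (x ∘ τ.symm)) x = ptD (τ r) κ h (x ∘ τ.symm) := by
  let L : (Fin 3 → M) →L[ℝ] (Fin 3 → M) :=
    ContinuousLinearMap.pi fun p => ContinuousLinearMap.proj (τ.symm p)
  have h1 : HasFDerivAt (fun x => h (L x)) ((fderiv ℝ h (L x)).comp L) x :=
    (hh.differentiable (L x)).hasFDerivAt.comp x L.hasFDerivAt
  have h2 : L (Pi.single r (Pi.single κ 1)) = Pi.single (τ r) (Pi.single κ 1) := by
    funext p
    by_cases hp : p = τ r
    · subst hp; simp [L]
    · have : τ.symm p ≠ r := fun h => hp (by simp [← h])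
      simp [L, hp, this]
  have h3 := congrArg (fun D => D (Pi.single r (Pi.single κ 1))) h1.fderiv
  simp only [ContinuousLinearMap.comp_apply, h2] at h3
  exact h3

/-! ### The purely gluonic part -/

/-- The homomorphism which sets the quark fields to zero. -/
noncomputable def gluonW : Wick N d →ₐ[ℂ] Wick N d :=
  MvPolynomial.aeval
    (fun v : Fin 3 × Fld N d => if v.2.isQuark then (0 : Wick N d) else MvPolynomial.X v)

/-- This exhibits the gluonic part as an algebra homomorphism, so that it passes through products
and sums. -/
theorem gluonPart_eq (X : Expr N d) :
    gluonPart X = MonoidAlgebra.mapAlgHom (FreeMonoid Edge) gluonW X := by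
  induction X using MonoidAlgebra.induction_linear with
  | zero => simp [gluonPart]
  | add X Y hX hY =>
    rw [map_add, ← hX, ← hY]
    unfold gluonPart
    rw [MonoidAlgebra.coeff_add]
    apply Finsupp.sum_add_index' <;> intros <;> simp
  | single w P =>
    unfold gluonPart
    rw [MonoidAlgebra.coeff_single, Finsupp.sum_single_index (by simp)]
    simp [gluonW]

theorem gluonW_reindex (f : Fin 3 → Fin 3) (P : Wick N d) :
    gluonW (reindex f P) = reindex f (gluonW P) := by
  induction P using MvPolynomial.induction_on with
  | C r => simp [MvPolynomial.algHom_C]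
  | add P Q hP hQ => simp [hP, hQ]
  | mul_X P v hP =>
    obtain ⟨p, χ⟩ := v
    rw [map_mul, map_mul, map_mul, map_mul, hP, reindex_X]
    congr 1
    by_cases hq : χ.isQuark <;> simp [gluonW, hq]

theorem quarkPart_eq_zero {X : Expr N d} : quarkPart X = 0 ↔ gluonPart X = X := by
  rw [quarkPart, sub_eq_zero, eq_comm]

theorem quarkPart_single {P : Wick N d} (hP : gluonW P = P) (w : FreeMonoid Edge) :
    quarkPart (MonoidAlgebra.single w P) = 0 := by
  rw [quarkPart_eq_zero, gluonPart_eq]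
  simp [hP]

theorem quarkPart_add (X Y : Expr N d) : quarkPart (X + Y) = quarkPart X + quarkPart Y := by
  simp only [quarkPart, gluonPart_eq, map_add]; abel

theorem quarkPart_smul (r : ℂ) (X : Expr N d) : quarkPart (r • X) = r • quarkPart X := by
  simp only [quarkPart, gluonPart_eq, map_smul, smul_sub]

/-! ### Equality up to total derivatives -/

section EqModDer
variable {G : GaugeData N d} {X Y Z X' Y' : Expr N d}

theorem quarkU_add (ξ ζ : Fin N → Expr N d) :
    quarkU G (fun a => ξ a + ζ a) = fun μ => quarkU G ξ μ + quarkU G ζ μ := by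
  funext μ
  simp [quarkU, pair, add_mul, Finset.sum_add_distrib]

theorem quarkU_smul (r : ℂ) (ξ : Fin N → Expr N d) :
    quarkU G (fun a => r • ξ a) = fun μ => r • quarkU G ξ μ := by
  funext μ
  simp [quarkU, pair, Finset.smul_sum]

theorem EqModDer.add (h₁ : EqModDer G X Y) (h₂ : EqModDer G X' Y') :
    EqModDer G (X + X') (Y + Y') := by
  obtain ⟨ξ, hξ, e⟩ := h₁
  obtain ⟨ζ, hζ, e'⟩ := h₂
  refine ⟨fun a => ξ a + ζ a, fun a => by rw [quarkPart_add, hξ, hζ, add_zero], ?_⟩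
  intro s C hC h hs hc
  have hh : IsTest h := ⟨hs, hc⟩
  rw [symm_congr (fun h hh => evalAt_add s hC.smooth hh X X') hh,
    symm_congr (fun h hh => evalAt_add s hC.smooth hh Y Y') hh, quarkU_add,
    symm_congr (fun h hh => divAt_add s hC.smooth hh _ _) hh, symm_add, symm_add, symm_add,
    e s C hC h hs hc, e' s C hC h hs hc]
  ring

theorem EqModDer.smul (r : ℂ) (h₁ : EqModDer G X Y) : EqModDer G (r • X) (r • Y) := by
  obtain ⟨ξ, hξ, e⟩ := h₁
  refine ⟨fun a => r • ξ a, fun a => by rw [quarkPart_smul, hξ, smul_zero], ?_⟩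
  intro s C hC h hs hc
  have hh : IsTest h := ⟨hs, hc⟩
  rw [symm_congr (fun h hh => evalAt_smul s hC.smooth hh r X) hh,
    symm_congr (fun h hh => evalAt_smul s hC.smooth hh r Y) hh, quarkU_smul,
    symm_congr (fun h hh => divAt_smul s hC.smooth hh r _) hh, symm_const_mul, symm_const_mul,
    symm_const_mul, e s C hC h hs hc]
  ring

theorem divAt_quarkU_zero (s : Strings) (C : Config N d) (h : (Fin 3 → M) → ℂ) :
    divAt s C (quarkU G fun _ => 0) h = 0 := by
  simp [divAt, quarkU, pair, evalAt_zero]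

theorem EqModDer.of_eval (H : ∀ (s : Strings) (C : Config N d), OnShell G C →
    ∀ h, IsTest h → symm (evalAt s C X) h = symm (evalAt s C Y) h) : EqModDer G X Y := by
  refine ⟨fun _ => 0, fun a => by simp [quarkPart_eq_zero, gluonPart_eq], ?_⟩
  intro s C hC h hs hc
  rw [H s C hC h ⟨hs, hc⟩]
  simp [symm, divAt_quarkU_zero]

theorem EqModDer.refl (X : Expr N d) : EqModDer G X X := .of_eval fun _ _ _ _ _ => rfl

/-- The total derivatives in the quark sector. -/
noncomputable def totalDer (G : GaugeData N d) : Submodule ℂ (Expr N d) where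
  carrier := {X | EqModDer G X 0}
  zero_mem' := .refl 0
  add_mem' h₁ h₂ := by simpa using EqModDer.add h₁ h₂
  smul_mem' r X h := by simpa using EqModDer.smul r h

theorem eqModDer_iff_sub_mem : EqModDer G X Y ↔ X - Y ∈ totalDer G := by
  constructor
  · intro h
    have := h.add (EqModDer.refl (G := G) (-Y))
    rw [add_neg_cancel] at this
    rwa [sub_eq_add_neg]
  · intro h
    have := EqModDer.add h (EqModDer.refl (G := G) Y)
    simpa using this

/-- The class of an expression modulo total derivatives. -/
noncomputable def cls (G : GaugeData N d) : Expr N d →ₗ[ℂ] Expr N d ⧸ totalDer G :=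
  (totalDer G).mkQ

theorem eqModDer_iff : EqModDer G X Y ↔ cls G X = cls G Y := by
  rw [eqModDer_iff_sub_mem]
  exact (Submodule.Quotient.eq _).symm

/-- Only symmetrized distributions are compared, and the average over permutations absorbs any
relabelling. -/
theorem cls_perm (τ : Equiv.Perm (Fin 3)) (X : Expr N d) : cls G (perm τ X) = cls G X := by
  rw [← eqModDer_iff]
  apply EqModDer.of_eval
  intro s C hC h hh
  rw [symm_congr (fun h hh => evalAt_perm s hC.smooth hh τ X) hh]
  exact symm_comp_perm τ.symm (evalAt s C X) h

end EqModDer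

end SQCD

namespace SQCD

variable {N d : ℕ}

/-! ### The quark current -/

/-- `ψ̄(x_p) γ^κ T ψ(x_q)` for a matrix `T` in the representation space. -/
noncomputable def jjW (G : GaugeData N d) (p q : Fin 3) (κ : Fin 4)
    (T : Matrix (Fin d) (Fin d) ℂ) : Wick N d :=
  ∑ s, ∑ t, ∑ m, ∑ n, (G.γ κ s t * T m n) •
    (MvPolynomial.X (p, Fld.psibar s m) * MvPolynomial.X (q, Fld.psi t n))

/-- The classical symbol of `ψ̄ γ^κ T ψ`. -/
noncomputable def jVal (G : GaugeData N d) (C : Config N d) (κ : Fin 4)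
    (T : Matrix (Fin d) (Fin d) ℂ) (y : M) : ℂ :=
  ∑ s, ∑ t, ∑ m, ∑ n, (G.γ κ s t * T m n) * (C (.psibar s m) y * C (.psi t n) y)

theorem reindex_jjW (G : GaugeData N d) (f : Fin 3 → Fin 3) (p q : Fin 3) (κ : Fin 4)
    (T : Matrix (Fin d) (Fin d) ℂ) : reindex f (jjW G p q κ T) = jjW G (f p) (f q) κ T := by
  simp only [jjW, map_sum, map_smul, map_mul, reindex_X]

theorem evalW_jjW (G : GaugeData N d) (C : Config N d) (p : Fin 3) (κ : Fin 4)
    (T : Matrix (Fin d) (Fin d) ℂ) (x : Fin 3 → M) :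
    evalW C (jjW G p p κ T) x = jVal G C κ T (x p) := by
  simp only [jjW, jVal, evalW_sum, evalW_smul, evalW_mul, evalW_X]

section Par

theorem par_mul {f g : M → ℂ} (hf : Differentiable ℝ f) (hg : Differentiable ℝ g) (κ : Fin 4)
    (y : M) : par κ (fun y => f y * g y) y = par κ f y * g y + f y * par κ g y := by
  simp only [par]
  rw [fderiv_fun_mul (hf y) (hg y)]
  simp only [add_apply, smul_apply, smul_eq_mul]
  ring

theorem par_const_mul {f : M → ℂ} (hf : Differentiable ℝ f) (r : ℂ) (κ : Fin 4) (y : M) :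
    par κ (fun y => r * f y) y = r * par κ f y := by
  simp only [par]
  rw [fderiv_const_mul (hf y)]
  rfl

theorem par_sum {ι : Type*} (t : Finset ι) {f : ι → M → ℂ} (hf : ∀ i, Differentiable ℝ (f i))
    (κ : Fin 4) (y : M) : par κ (fun y => ∑ i ∈ t, f i y) y = ∑ i ∈ t, par κ (f i) y := by
  simp only [par]
  rw [fderiv_fun_sum fun i _ => hf i y]
  simp

theorem sum_rotate {ι₁ ι₂ ι₃ V : Type*} [Fintype ι₁] [Fintype ι₂] [Fintype ι₃] [AddCommMonoid V]
    (f : ι₁ → ι₂ → ι₃ → V) : ∑ i, ∑ j, ∑ k, f i j k = ∑ k, ∑ i, ∑ j, f i j k := by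
  calc _ = ∑ i, ∑ k, ∑ j, f i j k := Finset.sum_congr rfl fun i _ => Finset.sum_comm
    _ = _ := Finset.sum_comm

variable {G : GaugeData N d} {C : Config N d} (hC : OnShell G C)
include hC

theorem OnShell.differentiable (χ : Fld N d) : Differentiable ℝ (C χ) :=
  (hC.smooth χ).differentiable (by simp)

theorem differentiable_jVal (κ : Fin 4) (T : Matrix (Fin d) (Fin d) ℂ) :
    Differentiable ℝ (jVal G C κ T) := by
  have := hC.differentiable
  unfold jVal
  fun_prop

/-- The two massless Dirac equations annihilate the two terms of the product rule. They do not mix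
representation indices, so any matrix `T` may be inserted. -/
theorem OnShell.current_conserved (T : Matrix (Fin d) (Fin d) ℂ) (y : M) :
    ∑ κ, par κ (jVal G C κ T) y = 0 := by
  have hd := hC.differentiable
  have h1 : ∀ κ, par κ (jVal G C κ T) y = ∑ s, ∑ t, ∑ m, ∑ n,
      ((par κ (C (.psibar s m)) y * G.γ κ s t) * (T m n * C (.psi t n) y) +
        (G.γ κ s t * par κ (C (.psi t n)) y) * (T m n * C (.psibar s m) y)) := by
    intro κ
    unfold jVal
    rw [par_sum _ (by fun_prop)]
    refine Finset.sum_congr rfl fun s _ => ?_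
    rw [par_sum _ (by fun_prop)]
    refine Finset.sum_congr rfl fun t _ => ?_
    rw [par_sum _ (by fun_prop)]
    refine Finset.sum_congr rfl fun m _ => ?_
    rw [par_sum _ (by fun_prop)]
    refine Finset.sum_congr rfl fun n _ => ?_
    rw [par_const_mul (by fun_prop), par_mul (hd _) (hd _)]
    ring
  simp only [h1, Finset.sum_add_distrib]
  have hA : ∑ κ, ∑ s, ∑ t, ∑ m, ∑ n,
      (par κ (C (.psibar s m)) y * G.γ κ s t) * (T m n * C (.psi t n) y) = 0 := by
    rw [sum_rotate]
    refine Finset.sum_eq_zero fun t _ => ?_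
    rw [sum_rotate]
    refine Finset.sum_eq_zero fun m _ => ?_
    rw [sum_rotate]
    refine Finset.sum_eq_zero fun n _ => ?_
    simp only [← Finset.sum_mul]
    rw [hC.dirac_bar, zero_mul]
  have hB : ∑ κ, ∑ s, ∑ t, ∑ m, ∑ n,
      (G.γ κ s t * par κ (C (.psi t n)) y) * (T m n * C (.psibar s m) y) = 0 := by
    rw [Finset.sum_comm]
    refine Finset.sum_eq_zero fun s _ => ?_
    rw [sum_rotate]
    refine Finset.sum_eq_zero fun m _ => ?_
    rw [sum_rotate]
    refine Finset.sum_eq_zero fun n _ => ?_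
    simp only [← Finset.sum_mul]
    rw [hC.dirac, zero_mul]
  rw [hA, hB, add_zero]

end Par

/-! ### Divergences of currents -/

/-- Functionals which are total derivatives after symmetrization. -/
def IsDiv (G : GaugeData N d) (Ψ : Strings → Config N d → ((Fin 3 → M) → ℂ) → ℂ) : Prop :=
  ∃ ξ : Fin N → Expr N d, (∀ a, quarkPart (ξ a) = 0) ∧
    ∀ s C, OnShell G C → ∀ h, IsTest h → symm (Ψ s C) h = symm (divAt s C (quarkU G ξ)) h

section IsDiv
variable {G : GaugeData N d} {Ψ Ψ' : Strings → Config N d → ((Fin 3 → M) → ℂ) → ℂ}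

theorem IsDiv.add (h₁ : IsDiv G Ψ) (h₂ : IsDiv G Ψ') :
    IsDiv G fun s C h => Ψ s C h + Ψ' s C h := by
  obtain ⟨ξ, hξ, e⟩ := h₁
  obtain ⟨ζ, hζ, e'⟩ := h₂
  refine ⟨fun a => ξ a + ζ a, fun a => by rw [quarkPart_add, hξ, hζ, add_zero], ?_⟩
  intro s C hC h hh
  rw [quarkU_add, symm_congr (fun h hh => divAt_add s hC.smooth hh _ _) hh, symm_add, symm_add,
    e s C hC h hh, e' s C hC h hh]

theorem IsDiv.const_mul (r : ℂ) (h₁ : IsDiv G Ψ) : IsDiv G fun s C h => r * Ψ s C h := by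
  obtain ⟨ξ, hξ, e⟩ := h₁
  refine ⟨fun a => r • ξ a, fun a => by rw [quarkPart_smul, hξ, smul_zero], ?_⟩
  intro s C hC h hh
  rw [quarkU_smul, symm_congr (fun h hh => divAt_smul s hC.smooth hh r _) hh, symm_const_mul,
    symm_const_mul, e s C hC h hh]

theorem EqModDer.of_isDiv {X Y : Expr N d} (hΨ : IsDiv G Ψ)
    (H : ∀ (s : Strings) (C : Config N d), OnShell G C → ∀ h, IsTest h →
      evalAt s C X h = evalAt s C Y h + Ψ s C h) : EqModDer G X Y := by
  obtain ⟨ξ, hξ, e⟩ := hΨ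
  refine ⟨ξ, hξ, ?_⟩
  intro s C hC h hs hc
  have hh : IsTest h := ⟨hs, hc⟩
  rw [symm_congr (H s C hC) hh, symm_add, e s C hC h hh]

open MonoidAlgebra in
theorem wick_j (G : GaugeData N d) (p : Fin 3) (μ : Fin 4) (a : Fin N) :
    j G p μ a = wick (jjW G p p μ (G.π a)) := by
  have hw : ∀ P : Wick N d, wick P = (algebraMap (Wick N d) (Expr N d)) P := fun P => rfl
  simp only [j, jjW, fld, hw, map_sum, map_mul, Algebra.smul_def]
  rfl

/-- The integral over `∂_κ` of the test function at the point `x_r` is a total derivative when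
contracted with the current at `x_r`. -/
theorem isDiv_ptD (G : GaugeData N d) (w : FreeMonoid Edge) {P : Wick N d} (hP : gluonW P = P)
    (r : Fin 3) (c : Fin N) :
    IsDiv G fun s C h => ∑ κ, evalAt s C
      (MonoidAlgebra.single w (P * jjW G r r κ (G.π c))) (ptD r κ h) := by
  classical
  -- Total derivatives have their current and derivative at x, so x and x_r are exchanged. The
  -- factor -1 in the witness below compensates the sign of the weak derivative in `divAt`.
  let τ : Equiv.Perm (Fin 3) := Equiv.swap r 0
  let Z : Expr N d := MonoidAlgebra.single (FreeMonoid.map (Edge.map τ) w) (reindex τ P)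
  refine ⟨fun a => if a = c then (-1 : ℂ) • Z else 0, ?_, ?_⟩
  · intro a
    have h0 : quarkPart (0 : Expr N d) = 0 := by simp [quarkPart_eq_zero, gluonPart_eq]
    by_cases h : a = c
    · have hz : quarkPart ((-1 : ℂ) • Z) = 0 := by
        rw [quarkPart_smul, quarkPart_single (by rw [gluonW_reindex, hP]), smul_zero]
      simp only [if_pos h, hz]
    · simpa [h] using h0
  · intro s C hC h hh
    have hU : ∀ κ, quarkU G (fun a => if a = c then (-1 : ℂ) • Z else 0) κ =
        (-1 : ℂ) • perm τ (MonoidAlgebra.single w (P * jjW G r r κ (G.π c))) := by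
      intro κ
      rw [quarkU, pair, Finset.sum_eq_single c (by intro b _ hb; simp [hb]) (by simp), wick_j,
        perm_single, map_mul, reindex_jjW]
      have hτ : τ r = 0 := by simp [τ]
      rw [if_pos rfl, hτ, smul_mul_assoc, wick, MonoidAlgebra.single_mul_single, mul_one]
    rw [← symm_comp_perm τ (divAt s C _)]
    apply symm_congr _ hh
    intro h hh
    have h1 := hh.comp_perm τ
    simp only [divAt, hU]
    rw [← Finset.sum_neg_distrib]
    refine Finset.sum_congr rfl fun κ _ => ?_
    have h2 := evalAt_smul s hC.smooth (h1.ptD 0 κ) (-1)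
      (perm τ (MonoidAlgebra.single w (P * jjW G r r κ (G.π c))))
    have h3 : (fun x => ptD 0 κ (fun x => h (x ∘ τ)) (x ∘ τ.symm)) = ptD r κ h := by
      funext x
      have := ptD_comp_perm h1 τ r κ x
      rw [show τ r = 0 by simp [τ]] at this
      rw [← this]
      congr 1
      funext x
      congr 1
      funext p
      simp
    rw [evalAt_perm s hC.smooth (h1.ptD 0 κ), h3] at h2
    change _ = -evalAt s C _ (ptD 0 κ fun x => h (x ∘ τ))
    rw [h2]
    ring

end IsDiv

end SQCD

/-! ### Integration by parts at x'' and along the diagonal x = x''. -/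

namespace SQCD

variable {N d : ℕ} {G : GaugeData N d}

/-- Invariance under a relabelling which avoids `r` is the way of saying that `P` contains no field
at x_r. -/
theorem ptD_evalW_eq_zero {C : Config N d} (hC : ∀ χ, ContDiff ℝ ∞ (C χ)) {P : Wick N d}
    {f : Fin 3 → Fin 3} {r : Fin 3} (hf : ∀ p, f p ≠ r) (hP : reindex f P = P) (κ : Fin 4)
    (x : Fin 3 → M) : ptD r κ (evalW C P) x = 0 := by
  let L : (Fin 3 → M) →L[ℝ] (Fin 3 → M) :=
    ContinuousLinearMap.pi fun p => ContinuousLinearMap.proj (f p)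
  have h0 : evalW C P = fun x => evalW C P (L x) := by
    funext x
    conv_lhs => rw [← hP, evalW_reindex]
    rfl
  have h1 : HasFDerivAt (fun x => evalW C P (L x)) ((fderiv ℝ (evalW C P) (L x)).comp L) x :=
    ((contDiff_evalW hC P).differentiable (by simp) (L x)).hasFDerivAt.comp x L.hasFDerivAt
  have h2 : L (Pi.single r (Pi.single κ 1)) = 0 := by
    funext p
    simp [L, hf p]
  have h3 := congrArg (fun D => D (Pi.single r (Pi.single κ 1))) h1.fderiv
  simp only [ContinuousLinearMap.comp_apply, h2, map_zero] at h3
  rw [h0]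
  exact h3

/-- Relabelling which removes the point `x''`. -/
def toTwo : Fin 3 → Fin 3 := ![0, 1, 1]

theorem toTwo_ne (p : Fin 3) : toTwo p ≠ 2 := by fin_cases p <;> simp [toTwo]

/-- In the product rule at x'', `P` is constant and the divergence of the current vanishes, so only
the derivative of the test function survives. -/
theorem wordVal_sum_ptD_current (s : Strings) {C : Config N d} (hC : OnShell G C)
    (w : FreeMonoid Edge) {P : Wick N d} (hP : reindex toTwo P = P) (c : Fin N)
    {h : (Fin 3 → M) → ℂ} (hh : IsTest h) :
    ∑ κ, wordVal s w (ptD 2 κ fun x => evalW C (P * jjW G 2 2 κ (G.π c)) x * h x) =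
      ∑ κ, evalAt s C (MonoidAlgebra.single w (P * jjW G 2 2 κ (G.π c))) (ptD 2 κ h) := by
  have hsm := hC.smooth
  have hdP : Differentiable ℝ (evalW C P) := (contDiff_evalW hsm P).differentiable (by simp)
  have hdj : ∀ κ, Differentiable ℝ fun x : Fin 3 → M => jVal G C κ (G.π c) (x 2) := fun κ =>
    (differentiable_jVal hC κ (G.π c)).comp (differentiable_apply 2)
  simp only [evalAt_single]
  rw [← wordVal_sum s w _ fun κ _ => ((hh.evalW_mul hsm _).ptD 2 κ),
    ← wordVal_sum s w _ fun κ _ => ((hh.ptD 2 κ).evalW_mul hsm _)]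
  congr 1
  funext x
  have e : ∀ κ, ptD 2 κ (fun x => evalW C (P * jjW G 2 2 κ (G.π c)) x * h x) x =
      evalW C P x * h x * par κ (jVal G C κ (G.π c)) (x 2) +
        evalW C (P * jjW G 2 2 κ (G.π c)) x * ptD 2 κ h x := by
    intro κ
    simp only [evalW_mul, evalW_jjW]
    have hm : Differentiable ℝ fun x => evalW C P x * jVal G C κ (G.π c) (x 2) := hdP.mul (hdj κ)
    rw [ptD_mul hm hh.differentiable, ptD_mul hdP (hdj κ),
      ptD_evalW_eq_zero hsm toTwo_ne hP,
      ptD_comp_apply (differentiable_jVal hC κ (G.π c)), if_pos rfl]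
    ring
  simp only [e, Finset.sum_add_distrib, ← Finset.mul_sum]
  rw [hC.current_conserved, mul_zero, zero_add]

/-- Combinations of a gluonic Wick polynomial at `x`, `x'` with a kernel between `x` and `x'`. -/
noncomputable def twoPoint (N d : ℕ) : Submodule ℂ (Expr N d) :=
  Submodule.span ℂ {Z | ∃ (a : Edge) (P : Wick N d), a.src ≠ 2 ∧ a.dst ≠ 2 ∧ reindex toTwo P = P ∧
    gluonW P = P ∧ Z = MonoidAlgebra.single (FreeMonoid.of a) P}

/-- The kernel with a derivative at the third point. -/
def IsOuter (e : Option (Fin 4) → Edge) (ε : ℂ) : Prop :=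
  ∀ (s : Strings) (a : Edge) (κ : Fin 4) (g : (Fin 3 → M) → ℂ), IsTest g → a.src ≠ 2 → a.dst ≠ 2 →
    wordVal s (word a (e (some κ))) g = ε * wordVal s (word a (e none)) (ptD 2 κ g)

theorem isOuter_src (q : Fin 3) (k : Ker) : IsOuter (fun o => ⟨2, q, k, o⟩) (-1) := by
  intro s a κ g hg h1 h2
  rw [wordVal_der_src s a q 2 k κ hg h1.symm h2.symm, neg_one_mul]

theorem isOuter_dst (q : Fin 3) (k : Ker) : IsOuter (fun o => ⟨q, 2, k, o⟩) 1 := by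
  intro s a κ g hg h1 h2
  rw [wordVal_der_dst s a q 2 k κ hg h1.symm h2.symm, one_mul]

theorem cls_single_outer {e : Option (Fin 4) → Edge} {ε : ℂ} (he : IsOuter e ε) {a : Edge}
    (h₁ : a.src ≠ 2) (h₂ : a.dst ≠ 2) {P : Wick N d} (hP : reindex toTwo P = P)
    (hP' : gluonW P = P) (c : Fin N) :
    ∑ κ, cls G (MonoidAlgebra.single (word a (e (some κ))) (P * jjW G 2 2 κ (G.π c))) = 0 := by
  rw [← map_sum, ← map_zero (cls G), ← eqModDer_iff]
  apply EqModDer.of_isDiv ((isDiv_ptD G (word a (e none)) hP' 2 c).const_mul ε)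
  intro s C hC h hh
  rw [evalAt_zero, zero_add, evalAt_sum s hC.smooth hh, ← wordVal_sum_ptD_current s hC _ hP c hh,
    Finset.mul_sum]
  refine Finset.sum_congr rfl fun κ _ => ?_
  rw [evalAt_single, he s a κ _ (hh.evalW_mul hC.smooth _) h₁ h₂]

/-- The divergence of a current at the third point is a total derivative. -/
theorem cls_outer {e : Option (Fin 4) → Edge} {ε : ℂ} (he : IsOuter e ε) {Z : Expr N d}
    (hZ : Z ∈ twoPoint N d) (c : Fin N) :
    ∑ κ, cls G (Z * (edge (e (some κ)) * wick (jjW G 2 2 κ (G.π c)))) = 0 := by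
  induction hZ using Submodule.span_induction with
  | mem Z hZ =>
    obtain ⟨a, P, h1, h2, h3, h4, rfl⟩ := hZ
    rw [← cls_single_outer he h1 h2 h3 h4 c]
    refine Finset.sum_congr rfl fun κ _ => ?_
    rw [edge, wick, MonoidAlgebra.single_mul_single, MonoidAlgebra.single_mul_single, one_mul,
      mul_one, word]
  | zero => simp
  | add Z Z' _ _ h h' => simp only [add_mul, map_add, Finset.sum_add_distrib, h, h', add_zero]
  | smul r Z _ h => simp only [smul_mul_assoc, map_smul, ← Finset.smul_sum, h, smul_zero]

/-! ### Diagonal terms -/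

/-- Relabelling `x'' → x`. -/
def toDiag : Fin 3 → Fin 3 := ![0, 1, 0]

theorem evalW_eq_of_toDiag {P Q : Wick N d} (h : reindex toDiag P = reindex toDiag Q)
    (C : Config N d) {x : Fin 3 → M} (hx : x 0 = x 2) : evalW C P x = evalW C Q x := by
  have e : x ∘ toDiag = x := by
    funext p
    fin_cases p <;> simp [toDiag, hx]
  have := congrArg (fun P => evalW C P x) h
  simpa only [evalW_reindex, e] using this

/-- Words supported on `x = x''`. -/
def IsDiag (w : FreeMonoid Edge) : Prop :=
  ∀ (s : Strings) (g₁ g₂ : (Fin 3 → M) → ℂ), IsTest g₁ → IsTest g₂ →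
    (∀ x, x 0 = x 2 → g₁ x = g₂ x) → wordVal s w g₁ = wordVal s w g₂

theorem isDiag_out (k : Ker) : IsDiag (word ⟨0, 1, k, none⟩ d02) := fun s _ _ _ _ h =>
  wordVal_delta_out_congr s k h

theorem isDiag_in (k : Ker) : IsDiag (word ⟨1, 0, k, none⟩ d02) := fun s _ _ _ _ h =>
  wordVal_delta_in_congr s k h

/-- Words `w'` which, up to the sign `ε`, are derivatives of `w` along the diagonal `x = x''`. -/
def IsDiagDer (w' : Fin 4 → FreeMonoid Edge) (w : FreeMonoid Edge) (ε : ℂ) : Prop :=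
  IsDiag w ∧ ∀ (s : Strings) (κ : Fin 4) (g : (Fin 3 → M) → ℂ), IsTest g →
    wordVal s (w' κ) g = ε * wordVal s w (diagD κ g)

theorem isDiagDer_delta_out (k : Ker) :
    IsDiagDer (fun κ => word d02 ⟨2, 1, k, some κ⟩) (word ⟨0, 1, k, none⟩ d02) (-1) :=
  ⟨isDiag_out k, fun s κ g hg => by rw [wordVal_delta_der_out s k hg, neg_one_mul]⟩

theorem isDiagDer_delta_in (k : Ker) :
    IsDiagDer (fun κ => word d02 ⟨1, 2, k, some κ⟩) (word ⟨1, 0, k, none⟩ d02) 1 :=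
  ⟨isDiag_in k, fun s κ g hg => by rw [wordVal_delta_der_in s k hg, one_mul]⟩

theorem isDiagDer_out_delta (k : Ker) :
    IsDiagDer (fun κ => word ⟨2, 1, k, some κ⟩ d02) (word ⟨0, 1, k, none⟩ d02) (-1) :=
  ⟨isDiag_out k, fun s κ g hg => by rw [wordVal_der_out_delta s k hg, neg_one_mul]⟩

theorem isDiagDer_in_delta (k : Ker) :
    IsDiagDer (fun κ => word ⟨1, 2, k, some κ⟩ d02) (word ⟨1, 0, k, none⟩ d02) 1 :=
  ⟨isDiag_in k, fun s κ g hg => by rw [wordVal_der_in_delta s k hg, one_mul]⟩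

/-- A tangential derivative creates no transversal derivatives of δ_{xx''}. Fields at x'' may
therefore be moved to x even under a differentiated kernel. -/
theorem IsDiagDer.isDiag {w' : Fin 4 → FreeMonoid Edge} {w : FreeMonoid Edge} {ε : ℂ}
    (h : IsDiagDer w' w ε) (κ : Fin 4) : IsDiag (w' κ) := by
  intro s g₁ g₂ h₁ h₂ e
  rw [h.2 s κ g₁ h₁, h.2 s κ g₂ h₂, h.1 s _ _ (h₁.diagD κ) (h₂.diagD κ)
    (diagD_congr h₁.differentiable h₂.differentiable e κ)]

theorem cls_collapse {w : FreeMonoid Edge} (hw : IsDiag w) {P Q : Wick N d}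
    (h : reindex toDiag P = reindex toDiag Q) :
    cls G (MonoidAlgebra.single w P) = cls G (MonoidAlgebra.single w Q) := by
  rw [← eqModDer_iff]
  apply EqModDer.of_eval
  intro s C hC h' hh
  apply symm_congr _ hh
  intro h' hh
  rw [evalAt_single, evalAt_single]
  apply hw s _ _ (hh.evalW_mul hC.smooth _) (hh.evalW_mul hC.smooth _)
  intro x hx
  rw [evalW_eq_of_toDiag h C hx]

/-- Words supported on the total diagonal. -/
theorem cls_collapse_delta {p q r t p' q' r' t' : Fin 3}
    (h₁ : Linked ⟨p, q, .delta, none⟩ ⟨r, t, .delta, none⟩)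
    (h₂ : Linked ⟨p', q', .delta, none⟩ ⟨r', t', .delta, none⟩) {P Q : Wick N d}
    (h : reindex (fun _ => 0) P = reindex (fun _ => 0) Q) :
    cls G (MonoidAlgebra.single (word ⟨p, q, .delta, none⟩ ⟨r, t, .delta, none⟩) P) =
      cls G (MonoidAlgebra.single (word ⟨p', q', .delta, none⟩ ⟨r', t', .delta, none⟩) Q) := by
  rw [← eqModDer_iff]
  apply EqModDer.of_eval
  intro s C hC h' hh
  apply symm_congr _ hh
  intro h' hh
  rw [evalAt_single, evalAt_single, wordVal_delta_delta s _ _ _ _ h₁,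
    wordVal_delta_delta s _ _ _ _ h₂]
  congr 1
  funext z
  congr 1
  have := congrArg (fun P => evalW C P fun _ => z) h
  simp only [evalW_reindex] at this
  exact this

/-- Integration by parts along the diagonal `x = x''`. -/
theorem cls_diagDer {w' : Fin 4 → FreeMonoid Edge} {w : FreeMonoid Edge} {ε : ℂ}
    (hw : IsDiagDer w' w ε) {A : Wick N d} (hA : reindex (fun _ => 1) A = A) (hA' : gluonW A = A)
    (b c : Fin N) :
    ∑ κ, cls G (MonoidAlgebra.single (w' κ)
        (A * MvPolynomial.X (0, .phi b) * jjW G 0 0 κ (G.π c))) =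
      ε • ∑ κ, (eta κ : ℂ) • cls G (MonoidAlgebra.single w
        (A * (MvPolynomial.X (0, .Ac b κ) - MvPolynomial.X (0, .A b κ)) * jjW G 0 0 κ (G.π c))) := by
  have hP : gluonW (A * MvPolynomial.X (0, Fld.phi b)) = A * MvPolynomial.X (0, .phi b) := by
    rw [map_mul, hA']
    simp [gluonW, Fld.isQuark]
  simp only [← map_sum, ← map_smul]
  rw [← eqModDer_iff]
  -- The diagonal derivative of the test function is the sum of its derivatives at x and x''. Each
  -- is a total derivative once the current sits at the differentiated point, so the second summand
  -- uses j(x'').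
  apply EqModDer.of_isDiv (((isDiv_ptD G w hP 0 c).const_mul ε).add
    ((isDiv_ptD G w hP 2 c).const_mul ε))
  intro s C hC h hh
  have hsm := hC.smooth
  -- Since `w` is supported on x = x'', the current may be moved back from x'' to x.
  have h2 : ∀ κ, evalAt s C (MonoidAlgebra.single w
        (A * MvPolynomial.X (0, .phi b) * jjW G 2 2 κ (G.π c))) (ptD 2 κ h) =
      evalAt s C (MonoidAlgebra.single w
        (A * MvPolynomial.X (0, .phi b) * jjW G 0 0 κ (G.π c))) (ptD 2 κ h) := by
    intro κ
    rw [evalAt_single, evalAt_single]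
    apply hw.1 s _ _ ((hh.ptD 2 κ).evalW_mul hsm _) ((hh.ptD 2 κ).evalW_mul hsm _)
    intro x hx
    have hr : reindex toDiag (A * MvPolynomial.X (0, .phi b) * jjW G 2 2 κ (G.π c)) =
        reindex toDiag (A * MvPolynomial.X (0, .phi b) * jjW G 0 0 κ (G.π c)) := by
      rw [map_mul, map_mul _ _ (jjW G 0 0 κ (G.π c)), reindex_jjW, reindex_jjW]
      rfl
    rw [evalW_eq_of_toDiag hr C hx]
  simp only [h2]
  rw [evalAt_sum s hsm hh, evalAt_smul s hsm hh, evalAt_sum s hsm hh]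
  simp only [evalAt_smul s hsm hh]
  simp only [evalAt_single]
  have e1 : ∀ κ, wordVal s (w' κ) (fun x =>
      evalW C (A * MvPolynomial.X (0, .phi b) * jjW G 0 0 κ (G.π c)) x * h x) =
      ε * wordVal s w (diagD κ fun x =>
        evalW C (A * MvPolynomial.X (0, .phi b) * jjW G 0 0 κ (G.π c)) x * h x) := fun κ =>
    hw.2 s κ _ (hh.evalW_mul hsm _)
  simp only [e1]
  rw [← Finset.mul_sum, ← mul_add, ← mul_add]
  congr 1
  have e2 : ∀ κ, (eta κ : ℂ) * wordVal s w (fun x => evalW C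
        (A * (MvPolynomial.X (0, .Ac b κ) - MvPolynomial.X (0, .A b κ)) *
          jjW G 0 0 κ (G.π c)) x * h x) =
      wordVal s w (fun x => (eta κ : ℂ) * (evalW C
        (A * (MvPolynomial.X (0, .Ac b κ) - MvPolynomial.X (0, .A b κ)) *
          jjW G 0 0 κ (G.π c)) x * h x)) := fun κ =>
    (wordVal_const_mul s w _ (hh.evalW_mul hsm _)).symm
  simp only [e2]
  rw [← wordVal_sum s w _ fun κ _ => (hh.evalW_mul hsm _).diagD κ,
    ← wordVal_sum s w _ fun κ _ => (hh.evalW_mul hsm _).const_mul _,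
    ← wordVal_sum s w _ fun κ _ => (hh.ptD 0 κ).evalW_mul hsm _,
    ← wordVal_sum s w _ fun κ _ => (hh.ptD 2 κ).evalW_mul hsm _,
    ← wordVal_add s w (.sum _ fun κ _ => (hh.ptD 0 κ).evalW_mul hsm _)
      (.sum _ fun κ _ => (hh.ptD 2 κ).evalW_mul hsm _),
    ← wordVal_add s w (.sum _ fun κ _ => (hh.evalW_mul hsm _).const_mul _)
      ((IsTest.sum _ fun κ _ => (hh.ptD 0 κ).evalW_mul hsm _).add
        (.sum _ fun κ _ => (hh.ptD 2 κ).evalW_mul hsm _))]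
  congr 1
  funext x
  have hdA : Differentiable ℝ (evalW C A) := (contDiff_evalW hsm A).differentiable (by simp)
  have hdf : Differentiable ℝ fun x : Fin 3 → M => C (.phi b) (x 0) :=
    (hC.differentiable _).comp (differentiable_apply 0)
  have hdj : ∀ κ, Differentiable ℝ fun x : Fin 3 → M => jVal G C κ (G.π c) (x 0) := fun κ =>
    (differentiable_jVal hC κ (G.π c)).comp (differentiable_apply 0)
  have hdAf : Differentiable ℝ fun x : Fin 3 → M => evalW C A x * C (.phi b) (x 0) := hdA.mul hdf
  have hg : ∀ κ, par κ (C (.phi b)) (x 0) = (eta κ : ℂ) * (C (.Ac b κ) (x 0) - C (.A b κ) (x 0)) := by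
    intro κ
    rw [← hC.grad_phi, ← mul_assoc]
    have : (eta κ : ℂ) * eta κ = 1 := by
      unfold eta
      split_ifs <;> simp
    rw [this, one_mul]
  -- Product rule: `A` lives at x' and is constant along this direction, φ gives D, the current
  -- gives its divergence (zero after summation), and the test function gives the total derivatives.
  have e : ∀ κ, diagD κ (fun x =>
        evalW C (A * MvPolynomial.X (0, .phi b) * jjW G 0 0 κ (G.π c)) x * h x) x =
      evalW C A x * C (.phi b) (x 0) * h x * par κ (jVal G C κ (G.π c)) (x 0) +
      ((eta κ : ℂ) * (evalW C (A * (MvPolynomial.X (0, .Ac b κ) - MvPolynomial.X (0, .A b κ)) *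
          jjW G 0 0 κ (G.π c)) x * h x) +
        (evalW C (A * MvPolynomial.X (0, .phi b) * jjW G 0 0 κ (G.π c)) x * ptD 0 κ h x +
          evalW C (A * MvPolynomial.X (0, .phi b) * jjW G 0 0 κ (G.π c)) x * ptD 2 κ h x)) := by
    intro κ
    have hm : Differentiable ℝ fun x => evalW C A x * C (.phi b) (x 0) * jVal G C κ (G.π c) (x 0) :=
      hdAf.mul (hdj κ)
    simp only [diagD, evalW_mul, evalW_jjW, evalW_X, sub_eq_add_neg, evalW_add]
    rw [ptD_mul hm hh.differentiable, ptD_mul hdAf (hdj κ), ptD_mul hdA hdf,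
      ptD_mul hm hh.differentiable, ptD_mul hdAf (hdj κ), ptD_mul hdA hdf,
      ptD_evalW_eq_zero hsm (by simp) hA, ptD_evalW_eq_zero hsm (by simp) hA,
      ptD_comp_apply (differentiable_jVal hC κ (G.π c)), if_pos rfl,
      ptD_comp_apply (hC.differentiable _), if_pos rfl,
      ptD_comp_apply (differentiable_jVal hC κ (G.π c)), if_neg (by decide),
      ptD_comp_apply (hC.differentiable _), if_neg (by decide), hg]
    have hn : evalW C (-MvPolynomial.X (0, Fld.A b κ)) x = -C (.A b κ) (x 0) := by simp [evalW]
    rw [hn]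
    ring
  simp only [e, Finset.sum_add_distrib, ← Finset.mul_sum]
  rw [hC.current_conserved, mul_zero, zero_add]

end SQCD

namespace SQCD

variable {N d : ℕ}

/-! ### Wick polynomials as coefficients -/

section Wick
variable (P Q : Wick N d) (X : Expr N d)

theorem wick_mul_eq_smul : wick P * X = P • X := by
  rw [Algebra.smul_def]; rfl

theorem mul_wick_eq_smul : X * wick P = P • X := by
  rw [Algebra.smul_def, Algebra.commutes]; rfl

theorem wick_eq_smul_one : wick P = P • (1 : Expr N d) := by
  rw [← wick_mul_eq_smul, mul_one]

theorem wick_mul : (wick (P * Q) : Expr N d) = wick P * wick Q := by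
  rw [wick_mul_eq_smul, wick_eq_smul_one, wick_eq_smul_one, mul_smul]

theorem wick_add : (wick (P + Q) : Expr N d) = wick P + wick Q := MonoidAlgebra.single_add ..

theorem wick_sub : (wick (P - Q) : Expr N d) = wick P - wick Q := MonoidAlgebra.single_sub ..

theorem wick_neg : (wick (-P) : Expr N d) = -wick P := MonoidAlgebra.single_neg ..

theorem wick_smul (r : ℂ) : (wick (r • P) : Expr N d) = r • wick P :=
  (MonoidAlgebra.smul_single ..).symm

theorem wick_sum {ι : Type*} (t : Finset ι) (P : ι → Wick N d) :
    (wick (∑ i ∈ t, P i) : Expr N d) = ∑ i ∈ t, wick (P i) :=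
  map_sum (MonoidAlgebra.singleAddHom (1 : FreeMonoid Edge)) P t

theorem single_word_eq_smul (a b : Edge) :
    MonoidAlgebra.single (word a b) P = P • (edge a * edge b : Expr N d) := by
  rw [edge, edge, MonoidAlgebra.single_mul_single, MonoidAlgebra.smul_single, smul_eq_mul, mul_one,
    mul_one, word]

end Wick

/-! ### Derivations on expressions -/

theorem pdv_eq_map (p : Fin 3) (χ : Fld N d) (X : Expr N d) :
    pdv p χ X = MonoidAlgebra.map
      (MvPolynomial.pderiv (R := ℂ) (p, χ)).toLinearMap.toAddMonoidHom X := by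
  induction X using MonoidAlgebra.induction_linear with
  | zero => simp [pdv]
  | add X Y hX hY =>
    rw [MonoidAlgebra.map_add, ← hX, ← hY]
    unfold pdv
    rw [MonoidAlgebra.coeff_add]
    apply Finsupp.sum_add_index' <;> intros <;> simp
  | single w P =>
    unfold pdv
    rw [MonoidAlgebra.coeff_single, Finsupp.sum_single_index (by simp)]
    simp

theorem pdv_single (p : Fin 3) (χ : Fld N d) (w : FreeMonoid Edge) (P : Wick N d) :
    pdv p χ (MonoidAlgebra.single w P) = MonoidAlgebra.single w (MvPolynomial.pderiv (p, χ) P) := by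
  rw [pdv_eq_map]
  simp

open Classical in
theorem pdv_wick_X (p q : Fin 3) (χ ρ : Fld N d) :
    pdv p χ (wick (MvPolynomial.X (q, ρ))) = if q = p ∧ ρ = χ then 1 else 0 := by
  rw [wick, pdv_single, MvPolynomial.pderiv_X, MonoidAlgebra.one_def]
  by_cases h : q = p ∧ ρ = χ
  · obtain ⟨rfl, rfl⟩ := h
    simp
  · have h' : ((p, χ) : Fin 3 × Fld N d) ≠ (q, ρ) := by
      rintro ⟨⟩
      exact h ⟨rfl, rfl⟩
    simp [h]

/-- Maps with the algebraic properties of obstruction maps: derivations on Wick polynomials which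
do not act on kernels. -/
structure IsObst (Ω : Expr N d → Expr N d) : Prop where
  add : ∀ X Y, Ω (X + Y) = Ω X + Ω Y
  smul : ∀ (r : ℂ) X, Ω (r • X) = r • Ω X
  leibniz : ∀ (P : Wick N d) X, Ω (P • X) = Ω (wick P) * X + P • Ω X
  edge : ∀ e, Ω (edge e) = 0

theorem isObst_pdv (p : Fin 3) (χ : Fld N d) : IsObst (pdv p χ) where
  add X Y := by simp only [pdv_eq_map, MonoidAlgebra.map_add]
  smul r X := by
    induction X using MonoidAlgebra.induction_linear with
    | zero => simp [pdv_eq_map]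
    | add X Y hX hY =>
      simp only [pdv_eq_map, MonoidAlgebra.map_add, smul_add] at *
      rw [hX, hY]
    | single w P => rw [MonoidAlgebra.smul_single, pdv_single, pdv_single, MonoidAlgebra.smul_single,
        Derivation.map_smul]
  leibniz P X := by
    induction X using MonoidAlgebra.induction_linear with
    | zero => simp [pdv_eq_map]
    | add X Y hX hY =>
      simp only [pdv_eq_map, MonoidAlgebra.map_add, smul_add, mul_add] at *
      rw [hX, hY]
      abel
    | single w Q =>
      rw [wick, MonoidAlgebra.smul_single, pdv_single, pdv_single, pdv_single,
        MonoidAlgebra.smul_single, MonoidAlgebra.single_mul_single, one_mul,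
        ← MonoidAlgebra.single_add, smul_eq_mul, Derivation.leibniz]
      simp only [smul_eq_mul]
      congr 1
      ring
  edge e := by
    rw [SQCD.edge, pdv_single]
    simp

theorem IsObst.sum {ι : Type*} {t : Finset ι} {Ω : ι → Expr N d → Expr N d}
    (h : ∀ i ∈ t, IsObst (Ω i)) : IsObst fun X => ∑ i ∈ t, Ω i X where
  add X Y := by
    rw [← Finset.sum_add_distrib]
    exact Finset.sum_congr rfl fun i hi => (h i hi).add X Y
  smul r X := by rw [Finset.smul_sum]; exact Finset.sum_congr rfl fun i hi => (h i hi).smul r X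
  leibniz P X := by
    rw [Finset.smul_sum, Finset.sum_mul, ← Finset.sum_add_distrib]
    exact Finset.sum_congr rfl fun i hi => (h i hi).leibniz P X
  edge e := Finset.sum_eq_zero fun i hi => (h i hi).edge e

theorem IsObst.fun_add {Ω Ω' : Expr N d → Expr N d} (h : IsObst Ω) (h' : IsObst Ω') :
    IsObst fun X => Ω X + Ω' X where
  add X Y := by rw [h.add, h'.add]; abel
  smul r X := by rw [h.smul, h'.smul, smul_add]
  leibniz P X := by rw [h.leibniz, h'.leibniz, smul_add, add_mul]; abel
  edge e := by rw [h.edge, h'.edge, add_zero]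

theorem IsObst.mul_left {Ω : Expr N d → Expr N d} (h : IsObst Ω) (c : Expr N d) :
    IsObst fun X => c * Ω X where
  add X Y := by rw [h.add, mul_add]
  smul r X := by rw [h.smul, mul_smul_comm]
  leibniz P X := by rw [h.leibniz, mul_add, mul_smul_comm, mul_assoc]
  edge e := by rw [h.edge, mul_zero]

/-- The coefficients of `Y` and the two-point obstructions only multiply partial derivatives from
the left, which preserves the derivation property. The map is thus controlled by its values on
single fields. -/
theorem isObst_obst (G : GaugeData N d) (Y : Current N d) : IsObst (obst G Y) := by
  unfold obst
  have hp := fun p (χ : Fld N d) (c : Expr N d) => (isObst_pdv p χ).mul_left c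
  refine .sum fun p _ => .fun_add (.sum fun a _ => .sum fun ν _ => ?_) (.sum fun a _ => ?_)
  · refine IsObst.mul_left (.fun_add (.fun_add (.fun_add (hp _ _ _) ?_) ?_) ?_) _
    · exact .sum fun κ _ => hp _ _ _
    · exact .sum fun κ _ => hp _ _ _
    · exact .sum fun κ _ => .sum fun l _ => hp _ _ _
  · exact IsObst.mul_left (.sum fun s _ => .sum fun m _ => .fun_add (hp _ _ _) (hp _ _ _)) _

section IsObst
variable {Ω : Expr N d → Expr N d} (h : IsObst Ω)
include h

theorem IsObst.zero : Ω 0 = 0 := by simpa using h.smul 0 0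

theorem IsObst.neg (X : Expr N d) : Ω (-X) = -Ω X := by
  have h1 := h.add X (-X)
  rw [add_neg_cancel, h.zero] at h1
  exact eq_neg_of_add_eq_zero_right h1.symm

theorem IsObst.sub (X Y : Expr N d) : Ω (X - Y) = Ω X - Ω Y := by
  rw [sub_eq_add_neg, h.add, h.neg, sub_eq_add_neg]

theorem IsObst.map_sum {ι : Type*} (t : Finset ι) (X : ι → Expr N d) :
    Ω (∑ i ∈ t, X i) = ∑ i ∈ t, Ω (X i) := by
  classical
  induction t using Finset.induction_on with
  | empty => simpa using h.zero
  | insert i t hi ih => rw [Finset.sum_insert hi, Finset.sum_insert hi, h.add, ih]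

theorem IsObst.wick_mul (P Q : Wick N d) :
    Ω (wick (P * Q)) = Q • Ω (wick P) + P • Ω (wick Q) := by
  rw [SQCD.wick_mul, wick_mul_eq_smul, h.leibniz, mul_wick_eq_smul]

theorem IsObst.smul_edge (P : Wick N d) {E : Expr N d} (hE : Ω E = 0) :
    Ω (P • E) = Ω (wick P) * E := by
  rw [h.leibniz, hE, smul_zero, add_zero]

end IsObst

/-! ### Obstructions of the fields -/

section Values
variable (G : GaugeData N d) (Y : Current N d) (q : Fin 3)

theorem obst_phi (a : Fin N) : obst G Y (wick (MvPolynomial.X (q, .phi a))) =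
    ∑ ν, Y.T ν a * oF_phi Y.pt q ν := by
  classical
  unfold obst
  rw [Finset.sum_eq_single q (by intro p _ hp; simp [pdv_wick_X, hp.symm]) (by simp)]
  rw [Finset.sum_eq_single a (by intro p _ hp; simp [pdv_wick_X, hp.symm]) (by simp)]
  simp [pdv_wick_X]

theorem obst_Ac (a : Fin N) (κ : Fin 4) : obst G Y (wick (MvPolynomial.X (q, .Ac a κ))) =
    ∑ ν, Y.T ν a * oF_Ac Y.pt q ν κ := by
  classical
  unfold obst
  rw [Finset.sum_eq_single q (by intro p _ hp; simp [pdv_wick_X, hp.symm]) (by simp)]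
  rw [Finset.sum_eq_single a (by intro p _ hp; simp [pdv_wick_X, hp.symm]) (by simp)]
  simp [pdv_wick_X]

theorem obst_A (a : Fin N) (κ : Fin 4) : obst G Y (wick (MvPolynomial.X (q, .A a κ))) =
    ∑ ν, Y.T ν a * oF_A Y.pt q ν κ := by
  classical
  unfold obst
  rw [Finset.sum_eq_single q (by intro p _ hp; simp [pdv_wick_X, hp.symm]) (by simp)]
  rw [Finset.sum_eq_single a (by intro p _ hp; simp [pdv_wick_X, hp.symm]) (by simp)]
  simp [pdv_wick_X]

theorem obst_psi (s : Fin 4) (m : Fin d) : obst G Y (wick (MvPolynomial.X (q, .psi s m))) =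
    ∑ b, Y.R b * oj_psi G Y.pt q b s m := by
  classical
  unfold obst
  rw [Finset.sum_eq_single q (by intro p _ hp; simp [pdv_wick_X, hp.symm]) (by simp)]
  simp only [pdv_wick_X]
  simp only [reduceCtorEq, and_false, if_false, mul_zero, Finset.sum_const_zero, add_zero, zero_add,
    true_and, Fld.psi.injEq, mul_ite, mul_one]
  refine Finset.sum_congr rfl fun b _ => ?_
  congr 1
  rw [Finset.sum_eq_single s (by intro p _ hp; simp [hp.symm]) (by simp)]
  simp

theorem obst_psibar (s : Fin 4) (m : Fin d) : obst G Y (wick (MvPolynomial.X (q, .psibar s m))) =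
    ∑ b, Y.R b * oj_psibar G Y.pt q b s m := by
  classical
  unfold obst
  rw [Finset.sum_eq_single q (by intro p _ hp; simp [pdv_wick_X, hp.symm]) (by simp)]
  simp only [pdv_wick_X]
  simp only [reduceCtorEq, and_false, if_false, mul_zero, Finset.sum_const_zero, add_zero, zero_add,
    true_and, Fld.psibar.injEq, mul_ite, mul_one]
  refine Finset.sum_congr rfl fun b _ => ?_
  congr 1
  rw [Finset.sum_eq_single s (by intro p _ hp; simp [hp.symm]) (by simp)]
  simp

end Values

end SQCD

namespace SQCD

variable {N d : ℕ}

/-! ### Fields as Wick polynomials -/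

noncomputable def phiW (p : Fin 3) (a : Fin N) : Wick N d := MvPolynomial.X (p, .phi a)

/-- `D^κ`. -/
noncomputable def DW (p : Fin 3) (κ : Fin 4) (a : Fin N) : Wick N d :=
  MvPolynomial.X (p, .Ac a κ) - MvPolynomial.X (p, .A a κ)

/-- `S^κ`. -/
noncomputable def SW (p : Fin 3) (κ : Fin 4) (a : Fin N) : Wick N d :=
  MvPolynomial.X (p, .Ac a κ) + MvPolynomial.X (p, .A a κ)

/-- `i[X,Y]`. -/
noncomputable def brW (G : GaugeData N d) (X Y : Fin N → Wick N d) (c : Fin N) : Wick N d :=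
  -∑ a, ∑ b, (G.f a b c : ℂ) • (X a * Y b)

/-- `σ_ν`. -/
noncomputable def sigW (G : GaugeData N d) (p : Fin 3) (ν : Fin 4) (a : Fin N) : Wick N d :=
  (eta ν : ℂ) • brW G (phiW p) (SW p ν) a

section Fields
variable (G : GaugeData N d) (p : Fin 3) (κ : Fin 4) (a : Fin N)

theorem phi_eq : phi p a = wick (phiW p a : Wick N d) := rfl

theorem D_eq : D p κ a = wick (DW p κ a : Wick N d) := by rw [DW, wick_sub]; rfl

theorem S_eq : S p κ a = wick (SW p κ a : Wick N d) := by rw [SW, wick_add]; rfl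

theorem br_wick (X Y : Fin N → Wick N d) :
    br G (fun a => wick (X a)) (fun a => wick (Y a)) = fun a => wick (brW G X Y a) := by
  funext c
  simp only [br, brW, wick_neg, wick_sum, wick_smul, wick_mul]

theorem sig_eq : sig G p κ a = wick (sigW G p κ a) := by
  have h := congrFun (br_wick G (phiW p) (SW p κ)) a
  rw [sigW, wick_smul, ← h, sig]
  congr 2
  funext b
  exact S_eq p κ b

variable (f : Fin 3 → Fin 3)

theorem reindex_phiW : reindex f (phiW p a : Wick N d) = phiW (f p) a := reindex_X ..

theorem reindex_DW : reindex f (DW p κ a : Wick N d) = DW (f p) κ a := by simp [DW]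

theorem reindex_SW : reindex f (SW p κ a : Wick N d) = SW (f p) κ a := by simp [SW]

theorem reindex_brW (X Y : Fin N → Wick N d) :
    reindex f (brW G X Y a) = brW G (fun a => reindex f (X a)) (fun a => reindex f (Y a)) a := by
  simp only [brW, map_neg, map_sum, map_smul, map_mul]

theorem reindex_sigW : reindex f (sigW G p κ a) = sigW G (f p) κ a := by
  simp only [sigW, map_smul, reindex_brW, reindex_phiW, reindex_SW]

theorem gluonW_phiW : gluonW (phiW p a : Wick N d) = phiW p a := by
  simp [gluonW, phiW, Fld.isQuark]

theorem gluonW_DW : gluonW (DW p κ a : Wick N d) = DW p κ a := by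
  simp [gluonW, DW, Fld.isQuark]

theorem gluonW_SW : gluonW (SW p κ a : Wick N d) = SW p κ a := by
  simp [gluonW, SW, Fld.isQuark]

theorem gluonW_brW {X Y : Fin N → Wick N d} (hX : ∀ a, gluonW (X a) = X a)
    (hY : ∀ a, gluonW (Y a) = Y a) : gluonW (brW G X Y a) = brW G X Y a := by
  simp only [brW, map_neg, map_sum, map_smul, map_mul, hX, hY]

theorem gluonW_sigW : gluonW (sigW G p κ a) = sigW G p κ a := by
  rw [sigW, map_smul, gluonW_brW G a (gluonW_phiW p) (gluonW_SW p κ)]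

theorem gluonW_jjW (q : Fin 3) (T : Matrix (Fin d) (Fin d) ℂ) : gluonW (jjW G p q κ T) = 0 := by
  simp [jjW, gluonW, Fld.isQuark]

end Fields

section Current
variable (G : GaugeData N d) (p q : Fin 3) (κ : Fin 4)

theorem jjW_sub (T U : Matrix (Fin d) (Fin d) ℂ) :
    jjW G p q κ (T - U) = jjW G p q κ T - jjW G p q κ U := by
  simp only [jjW, Matrix.sub_apply, mul_sub, sub_smul, Finset.sum_sub_distrib]

theorem jjW_smul (r : ℂ) (T : Matrix (Fin d) (Fin d) ℂ) :
    jjW G p q κ (r • T) = r • jjW G p q κ T := by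
  simp only [jjW, Matrix.smul_apply, smul_eq_mul, Finset.smul_sum, smul_smul]
  simp only [mul_left_comm]

theorem jjW_sum {ι : Type*} (t : Finset ι) (T : ι → Matrix (Fin d) (Fin d) ℂ) :
    jjW G p q κ (∑ i ∈ t, T i) = ∑ i ∈ t, jjW G p q κ (T i) := by
  classical
  induction t using Finset.induction_on with
  | empty => simp [jjW]
  | insert i t hi ih =>
    rw [Finset.sum_insert hi, Finset.sum_insert hi, ← ih, ← sub_neg_eq_add (T i), jjW_sub,
      ← neg_one_smul ℂ (∑ i ∈ t, T i), jjW_smul, neg_one_smul, sub_neg_eq_add]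

/-- The commutator of the representation matrices in a current. -/
theorem jjW_comm (a b : Fin N) : jjW G p q κ (G.π a * G.π b) - jjW G p q κ (G.π b * G.π a) =
    ∑ c, (Complex.I * G.f a b c) • jjW G p q κ (G.π c) := by
  rw [← jjW_sub, G.π_comm, jjW_smul, jjW_sum, Finset.smul_sum]
  simp only [jjW_smul, smul_smul]

theorem jjW_mul_right (T U : Matrix (Fin d) (Fin d) ℂ) :
    jjW G p q κ (T * U) = ∑ s, ∑ t, ∑ m, ∑ n, (G.γ κ s t * T m n) •
      (MvPolynomial.X (p, Fld.psibar s m) * ∑ n', U n n' • MvPolynomial.X (q, Fld.psi t n')) := by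
  simp only [jjW]
  refine Finset.sum_congr rfl fun s _ => Finset.sum_congr rfl fun t _ =>
    Finset.sum_congr rfl fun m _ => ?_
  simp only [Matrix.mul_apply, Finset.mul_sum, Finset.sum_smul, Finset.smul_sum, mul_smul_comm,
    smul_smul]
  rw [Finset.sum_comm]
  simp only [mul_assoc]

theorem jjW_mul_left (T U : Matrix (Fin d) (Fin d) ℂ) :
    jjW G p q κ (U * T) = ∑ s, ∑ t, ∑ m, ∑ n, (G.γ κ s t * T m n) •
      ((∑ m', U m' m • MvPolynomial.X (p, Fld.psibar s m')) * MvPolynomial.X (q, Fld.psi t n)) := by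
  simp only [jjW]
  refine Finset.sum_congr rfl fun s _ => Finset.sum_congr rfl fun t _ => ?_
  simp only [Matrix.mul_apply, Finset.mul_sum, Finset.sum_mul, Finset.sum_smul, Finset.smul_sum,
    smul_mul_assoc, smul_smul]
  rw [Finset.sum_comm]
  conv_lhs => enter [2, n]; rw [Finset.sum_comm]
  rw [Finset.sum_comm]
  refine Finset.sum_congr rfl fun m _ => Finset.sum_congr rfl fun n _ =>
    Finset.sum_congr rfl fun m' _ => ?_
  congr 1
  ring

end Current

/-! ### Obstructions of composite fields -/

/-- `O_μ(F^{μν}(x), D^κ(p))`. -/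
noncomputable def oDiff (x p : Fin 3) (ν κ : Fin 4) : Expr N d :=
  -(Complex.I • (dK (Ker.Ic ν) p x κ - dK (Ker.Iu ν) x p κ))

/-- The part of `O_μ(F^{μν}(x), S^κ(p))` with derivatives of kernels. -/
noncomputable def oSum (x p : Fin 3) (ν κ : Fin 4) : Expr N d :=
  -(Complex.I • (dK (Ker.Ic ν) p x κ + dK (Ker.Iu ν) x p κ))

section Obst
variable (G : GaugeData N d) (Y : Current N d) (q : Fin 3)

/-- The local terms in the obstructions of A(c) and A are equal and cancel in the difference, which
leaves only derivatives of string kernels. -/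
theorem obst_DW (κ : Fin 4) (a : Fin N) :
    obst G Y (wick (DW q κ a)) = ∑ ν, Y.T ν a * oDiff Y.pt q ν κ := by
  rw [DW, wick_sub, (isObst_obst G Y).sub, obst_Ac, obst_A, ← Finset.sum_sub_distrib]
  refine Finset.sum_congr rfl fun ν _ => ?_
  rw [← mul_sub, oF_Ac, oF_A, oDiff]
  simp only [smul_add, smul_sub]
  congr 1
  abel

/-- In the sum the two local terms add up, which is the source of the coefficient -2i. -/
theorem obst_SW (κ : Fin 4) (a : Fin N) :
    obst G Y (wick (SW q κ a)) = (-(2 * Complex.I) * eta κ) • (Y.T κ a * delta Y.pt q) +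
      ∑ ν, Y.T ν a * oSum Y.pt q ν κ := by
  have h : ∀ ν, Y.T ν a * oF_Ac Y.pt q ν κ + Y.T ν a * oF_A Y.pt q ν κ =
      (if ν = κ then (-(2 * Complex.I) * eta ν) • (Y.T ν a * delta Y.pt q) else 0) +
        Y.T ν a * oSum Y.pt q ν κ := by
    intro ν
    rw [oF_Ac, oF_A, oSum]
    split_ifs
    · rw [← mul_add, ← mul_smul_comm, ← mul_add]
      congr 1
      module
    · rw [zero_add, ← mul_add, zero_add, zero_add, ← neg_add, ← smul_add]
  rw [SW, wick_add, (isObst_obst G Y).add, obst_Ac, obst_A, ← Finset.sum_add_distrib]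
  simp only [h, Finset.sum_add_distrib, Finset.sum_ite_eq', Finset.mem_univ, if_true]

/-- The Ward identities move ψ or ψ̄ to the point of `Y` and insert π(ξ_b) on the right or, with a
minus sign, on the left of `T`. The end points are kept independent because one obstruction
separates ψ̄ from ψ before the next one acts. -/
theorem obst_jjW (p : Fin 3) (κ : Fin 4) (T : Matrix (Fin d) (Fin d) ℂ) :
    obst G Y (wick (jjW G p q κ T)) = ∑ b, Y.R b *
      (jjW G p Y.pt κ (T * G.π b) • delta Y.pt q - jjW G Y.pt q κ (G.π b * T) • delta Y.pt p) := by
  have hO := isObst_obst G Y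
  have hpsi : ∀ s m b, oj_psi G Y.pt q b s m =
      (∑ n, G.π b m n • MvPolynomial.X (Y.pt, Fld.psi s n) : Wick N d) • delta Y.pt q := by
    intro s m b
    simp only [oj_psi, fld, ← wick_smul, ← wick_sum, wick_mul_eq_smul]
  have hbar : ∀ s m b, oj_psibar G Y.pt p b s m =
      -((∑ n, G.π b n m • MvPolynomial.X (Y.pt, Fld.psibar s n) : Wick N d) • delta Y.pt p) := by
    intro s m b
    simp only [oj_psibar, fld, ← wick_smul, ← wick_sum, wick_mul_eq_smul]
  have hterm : ∀ s t m n, obst G Y (wick ((G.γ κ s t * T m n) •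
        (MvPolynomial.X (p, Fld.psibar s m) * MvPolynomial.X (q, Fld.psi t n)))) =
      ∑ b, Y.R b * (((G.γ κ s t * T m n) • (MvPolynomial.X (p, Fld.psibar s m) *
          ∑ n', G.π b n n' • MvPolynomial.X (Y.pt, Fld.psi t n')) : Wick N d) • delta Y.pt q -
        ((G.γ κ s t * T m n) • ((∑ m', G.π b m' m • MvPolynomial.X (Y.pt, Fld.psibar s m')) *
          MvPolynomial.X (q, Fld.psi t n)) : Wick N d) • delta Y.pt p) := by
    intro s t m n
    rw [wick_smul, hO.smul, hO.wick_mul, obst_psi, obst_psibar, Finset.smul_sum, Finset.smul_sum,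
      ← Finset.sum_add_distrib, Finset.smul_sum]
    refine Finset.sum_congr rfl fun b _ => ?_
    rw [hpsi, hbar, ← mul_smul_comm, ← mul_smul_comm, ← mul_add, ← mul_smul_comm, smul_neg,
      smul_smul, smul_smul, neg_add_eq_sub, smul_sub, smul_assoc, smul_assoc,
      mul_comm (MvPolynomial.X (q, Fld.psi t n))]
  have hb : ∀ b, Y.R b * (jjW G p Y.pt κ (T * G.π b) • delta Y.pt q -
        jjW G Y.pt q κ (G.π b * T) • delta Y.pt p) = ∑ s, ∑ t, ∑ m, ∑ n,
      Y.R b * (((G.γ κ s t * T m n) • (MvPolynomial.X (p, Fld.psibar s m) *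
          ∑ n', G.π b n n' • MvPolynomial.X (Y.pt, Fld.psi t n')) : Wick N d) • delta Y.pt q -
        ((G.γ κ s t * T m n) • ((∑ m', G.π b m' m • MvPolynomial.X (Y.pt, Fld.psibar s m')) *
          MvPolynomial.X (q, Fld.psi t n)) : Wick N d) • delta Y.pt p) := by
    intro b
    rw [jjW_mul_right, jjW_mul_left]
    simp only [Finset.sum_smul, mul_sub, Finset.mul_sum, Finset.sum_sub_distrib]
  simp only [hb]
  rw [jjW]
  simp only [wick_sum, hO.map_sum, hterm]
  exact (Finset.sum_congr rfl fun s _ => Finset.sum_congr rfl fun t _ => sum_rotate _).trans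
    (sum_rotate _)

end Obst

end SQCD

namespace SQCD

variable {N d : ℕ}

/-! ### The quark part of obstructions -/

/-- The purely gluonic part as a homomorphism. -/
noncomputable def gluonHom : Expr N d →ₐ[ℂ] Expr N d :=
  MonoidAlgebra.mapAlgHom (FreeMonoid Edge) gluonW

theorem gluonHom_wick (P : Wick N d) : gluonHom (wick P) = wick (gluonW P) := by
  simp [gluonHom, wick]

theorem gluonHom_edge (e : Edge) : gluonHom (edge e : Expr N d) = edge e := by
  simp [gluonHom, edge]

theorem gluonHom_K (k : Ker) (p q : Fin 3) : gluonHom (K k p q : Expr N d) = K k p q :=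
  gluonHom_edge _

theorem gluonHom_delta (p q : Fin 3) : gluonHom (delta p q : Expr N d) = delta p q :=
  gluonHom_edge _

theorem gluonHom_dK (k : Ker) (p q : Fin 3) (κ : Fin 4) :
    gluonHom (dK k p q κ : Expr N d) = dK k p q κ := by
  rw [dK, map_smul, gluonHom_edge]

theorem gluonHom_phi (p : Fin 3) (a : Fin N) : gluonHom (phi p a : Expr N d) = phi p a := by
  rw [phi_eq, gluonHom_wick, gluonW_phiW]

theorem gluonHom_fld (p : Fin 3) {χ : Fld N d} (h : χ.isQuark = false) :
    gluonHom (fld p χ) = fld p χ := by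
  rw [fld, gluonHom_wick]
  simp [gluonW, h]

theorem gluonHom_D (p : Fin 3) (κ : Fin 4) (a : Fin N) :
    gluonHom (D p κ a : Expr N d) = D p κ a := by
  rw [D_eq, gluonHom_wick, gluonW_DW]

theorem gluonHom_S (p : Fin 3) (κ : Fin 4) (a : Fin N) :
    gluonHom (S p κ a : Expr N d) = S p κ a := by
  rw [S_eq, gluonHom_wick, gluonW_SW]

theorem gluonHom_sig (G : GaugeData N d) (p : Fin 3) (κ : Fin 4) (a : Fin N) :
    gluonHom (sig G p κ a) = sig G p κ a := by
  rw [sig_eq, gluonHom_wick, gluonW_sigW]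

theorem gluonHom_br (G : GaugeData N d) {X Y : Fin N → Expr N d} (hX : ∀ a, gluonHom (X a) = X a)
    (hY : ∀ a, gluonHom (Y a) = Y a) (a : Fin N) : gluonHom (br G X Y a) = br G X Y a := by
  simp only [br, map_neg, map_sum, map_smul, map_mul, hX, hY]

theorem gluonHom_pair {X Y : Fin N → Expr N d} (hX : ∀ a, gluonHom (X a) = X a)
    (hY : ∀ a, gluonHom (Y a) = Y a) : gluonHom (pair X Y) = pair X Y := by
  simp only [pair, map_sum, map_mul, hX, hY]

theorem gluonHom_Ac2 (G : GaugeData N d) (p : Fin 3) (κ l : Fin 4) (a : Fin N) :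
    gluonHom (Ac2 G p κ l a) = Ac2 G p κ l a :=
  gluonHom_br G (fun _ => gluonHom_fld p rfl) (fun _ => gluonHom_fld p rfl) a

theorem gluonHom_A2 (G : GaugeData N d) (p : Fin 3) (κ l : Fin 4) (a : Fin N) :
    gluonHom (A2 G p κ l a) = A2 G p κ l a :=
  gluonHom_br G (fun _ => gluonHom_fld p rfl) (fun _ => gluonHom_fld p rfl) a

theorem quarkPart_eq (X : Expr N d) : quarkPart X = X - gluonHom X := by
  rw [quarkPart, gluonPart_eq]; rfl

theorem gluonHom_pdv (p : Fin 3) {χ : Fld N d} (hχ : χ.isQuark = false) (X : Expr N d) :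
    gluonHom (pdv p χ X) = pdv p χ (gluonHom X) := by
  induction X using MonoidAlgebra.induction_linear with
  | zero => simp [(isObst_pdv p χ).zero]
  | add X Y hX hY => rw [(isObst_pdv p χ).add, map_add, map_add, (isObst_pdv p χ).add, hX, hY]
  | single w P =>
    rw [pdv_single, gluonHom, MonoidAlgebra.mapAlgHom_single, MonoidAlgebra.mapAlgHom_single,
      pdv_single]
    congr 1
    induction P using MvPolynomial.induction_on with
    | C r => simp [MvPolynomial.algHom_C]
    | add P Q hP hQ => simp only [map_add, hP, hQ]
    | mul_X P v hP =>
      have hX : gluonW (MvPolynomial.pderiv (p, χ) (MvPolynomial.X v : Wick N d)) =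
          MvPolynomial.pderiv (p, χ) (gluonW (MvPolynomial.X v)) := by
        classical
        obtain ⟨q, ρ⟩ := v
        rw [MvPolynomial.pderiv_X]
        by_cases h : ρ.isQuark
        · have hne : ((p, χ) : Fin 3 × Fld N d) ≠ (q, ρ) := by
            rintro ⟨⟩
            simp [hχ] at h
          simp [gluonW, h, hne]
        · by_cases he : ((p, χ) : Fin 3 × Fld N d) = (q, ρ)
          · obtain ⟨rfl, rfl⟩ := Prod.mk.inj he
            simp [gluonW, h]
          · simp [gluonW, h, MvPolynomial.pderiv_X, he]
      rw [Derivation.leibniz, map_add, smul_eq_mul, smul_eq_mul, map_mul, map_mul, hX, hP, map_mul,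
        Derivation.leibniz, smul_eq_mul, smul_eq_mul]

theorem pdv_gluonHom (p : Fin 3) {χ : Fld N d} (hχ : χ.isQuark = true) (X : Expr N d) :
    pdv p χ (gluonHom X) = 0 := by
  induction X using MonoidAlgebra.induction_linear with
  | zero => simp [(isObst_pdv p χ).zero]
  | add X Y hX hY => rw [map_add, (isObst_pdv p χ).add, hX, hY, add_zero]
  | single w P =>
    rw [gluonHom, MonoidAlgebra.mapAlgHom_single, pdv_single]
    have : MvPolynomial.pderiv (p, χ) (gluonW P) = 0 := by
      induction P using MvPolynomial.induction_on with
      | C r => simp [MvPolynomial.algHom_C]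
      | add P Q hP hQ => simp only [map_add, hP, hQ, add_zero]
      | mul_X P v hP =>
        classical
        obtain ⟨q, ρ⟩ := v
        by_cases h : ρ.isQuark
        · simp [gluonW, h]
        · have hne : ((p, χ) : Fin 3 × Fld N d) ≠ (q, ρ) := by
            rintro ⟨⟩
            exact h hχ
          rw [map_mul, Derivation.leibniz, hP]
          simp [gluonW, h, MvPolynomial.pderiv_X, hne]
    rw [this, MonoidAlgebra.single_zero]

section Obst
variable (G : GaugeData N d)

theorem gluonHom_oj_psi (x p : Fin 3) (a : Fin N) (s : Fin 4) (m : Fin d) :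
    gluonHom (oj_psi G x p a s m) = 0 := by
  simp only [oj_psi, map_mul, map_sum, map_smul, fld, gluonHom_wick]
  simp [gluonW, Fld.isQuark, wick]

theorem gluonHom_oj_psibar (x p : Fin 3) (a : Fin N) (s : Fin 4) (m : Fin d) :
    gluonHom (oj_psibar G x p a s m) = 0 := by
  simp only [oj_psibar, map_neg, map_mul, map_sum, map_smul, fld, gluonHom_wick]
  simp [gluonW, Fld.isQuark, wick]

theorem gluonHom_oF (x p : Fin 3) (ν κ l : Fin 4) :
    gluonHom (oF_phi x p ν : Expr N d) = oF_phi x p ν ∧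
    gluonHom (oF_Ac x p ν κ : Expr N d) = oF_Ac x p ν κ ∧
    gluonHom (oF_A x p ν κ : Expr N d) = oF_A x p ν κ ∧
    gluonHom (oF_F x p ν κ l : Expr N d) = oF_F x p ν κ l := by
  refine ⟨?_, ?_, ?_, ?_⟩
  · simp only [oF_phi, map_neg, map_smul, map_add, gluonHom_K]
  · simp only [oF_Ac, map_neg, map_smul, map_add, apply_ite gluonHom, map_zero, gluonHom_dK,
      gluonHom_delta]
  · simp only [oF_A, map_neg, map_smul, map_add, apply_ite gluonHom, map_zero, gluonHom_dK,
      gluonHom_delta]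
  · simp only [oF_F, map_neg, map_smul, map_sub, apply_ite gluonHom, map_zero, gluonHom_dK]

/-- Obstruction maps of gluonic coefficients preserve the quark part. -/
theorem quarkPart_obst {Y : Current N d} (hT : ∀ ν a, gluonHom (Y.T ν a) = Y.T ν a)
    (hR : ∀ a, gluonHom (Y.R a) = Y.R a) (X : Expr N d) :
    quarkPart (obst G Y X) = obst G Y (quarkPart X) := by
  rw [quarkPart_eq, quarkPart_eq, (isObst_obst G Y).sub]
  congr 1
  have h1 : ∀ p a, gluonHom (pdv p (.phi a) X) = pdv p (.phi a) (gluonHom X) := fun p a =>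
    gluonHom_pdv p rfl X
  have h2 : ∀ p a κ, gluonHom (pdv p (.Ac a κ) X) = pdv p (.Ac a κ) (gluonHom X) := fun p a κ =>
    gluonHom_pdv p rfl X
  have h3 : ∀ p a κ, gluonHom (pdv p (.A a κ) X) = pdv p (.A a κ) (gluonHom X) := fun p a κ =>
    gluonHom_pdv p rfl X
  have h4 : ∀ p a κ l, gluonHom (pdv p (.F a κ l) X) = pdv p (.F a κ l) (gluonHom X) :=
    fun p a κ l => gluonHom_pdv p rfl X
  have h5 : ∀ p s m, pdv p (.psi s m) (gluonHom X) = 0 := fun p s m => pdv_gluonHom p rfl X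
  have h6 : ∀ p s m, pdv p (.psibar s m) (gluonHom X) = 0 := fun p s m => pdv_gluonHom p rfl X
  have o1 : ∀ p ν, gluonHom (oF_phi Y.pt p ν : Expr N d) = oF_phi Y.pt p ν := fun p ν =>
    (gluonHom_oF Y.pt p ν 0 0).1
  have o2 : ∀ p ν κ, gluonHom (oF_Ac Y.pt p ν κ : Expr N d) = oF_Ac Y.pt p ν κ := fun p ν κ =>
    (gluonHom_oF Y.pt p ν κ 0).2.1
  have o3 : ∀ p ν κ, gluonHom (oF_A Y.pt p ν κ : Expr N d) = oF_A Y.pt p ν κ := fun p ν κ =>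
    (gluonHom_oF Y.pt p ν κ 0).2.2.1
  have o4 : ∀ p ν κ l, gluonHom (oF_F Y.pt p ν κ l : Expr N d) = oF_F Y.pt p ν κ l :=
    fun p ν κ l => (gluonHom_oF Y.pt p ν κ l).2.2.2
  -- The Ward terms vanish on both sides for different reasons: their coefficients contain a quark
  -- field, and a gluonic expression has no quark derivatives.
  simp only [obst, map_sum, map_add, map_mul, hT, hR, o1, o2, o3, o4, h1, h2, h3, h4, h5, h6,
    gluonHom_oj_psi, gluonHom_oj_psibar, zero_mul, mul_zero, add_zero, Finset.sum_const_zero]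

theorem quarkPart_obst_U1 (p : Fin 3) (X : Expr N d) :
    quarkPart (obst G (U1 G p) X) = obst G (U1 G p) (quarkPart X) := by
  apply quarkPart_obst
  · intro ν a
    simp only [U1, map_smul, gluonHom_sig]
  · exact fun a => gluonHom_phi p a

theorem gluonHom_Iplus (ν : Fin 4) (p q : Fin 3) :
    gluonHom (Iplus ν p q : Expr N d) = Iplus ν p q := by
  simp only [Iplus, map_add, gluonHom_K]

theorem gluonHom_Iminus (ν : Fin 4) (p q : Fin 3) :
    gluonHom (Iminus ν p q : Expr N d) = Iminus ν p q := by
  simp only [Iminus, map_sub, gluonHom_K]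

theorem quarkPart_obst_U2string (X : Expr N d) :
    quarkPart (obst G (U2string G) X) = obst G (U2string G) (quarkPart X) := by
  apply quarkPart_obst
  · intro ν a
    simp only [U2string, map_neg, map_smul, map_sum, map_add, map_mul, gluonHom_Iplus,
      gluonHom_Iminus, gluonHom_br G (gluonHom_S 0 ν) (gluonHom_sig G 1 _),
      gluonHom_br G (gluonHom_D 0 ν) (gluonHom_sig G 1 _)]
  · intro a
    simp only [U2string, map_smul, map_sum, map_mul, gluonHom_sig, gluonHom_Iminus]

theorem quarkPart_obst_U2local (X : Expr N d) :
    quarkPart (obst G (U2local G) X) = obst G (U2local G) (quarkPart X) := by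
  apply quarkPart_obst
  · intro ν a
    simp only [U2local, map_neg, map_smul,
      gluonHom_br G (gluonHom_phi 0) (gluonHom_br G (gluonHom_phi 0) (gluonHom_D 0 ν))]
  · intro a
    simp only [U2local, map_zero]

theorem quarkPart_of_gluonHom {X : Expr N d} (h : gluonHom X = X) : quarkPart X = 0 := by
  rw [quarkPart_eq, h, sub_self]

theorem gluonHom_j (p : Fin 3) (μ : Fin 4) (a : Fin N) : gluonHom (j G p μ a) = 0 := by
  rw [wick_j, gluonHom_wick, gluonW_jjW, wick, MonoidAlgebra.single_zero]

theorem quarkPart_L1 (p : Fin 3) :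
    quarkPart (L1 G p) = ∑ μ, (eta μ : ℂ) • pair (Ac p μ) (j G p μ) := by
  have h : ∀ μ ν, gluonHom (pair (F p μ ν) (Ac2 G p μ ν)) = pair (F p μ ν) (Ac2 G p μ ν) :=
    fun μ ν => gluonHom_pair (fun _ => gluonHom_fld p rfl) (gluonHom_Ac2 G p μ ν)
  rw [quarkPart_eq, L1, map_add, map_smul]
  simp only [map_sum, map_smul, h]
  simp [pair, gluonHom_j]

theorem quarkPart_K1 (p : Fin 3) :
    quarkPart (K1 G p) = ∑ μ, (eta μ : ℂ) • pair (A p μ) (j G p μ) := by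
  have h : ∀ μ ν, gluonHom (pair (F p μ ν) (A2 G p μ ν)) = pair (F p μ ν) (A2 G p μ ν) :=
    fun μ ν => gluonHom_pair (fun _ => gluonHom_fld p rfl) (gluonHom_A2 G p μ ν)
  rw [quarkPart_eq, K1, map_add, map_smul]
  simp only [map_sum, map_smul, h]
  simp [pair, gluonHom_j]

theorem pair_eq_wick (X : Fin N → Wick N d) (p : Fin 3) (μ : Fin 4) :
    pair (fun a => wick (X a)) (j G p μ) = ∑ a, X a • wick (jjW G p p μ (G.π a)) := by
  simp only [pair, wick_j, wick_mul_eq_smul]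

/-- The minimal coupling `⟨X_μ|j^μ⟩` at the point `p`. -/
noncomputable def coupling (p : Fin 3) (X : Fin 4 → Fin N → Wick N d) : Expr N d :=
  ∑ μ, (eta μ : ℂ) • ∑ a, X μ a • wick (jjW G p p μ (G.π a))

theorem quarkPart_sub_L1_K1 (p : Fin 3) : quarkPart (L1 G p - K1 G p) = coupling G p (DW p) := by
  rw [coupling]
  have h : quarkPart (L1 G p - K1 G p) = quarkPart (L1 G p) - quarkPart (K1 G p) := by
    simp only [quarkPart_eq, map_sub]; abel
  rw [h, quarkPart_L1, quarkPart_K1, ← Finset.sum_sub_distrib]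
  refine Finset.sum_congr rfl fun μ _ => ?_
  rw [← smul_sub, ← pair_eq_wick, pair, pair, pair, ← Finset.sum_sub_distrib]
  simp only [← sub_mul, ← D_eq, D]

theorem quarkPart_add_L1_K1 (p : Fin 3) : quarkPart (L1 G p + K1 G p) = coupling G p (SW p) := by
  rw [coupling]
  rw [quarkPart_add, quarkPart_L1, quarkPart_K1, ← Finset.sum_add_distrib]
  refine Finset.sum_congr rfl fun μ _ => ?_
  rw [← smul_add, ← pair_eq_wick, pair, pair, pair, ← Finset.sum_add_distrib]
  simp only [← add_mul, ← S_eq, S]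

theorem quarkPart_P3a : quarkPart (P3a G) = (1 / 2 : ℂ) • obst G (U1 G 0) (obst G (U1 G 1)
    (coupling G 2 (DW 2))) := by
  rw [P3a, quarkPart_smul, quarkPart_obst_U1, quarkPart_obst_U1, quarkPart_sub_L1_K1]

theorem quarkPart_P3b : quarkPart (P3b G) = (-(3 * Complex.I / 2)) •
    (obst G (U2string G) (coupling G 2 (SW 2)) +
      (1 / 2 : ℂ) • (delta 0 1 * obst G (U2local G)
        (coupling G 2 (SW 2)))) := by
  have h : ∀ X : Expr N d, quarkPart (delta 0 1 * X) = delta 0 1 * quarkPart X := by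
    intro X
    simp only [quarkPart_eq, map_mul, gluonHom_delta, mul_sub]
  rw [P3b, obstU2, quarkPart_smul, quarkPart_add, quarkPart_smul, h, quarkPart_obst_U2string,
    quarkPart_obst_U2local, quarkPart_add_L1_K1]

/-- L_2 and K_2 contain no quark fields, and the obstruction by U_1 cannot create any from a gluonic
expression. -/
theorem quarkPart_P3c : quarkPart (P3c G) = 0 := by
  have h : gluonHom ((L2 G 1 + K2 G 1) * delta 1 2) = (L2 G 1 + K2 G 1) * delta 1 2 := by
    simp only [L2, K2, map_mul, map_add, map_neg, map_smul, map_sum, gluonHom_delta,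
      gluonHom_pair (gluonHom_Ac2 G 1 _ _) (gluonHom_Ac2 G 1 _ _),
      gluonHom_pair (gluonHom_A2 G 1 _ _) (gluonHom_A2 G 1 _ _)]
  rw [P3c, quarkPart_smul, quarkPart_obst_U1, quarkPart_of_gluonHom h, (isObst_obst _ _).zero,
    smul_zero]

end Obst

end SQCD

/-! ### Classes modulo total derivatives, kernels on the diagonal x = x'', and the bulk terms. -/

namespace SQCD

variable {N d : ℕ} (G : GaugeData N d)

theorem expr_mul_neg (X Y : Expr N d) : X * -Y = -(X * Y) := mul_neg X Y

theorem expr_neg_mul (X Y : Expr N d) : -X * Y = -(X * Y) := neg_mul X Y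

theorem eta_mul_eta (κ : Fin 4) : (eta κ : ℂ) * eta κ = 1 := by
  unfold eta
  split_ifs <;> simp

/-- The class of `P E` as a linear function of the Wick polynomial `P`. -/
noncomputable def clsL (E : Expr N d) : Wick N d →ₗ[ℂ] Expr N d ⧸ totalDer G :=
  cls G ∘ₗ ((LinearMap.toSpanSingleton (Wick N d) (Expr N d) E).restrictScalars ℂ)

section ClsL
variable {G} {E E' : Expr N d} (P Q : Wick N d)

theorem clsL_apply : clsL G E P = cls G (P • E) := rfl

theorem clsL_add_left : clsL G (E + E') P = clsL G E P + clsL G E' P := by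
  simp only [clsL_apply, smul_add, map_add]

theorem clsL_sub_left : clsL G (E - E') P = clsL G E P - clsL G E' P := by
  simp only [clsL_apply, smul_sub, map_sub]

theorem clsL_smul_left (r : ℂ) : clsL G (r • E) P = r • clsL G E P := by
  rw [clsL_apply, clsL_apply, smul_comm P r E, (cls G).map_smul]

theorem clsL_neg_left : clsL G (-E) P = -clsL G E P := by
  simp only [clsL_apply, smul_neg, map_neg]

theorem clsL_edge_mul_edge (a b : Edge) :
    clsL G (edge a * edge b) P = cls G (MonoidAlgebra.single (word a b) P) := by
  rw [clsL_apply, single_word_eq_smul]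

theorem perm_smul (τ : Equiv.Perm (Fin 3)) (X : Expr N d) :
    perm τ (P • X) = reindex τ P • perm τ X := by
  rw [← wick_mul_eq_smul, ← wick_mul_eq_smul, map_mul]
  congr 1
  rw [wick, perm_single]
  simp [wick]

theorem perm_edge (τ : Equiv.Perm (Fin 3)) (e : Edge) :
    perm τ (edge e : Expr N d) = edge (e.map τ) := by
  rw [edge, perm_single]
  simp [edge]

theorem clsL_perm (τ : Equiv.Perm (Fin 3)) : clsL G (perm τ E) (reindex τ P) = clsL G E P := by
  rw [clsL_apply, clsL_apply, ← perm_smul, cls_perm]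

end ClsL

/-- Kernels supported on `x = x''`. -/
def IsDiagKer (E : Expr N d) : Prop :=
  ∀ P Q : Wick N d, reindex toDiag P = reindex toDiag Q → clsL G E P = clsL G E Q

section IsDiagKer
variable {G} {E E' : Expr N d}

theorem isDiagKer_of_isDiag {a b : Edge} (h : IsDiag (word a b)) :
    IsDiagKer G (edge a * edge b) := by
  intro P Q hPQ
  rw [clsL_edge_mul_edge, clsL_edge_mul_edge, cls_collapse h hPQ]

theorem IsDiagKer.add (h : IsDiagKer G E) (h' : IsDiagKer G E') : IsDiagKer G (E + E') := by
  intro P Q hPQ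
  rw [clsL_add_left, clsL_add_left, h P Q hPQ, h' P Q hPQ]

theorem IsDiagKer.sub (h : IsDiagKer G E) (h' : IsDiagKer G E') : IsDiagKer G (E - E') := by
  intro P Q hPQ
  rw [clsL_sub_left, clsL_sub_left, h P Q hPQ, h' P Q hPQ]

theorem IsDiagKer.smul (r : ℂ) (h : IsDiagKer G E) : IsDiagKer G (r • E) := by
  intro P Q hPQ
  rw [clsL_smul_left, clsL_smul_left, h P Q hPQ]

theorem IsDiagKer.neg (h : IsDiagKer G E) : IsDiagKer G (-E) := by
  intro P Q hPQ
  rw [clsL_neg_left, clsL_neg_left, h P Q hPQ]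

end IsDiagKer

/-- `I^{+ν}_{xx'} δ_{xx''}`. -/
noncomputable def plusKer (ν : Fin 4) : Expr N d := Iplus ν 0 1 * delta 0 2

/-- `I^{-ν}_{xx'} δ_{xx''}`. -/
noncomputable def minusKer (ν : Fin 4) : Expr N d := Iminus ν 0 1 * delta 0 2

/-- `δ_{xx'} δ_{xx''}`. -/
noncomputable def localKer : Expr N d := delta 0 1 * delta 0 2

theorem isDiagKer_plus (ν : Fin 4) : IsDiagKer G (plusKer ν : Expr N d) := by
  rw [plusKer, Iplus, add_mul]
  exact (isDiagKer_of_isDiag (isDiag_out _)).add (isDiagKer_of_isDiag (isDiag_in _))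

theorem isDiagKer_minus (ν : Fin 4) : IsDiagKer G (minusKer ν : Expr N d) := by
  rw [minusKer, Iminus, sub_mul]
  exact (isDiagKer_of_isDiag (isDiag_out _)).sub (isDiagKer_of_isDiag (isDiag_in _))

theorem isDiagKer_local : IsDiagKer G (localKer : Expr N d) :=
  isDiagKer_of_isDiag (isDiag_out .delta)

/-- Kernels which allow an integration by parts along the diagonal. -/
structure IsDerKer (E : Fin 4 → Expr N d) (ν : Fin 4) : Prop where
  diag : ∀ κ, IsDiagKer G (E κ)
  parts : ∀ A : Wick N d, reindex (fun _ => 1) A = A → gluonW A = A → ∀ b c,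
    ∑ κ, (eta κ : ℂ) • clsL G (E κ) (A * phiW 0 b * jjW G 0 0 κ (G.π c)) =
      Complex.I • ∑ κ, (eta κ : ℂ) • clsL G (plusKer ν) (A * DW 0 κ b * jjW G 0 0 κ (G.π c))

section IsDerKer
variable {G}

/-- The I_c and I_u kernels occur in the obstruction of D with opposite signs, and integration by
parts also gives them opposite signs. They therefore combine to I^+, with factor (-i)(-1) = i. -/
theorem isDerKer_of {E : Fin 4 → Expr N d} {ν : Fin 4} {w₁ w₂ : Fin 4 → Edge × Edge}
    (h₁ : IsDiagDer (fun κ => word (w₁ κ).1 (w₁ κ).2) (word ⟨0, 1, .Ic ν, none⟩ d02) (-1))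
    (h₂ : IsDiagDer (fun κ => word (w₂ κ).1 (w₂ κ).2) (word ⟨1, 0, .Iu ν, none⟩ d02) 1)
    (hE : ∀ κ, E κ = -(Complex.I • ((eta κ : ℂ) • (edge (w₁ κ).1 * edge (w₁ κ).2) -
      (eta κ : ℂ) • (edge (w₂ κ).1 * edge (w₂ κ).2)))) : IsDerKer G E ν where
  diag κ := by
    rw [hE]
    exact (((isDiagKer_of_isDiag (h₁.isDiag κ)).smul _).sub
      ((isDiagKer_of_isDiag (h₂.isDiag κ)).smul _)).smul _ |>.neg
  parts A hA hA' b c := by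
    have e1 := cls_diagDer (G := G) h₁ hA hA' b c
    have e2 := cls_diagDer (G := G) h₂ hA hA' b c
    simp only [← clsL_edge_mul_edge] at e1 e2
    have hl : ∀ κ, (eta κ : ℂ) • clsL G (E κ) (A * phiW 0 b * jjW G 0 0 κ (G.π c)) =
        (-Complex.I) • (clsL G (edge (w₁ κ).1 * edge (w₁ κ).2)
            (A * MvPolynomial.X (0, Fld.phi b) * jjW G 0 0 κ (G.π c)) -
          clsL G (edge (w₂ κ).1 * edge (w₂ κ).2)
            (A * MvPolynomial.X (0, Fld.phi b) * jjW G 0 0 κ (G.π c))) := by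
      intro κ
      rw [hE, clsL_neg_left, clsL_smul_left, clsL_sub_left, clsL_smul_left, clsL_smul_left,
        ← smul_sub, smul_comm Complex.I, smul_neg, smul_smul, eta_mul_eta, one_smul, neg_smul]
      rfl
    have hr : ∀ κ, clsL G (plusKer ν) (A * DW 0 κ b * jjW G 0 0 κ (G.π c)) =
        clsL G (edge ⟨0, 1, .Ic ν, none⟩ * edge d02) (A * (MvPolynomial.X (0, .Ac b κ) -
          MvPolynomial.X (0, .A b κ)) * jjW G 0 0 κ (G.π c)) +
        clsL G (edge ⟨1, 0, .Iu ν, none⟩ * edge d02) (A * (MvPolynomial.X (0, .Ac b κ) -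
          MvPolynomial.X (0, .A b κ)) * jjW G 0 0 κ (G.π c)) := by
      intro κ
      rw [← clsL_add_left, ← add_mul]
      rfl
    simp only [hl, hr, smul_add, Finset.sum_add_distrib]
    rw [← Finset.smul_sum, Finset.sum_sub_distrib, e1, e2]
    module

/-- This order of the factors arises when the outer obstruction hits the current; the opposite one
arises when it hits D, after x and x' are exchanged. -/
theorem isDerKer_delta_mul (ν : Fin 4) :
    IsDerKer G (fun κ => delta 0 2 * oDiff 1 2 ν κ) ν := by
  apply isDerKer_of (isDiagDer_delta_out (.Ic ν)) (isDiagDer_delta_in (.Iu ν))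
    (w₁ := fun κ => (d02, ⟨2, 1, .Ic ν, some κ⟩)) (w₂ := fun κ => (d02, ⟨1, 2, .Iu ν, some κ⟩))
  intro κ
  rw [oDiff, dK, dK, expr_mul_neg, mul_smul_comm, mul_sub, mul_smul_comm, mul_smul_comm]
  rfl

theorem isDerKer_mul_delta (ν : Fin 4) :
    IsDerKer G (fun κ => oDiff 1 2 ν κ * delta 0 2) ν := by
  apply isDerKer_of (isDiagDer_out_delta (.Ic ν)) (isDiagDer_in_delta (.Iu ν))
    (w₁ := fun κ => (⟨2, 1, .Ic ν, some κ⟩, d02)) (w₂ := fun κ => (⟨1, 2, .Iu ν, some κ⟩, d02))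
  intro κ
  rw [oDiff, dK, dK, expr_neg_mul, smul_mul_assoc, sub_mul, smul_mul_assoc, smul_mul_assoc]
  rfl

end IsDerKer

/-! ### The bulk terms -/

/-- The class of `⟨i[σ'_ν,D_κ]|j^κ⟩ I^{+ν}_{xx'} δ_{xx''}`. -/
noncomputable def bulkPlus : Expr N d ⧸ totalDer G :=
  ∑ ν, ∑ κ, (eta κ : ℂ) • clsL G (plusKer ν)
    (∑ c, brW G (sigW G 1 ν) (DW 0 κ) c * jjW G 0 0 κ (G.π c))

/-- The class of `⟨i[φ,i[φ,D_κ]]|j^κ⟩ δ_{xx'} δ_{xx''}`. -/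
noncomputable def bulkLocal : Expr N d ⧸ totalDer G :=
  ∑ κ, (eta κ : ℂ) • clsL G localKer
    (∑ c, brW G (phiW 0) (brW G (phiW 0) (DW 0 κ)) c * jjW G 0 0 κ (G.π c))

theorem cls_bulk : cls G (bulk G) = (3 / 4 : ℂ) • bulkPlus G - (1 / 2 : ℂ) • bulkLocal G := by
  have hs : ∀ ν, sig G 1 ν = fun a => wick (sigW G 1 ν a) := fun ν => funext (sig_eq G 1 ν)
  have hD : ∀ κ, (D 0 κ : Fin N → Expr N d) = fun a => wick (DW 0 κ a) := fun κ =>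
    funext (D_eq 0 κ)
  have hp : (phi 0 : Fin N → Expr N d) = fun a => wick (phiW 0 a) := rfl
  have hpair : ∀ (X : Fin N → Wick N d) (κ : Fin 4), pair (fun a => wick (X a)) (j G 0 κ) =
      wick (∑ c, X c * jjW G 0 0 κ (G.π c)) := by
    intro X κ
    simp only [pair, wick_j, wick_sum, wick_mul]
  simp only [bulk, bulkPlus, bulkLocal, clsL_apply, hs, hD, hp, br_wick, hpair, plusKer, localKer,
    wick_mul_eq_smul, smul_mul_assoc, (cls G).map_sub, (cls G).map_smul, map_sum (cls G)]

theorem clsL_sum_brW (E : Expr N d) (X Y : Fin N → Wick N d) (κ : Fin 4) :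
    clsL G E (∑ c, brW G X Y c * jjW G 0 0 κ (G.π c)) =
      -∑ a, ∑ b, ∑ c, (G.f a b c : ℂ) • clsL G E (X a * Y b * jjW G 0 0 κ (G.π c)) := by
  simp only [brW, neg_mul, Finset.sum_mul, smul_mul_assoc, Finset.sum_neg_distrib, map_neg, map_sum,
    map_smul]
  rw [← sum_rotate]

theorem bulkPlus_eq : bulkPlus G = -∑ ν, ∑ a, ∑ κ, (eta κ : ℂ) • ∑ b, ∑ c, (G.f a b c : ℂ) •
    clsL G (plusKer ν) (sigW G 1 ν a * DW 0 κ b * jjW G 0 0 κ (G.π c)) := by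
  rw [bulkPlus, ← Finset.sum_neg_distrib]
  refine Finset.sum_congr rfl fun ν _ => ?_
  rw [Finset.sum_comm, ← Finset.sum_neg_distrib]
  refine Finset.sum_congr rfl fun κ _ => ?_
  rw [clsL_sum_brW, smul_neg, Finset.smul_sum]

/-- The commutator term with a derivative of the string-integrated kernel. -/
theorem sum_clsL_derKer {E : Fin 4 → Expr N d} {ν : Fin 4} (hE : IsDerKer G E ν) (a : Fin N) :
    ∑ κ, (eta κ : ℂ) • ∑ b, clsL G (E κ) (sigW G 1 ν a * phiW 0 b *
        (jjW G 2 0 κ (G.π a * G.π b) - jjW G 0 2 κ (G.π b * G.π a))) =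
      -∑ κ, (eta κ : ℂ) • ∑ b, ∑ c, (G.f a b c : ℂ) •
        clsL G (plusKer ν) (sigW G 1 ν a * DW 0 κ b * jjW G 0 0 κ (G.π c)) := by
  have h1 : ∀ κ b, clsL G (E κ) (sigW G 1 ν a * phiW 0 b *
      (jjW G 2 0 κ (G.π a * G.π b) - jjW G 0 2 κ (G.π b * G.π a))) =
      ∑ c, (Complex.I * G.f a b c) •
        clsL G (E κ) (sigW G 1 ν a * phiW 0 b * jjW G 0 0 κ (G.π c)) := by
    intro κ b
    -- The two bilinears form a commutator only after ψ and ψ̄ have been brought to the same point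
    -- x.
    rw [hE.diag κ _ (sigW G 1 ν a * phiW 0 b *
      (jjW G 0 0 κ (G.π a * G.π b) - jjW G 0 0 κ (G.π b * G.π a)))]
    · rw [jjW_comm]
      simp only [Finset.mul_sum, mul_smul_comm, map_sum, map_smul]
    · simp only [map_mul, map_sub, reindex_jjW]
      rfl
  have h2 : ∀ b c, ∑ κ, (eta κ : ℂ) •
        clsL G (E κ) (sigW G 1 ν a * phiW 0 b * jjW G 0 0 κ (G.π c)) =
      Complex.I • ∑ κ, (eta κ : ℂ) • clsL G (plusKer ν)
        (sigW G 1 ν a * DW 0 κ b * jjW G 0 0 κ (G.π c)) := fun b c =>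
    hE.parts _ (reindex_sigW ..) (gluonW_sigW ..) b c
  simp only [h1, Finset.smul_sum]
  rw [← Finset.sum_neg_distrib]
  calc _ = ∑ b, ∑ c, ∑ κ, (Complex.I * G.f a b c) • (eta κ : ℂ) •
        clsL G (E κ) (sigW G 1 ν a * phiW 0 b * jjW G 0 0 κ (G.π c)) := by
        rw [Finset.sum_comm]
        refine Finset.sum_congr rfl fun b _ => ?_
        rw [Finset.sum_comm]
        exact Finset.sum_congr rfl fun c _ => Finset.sum_congr rfl fun κ _ => smul_comm _ _ _
    _ = ∑ b, ∑ c, ∑ κ, -((eta κ : ℂ) • (G.f a b c : ℂ) •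
        clsL G (plusKer ν) (sigW G 1 ν a * DW 0 κ b * jjW G 0 0 κ (G.π c))) := by
        refine Finset.sum_congr rfl fun b _ => Finset.sum_congr rfl fun c _ => ?_
        rw [← Finset.smul_sum, h2, smul_smul, Finset.smul_sum]
        refine Finset.sum_congr rfl fun κ _ => ?_
        rw [smul_comm (eta κ : ℂ), ← neg_smul]
        congr 1
        -- One factor i comes from the commutator of the representation matrices, the other from the
        -- integration by parts.
        linear_combination (G.f a b c : ℂ) * Complex.I_mul_I
    _ = _ := by
        rw [sum_rotate]
        simp only [Finset.sum_neg_distrib]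

end SQCD

namespace SQCD

variable {N d : ℕ} (G : GaugeData N d)

/-! ### The iterated obstruction of first order -/

theorem U1_T (p : Fin 3) (ν : Fin 4) (a : Fin N) :
    (U1 G p).T ν a = wick ((1 / 2 : ℂ) • sigW G p ν a) := by
  rw [wick_smul, ← sig_eq]
  rfl

theorem obst_U1_DW (p q : Fin 3) (κ : Fin 4) (a : Fin N) :
    obst G (U1 G p) (wick (DW q κ a)) =
      ∑ ν, ((1 / 2 : ℂ) • sigW G p ν a) • oDiff p q ν κ := by
  rw [obst_DW]
  simp only [U1_T, wick_mul_eq_smul]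
  rfl

theorem obst_U1_phiW (p q : Fin 3) (a : Fin N) :
    obst G (U1 G p) (wick (phiW q a)) =
      ∑ ν, ((1 / 2 : ℂ) • sigW G p ν a) • oF_phi p q ν := by
  rw [phiW, obst_phi]
  simp only [U1_T, wick_mul_eq_smul]
  rfl

theorem obst_U1_jjW (p q r : Fin 3) (κ : Fin 4) (T : Matrix (Fin d) (Fin d) ℂ) :
    obst G (U1 G p) (wick (jjW G r q κ T)) = ∑ b, (phiW p b : Wick N d) •
      (jjW G r p κ (T * G.π b) • (delta p q : Expr N d) -
        jjW G p q κ (G.π b * T) • (delta p r : Expr N d)) := by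
  rw [obst_jjW]
  simp only [← wick_mul_eq_smul]
  rfl

theorem obst_delta (Y : Current N d) (p q : Fin 3) : obst G Y (delta p q) = 0 :=
  (isObst_obst G Y).edge _

theorem obst_dK (Y : Current N d) (k : Ker) (p q : Fin 3) (κ : Fin 4) :
    obst G Y (dK k p q κ) = 0 := by
  rw [dK, (isObst_obst G Y).smul, (isObst_obst G Y).edge, smul_zero]

theorem obst_oDiff (Y : Current N d) (x p : Fin 3) (ν κ : Fin 4) :
    obst G Y (oDiff x p ν κ) = 0 := by
  have hO := isObst_obst G Y
  rw [oDiff, hO.neg, hO.smul, hO.sub, obst_dK, obst_dK, sub_self, smul_zero, neg_zero]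

theorem wick_smul_smul (P Q : Wick N d) (X : Expr N d) : P • Q • X = (P * Q) • X :=
  smul_smul P Q X

theorem wick_sub_smul (P Q : Wick N d) (X : Expr N d) : (P - Q) • X = P • X - Q • X :=
  sub_smul P Q X

theorem wick_smul_mul (P : Wick N d) (X Y : Expr N d) : P • X * Y = P • (X * Y) :=
  smul_mul_assoc P X Y

theorem smul_sub_smul_mul {R E : Type*} [CommRing R] [Ring E] [Algebra R E]
    (A p J₁ J₂ J₃ J₄ : R) (X Y Z : E) :
    A • (p • (J₁ • X - J₂ • Y) - p • (J₃ • Y - J₄ • X)) * Z =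
      (A * p * (J₁ + J₄)) • (X * Z) - (A * p * (J₂ + J₃)) • (Y * Z) := by
  simp only [smul_sub, sub_mul, smul_mul_assoc]
  module

theorem obst_U1_coupling_term (κ : Fin 4) (a : Fin N) :
    obst G (U1 G 1) ((DW 2 κ a : Wick N d) • wick (jjW G 2 2 κ (G.π a))) =
      ∑ ν, (((1 / 2 : ℂ) • sigW G 1 ν a) * jjW G 2 2 κ (G.π a)) • (oDiff 1 2 ν κ : Expr N d) +
        ∑ b, (DW 2 κ a * phiW 1 b * (jjW G 2 1 κ (G.π a * G.π b) -
          jjW G 1 2 κ (G.π b * G.π a))) • (delta 1 2 : Expr N d) := by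
  rw [(isObst_obst G (U1 G 1)).leibniz, obst_U1_DW, obst_U1_jjW, mul_wick_eq_smul,
    Finset.smul_sum, Finset.smul_sum]
  refine congrArg₂ (· + ·) (Finset.sum_congr rfl fun ν _ => ?_)
    (Finset.sum_congr rfl fun b _ => ?_)
  · rw [wick_smul_smul, mul_comm]
  · rw [← wick_sub_smul, wick_smul_smul, wick_smul_smul, mul_assoc]

theorem obst_U1_coupling : obst G (U1 G 1) (coupling G 2 (DW 2)) =
    ∑ κ, (eta κ : ℂ) • ∑ a,
      obst G (U1 G 1) ((DW 2 κ a : Wick N d) • wick (jjW G 2 2 κ (G.π a))) := by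
  have hO := isObst_obst G (U1 G 1)
  simp only [coupling, hO.map_sum, hO.smul]

/-- The outer map ignores the kernel, so it hits either σ' or the current at x''. -/
theorem obst_derivative_term (ν κ : Fin 4) (a : Fin N) :
    obst G (U1 G 0) ((((1 / 2 : ℂ) • sigW G 1 ν a) * jjW G 2 2 κ (G.π a)) •
        (oDiff 1 2 ν κ : Expr N d)) =
      obst G (U1 G 0) (wick ((1 / 2 : ℂ) • sigW G 1 ν a)) *
          (oDiff 1 2 ν κ * wick (jjW G 2 2 κ (G.π a))) +
        ∑ b, (((1 / 2 : ℂ) • sigW G 1 ν a) * phiW 0 b * (jjW G 2 0 κ (G.π a * G.π b) -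
          jjW G 0 2 κ (G.π b * G.π a))) • (delta 0 2 * oDiff 1 2 ν κ : Expr N d) := by
  have hO := isObst_obst G (U1 G 0)
  rw [hO.smul_edge _ (obst_oDiff ..), hO.wick_mul, add_mul, obst_U1_jjW, mul_wick_eq_smul,
    mul_smul_comm, wick_smul_mul]
  congr 1
  rw [Finset.smul_sum, Finset.sum_mul]
  refine Finset.sum_congr rfl fun b _ => ?_
  rw [← wick_sub_smul, wick_smul_smul, wick_smul_smul, wick_smul_mul, mul_assoc]

/-- The three sums correspond to the outer map hitting D'', φ' and the bilinears. In the last case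
ψ̄ and ψ sit at different points, so the four products are grouped by the kernel they carry. -/
theorem obst_local_term (κ : Fin 4) (a b : Fin N) :
    obst G (U1 G 0) ((DW 2 κ a * phiW 1 b * (jjW G 2 1 κ (G.π a * G.π b) -
          jjW G 1 2 κ (G.π b * G.π a))) • (delta 1 2 : Expr N d)) =
      ∑ ν, (((1 / 2 : ℂ) • sigW G 0 ν a) * phiW 1 b * (jjW G 2 1 κ (G.π a * G.π b) -
          jjW G 1 2 κ (G.π b * G.π a))) • (oDiff 0 2 ν κ * delta 1 2 : Expr N d) +
      ∑ ν, (((1 / 2 : ℂ) • sigW G 0 ν b) * DW 2 κ a * (jjW G 2 1 κ (G.π a * G.π b) -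
          jjW G 1 2 κ (G.π b * G.π a))) • (oF_phi 0 1 ν * delta 1 2 : Expr N d) +
      ∑ c, ((DW 2 κ a * phiW 1 b * phiW 0 c * (jjW G 2 0 κ (G.π a * G.π b * G.π c) +
            jjW G 0 2 κ (G.π c * (G.π b * G.π a)))) • (delta 0 1 * delta 1 2 : Expr N d) -
          (DW 2 κ a * phiW 1 b * phiW 0 c * (jjW G 0 1 κ (G.π c * (G.π a * G.π b)) +
            jjW G 1 0 κ (G.π b * G.π a * G.π c))) • (delta 0 2 * delta 1 2 : Expr N d)) := by
  have hO := isObst_obst G (U1 G 0)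
  rw [hO.smul_edge _ (obst_delta ..), hO.wick_mul, hO.wick_mul, wick_sub, hO.sub, obst_U1_jjW,
    obst_U1_jjW, obst_U1_DW, obst_U1_phiW, add_mul, smul_add, add_mul]
  congr 1
  · congr 1
    · simp only [Finset.smul_sum, Finset.sum_mul]
      refine Finset.sum_congr rfl fun ν _ => ?_
      rw [wick_smul_smul, wick_smul_smul, wick_smul_mul]
      congr 1
      ring
    · simp only [Finset.smul_sum, Finset.sum_mul]
      refine Finset.sum_congr rfl fun ν _ => ?_
      rw [wick_smul_smul, wick_smul_smul, wick_smul_mul]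
      congr 1
      ring
  · rw [← Finset.sum_sub_distrib, Finset.smul_sum, Finset.sum_mul]
    refine Finset.sum_congr rfl fun c _ => ?_
    exact smul_sub_smul_mul ..

/-! ### Kernels between `x` and `x'` -/

theorem edge_mem_twoPoint {e : Edge} (h₁ : e.src ≠ 2) (h₂ : e.dst ≠ 2) :
    (edge e : Expr N d) ∈ twoPoint N d :=
  Submodule.subset_span ⟨e, 1, h₁, h₂, map_one _, map_one _, rfl⟩

theorem dK_mem_twoPoint (k : Ker) {p q : Fin 3} (h₁ : p ≠ 2) (h₂ : q ≠ 2) (κ : Fin 4) :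
    (dK k p q κ : Expr N d) ∈ twoPoint N d :=
  Submodule.smul_mem _ _ (edge_mem_twoPoint h₁ h₂)

theorem K_mem_twoPoint (k : Ker) {p q : Fin 3} (h₁ : p ≠ 2) (h₂ : q ≠ 2) :
    (K k p q : Expr N d) ∈ twoPoint N d := edge_mem_twoPoint h₁ h₂

theorem smul_mem_twoPoint {P : Wick N d} (h₁ : reindex toTwo P = P) (h₂ : gluonW P = P)
    {Z : Expr N d} (hZ : Z ∈ twoPoint N d) : P • Z ∈ twoPoint N d := by
  induction hZ using Submodule.span_induction with
  | mem Z hZ =>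
    obtain ⟨a, Q, h3, h4, h5, h6, rfl⟩ := hZ
    refine Submodule.subset_span ⟨a, P * Q, h3, h4, ?_, ?_, ?_⟩
    · rw [map_mul, h₁, h5]
    · rw [map_mul, h₂, h6]
    · rw [MonoidAlgebra.smul_single, smul_eq_mul]
  | zero => rw [smul_zero]; exact Submodule.zero_mem _
  | add Z Z' _ _ h h' => rw [smul_add]; exact Submodule.add_mem _ h h'
  | smul r Z _ h => rw [smul_comm]; exact Submodule.smul_mem _ r h

theorem oF_mem_twoPoint (ν κ : Fin 4) :
    (oF_phi 0 1 ν : Expr N d) ∈ twoPoint N d ∧ (oF_Ac 0 1 ν κ : Expr N d) ∈ twoPoint N d ∧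
      (oF_A 0 1 ν κ : Expr N d) ∈ twoPoint N d := by
  have h0 : (0 : Fin 3) ≠ 2 := by decide
  have h1 : (1 : Fin 3) ≠ 2 := by decide
  have hite : (if ν = κ then (eta ν : ℂ) • delta 0 1 else (0 : Expr N d)) ∈ twoPoint N d := by
    split_ifs
    · exact Submodule.smul_mem _ _ (K_mem_twoPoint _ h0 h1)
    · exact Submodule.zero_mem _
  refine ⟨?_, ?_, ?_⟩
  · exact Submodule.neg_mem _ (Submodule.smul_mem _ _ (Submodule.add_mem _ (K_mem_twoPoint _ h1 h0)
      (K_mem_twoPoint _ h0 h1)))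
  · exact Submodule.neg_mem _ (Submodule.smul_mem _ _ (Submodule.add_mem _ hite
      (dK_mem_twoPoint _ h1 h0 κ)))
  · exact Submodule.neg_mem _ (Submodule.smul_mem _ _ (Submodule.add_mem _ hite
      (dK_mem_twoPoint _ h0 h1 κ)))

/-- σ' lives at x' and the current U_1 at x, so x'' does not occur. When the outer obstruction hits
σ', the derivative kernel at x'' is therefore an outer one and the term is a total derivative. -/
theorem obst_sigW_mem_twoPoint (ν : Fin 4) (a : Fin N) :
    obst G (U1 G 0) (wick ((1 / 2 : ℂ) • sigW G 1 ν a)) ∈ twoPoint N d := by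
  have hO := isObst_obst G (U1 G 0)
  have hT : ∀ ν a (Z : Expr N d), Z ∈ twoPoint N d → (U1 G 0).T ν a * Z ∈ twoPoint N d := by
    intro ν a Z hZ
    rw [U1_T, wick_mul_eq_smul]
    apply smul_mem_twoPoint _ _ hZ
    · rw [map_smul, reindex_sigW]; rfl
    · rw [map_smul, gluonW_sigW]
  rw [wick_smul, hO.smul, sigW, wick_smul, hO.smul, brW, wick_neg, hO.neg, wick_sum, hO.map_sum]
  refine Submodule.smul_mem _ _ (Submodule.smul_mem _ _ (Submodule.neg_mem _
    (Submodule.sum_mem _ fun b _ => ?_)))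
  rw [wick_sum, hO.map_sum]
  refine Submodule.sum_mem _ fun c _ => ?_
  rw [wick_smul, hO.smul, hO.wick_mul, SW, wick_add, hO.add, obst_Ac, obst_A, phiW, obst_phi]
  refine Submodule.smul_mem _ _ (Submodule.add_mem _ (smul_mem_twoPoint ?_ ?_ ?_)
    (smul_mem_twoPoint ?_ ?_ (Submodule.add_mem _ ?_ ?_)))
  · exact reindex_SW 1 ν c toTwo
  · exact gluonW_SW 1 ν c
  · exact Submodule.sum_mem _ fun ν' _ => hT _ _ _ (oF_mem_twoPoint ν' ν).1
  · exact reindex_phiW 1 b toTwo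
  · exact gluonW_phiW 1 b
  · exact Submodule.sum_mem _ fun ν' _ => hT _ _ _ (oF_mem_twoPoint ν' ν).2.1
  · exact Submodule.sum_mem _ fun ν' _ => hT _ _ _ (oF_mem_twoPoint ν' ν).2.2

theorem sum_cls_dK {k : Ker} {Z : Expr N d} (hZ : Z ∈ twoPoint N d) (q : Fin 3) (c : Fin N) :
    ∑ κ, (eta κ : ℂ) • cls G (Z * (dK k 2 q κ * wick (jjW G 2 2 κ (G.π c)))) = 0 ∧
    ∑ κ, (eta κ : ℂ) • cls G (Z * (dK k q 2 κ * wick (jjW G 2 2 κ (G.π c)))) = 0 := by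
  constructor
  · rw [← cls_outer (G := G) (isOuter_src q k) hZ c]
    refine Finset.sum_congr rfl fun κ _ => ?_
    rw [dK, smul_mul_assoc, mul_smul_comm, (cls G).map_smul, smul_smul, eta_mul_eta, one_smul]
  · rw [← cls_outer (G := G) (isOuter_dst q k) hZ c]
    refine Finset.sum_congr rfl fun κ _ => ?_
    rw [dK, smul_mul_assoc, mul_smul_comm, (cls G).map_smul, smul_smul, eta_mul_eta, one_smul]

theorem sum_cls_oDiff {Z : Expr N d} (hZ : Z ∈ twoPoint N d) (q : Fin 3) (ν : Fin 4) (c : Fin N) :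
    ∑ κ, (eta κ : ℂ) • cls G (Z * (oDiff q 2 ν κ * wick (jjW G 2 2 κ (G.π c)))) = 0 := by
  have h : ∀ κ, cls G (Z * (oDiff q 2 ν κ * wick (jjW G 2 2 κ (G.π c)))) =
      (-Complex.I) • (cls G (Z * (dK (.Ic ν) 2 q κ * wick (jjW G 2 2 κ (G.π c)))) -
        cls G (Z * (dK (.Iu ν) q 2 κ * wick (jjW G 2 2 κ (G.π c))))) := by
    intro κ
    rw [← (cls G).map_sub, ← (cls G).map_smul, ← mul_sub, ← sub_mul, ← mul_smul_comm,
      ← smul_mul_assoc, neg_smul]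
    rfl
  simp only [h, smul_comm _ (-Complex.I), ← Finset.smul_sum, smul_sub, Finset.sum_sub_distrib,
    (sum_cls_dK G hZ q c).1, (sum_cls_dK G hZ q c).2, sub_zero, smul_zero]

theorem sum_cls_oSum {Z : Expr N d} (hZ : Z ∈ twoPoint N d) (q : Fin 3) (ν : Fin 4) (c : Fin N) :
    ∑ κ, (eta κ : ℂ) • cls G (Z * (oSum q 2 ν κ * wick (jjW G 2 2 κ (G.π c)))) = 0 := by
  have h : ∀ κ, cls G (Z * (oSum q 2 ν κ * wick (jjW G 2 2 κ (G.π c)))) =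
      (-Complex.I) • (cls G (Z * (dK (.Ic ν) 2 q κ * wick (jjW G 2 2 κ (G.π c)))) +
        cls G (Z * (dK (.Iu ν) q 2 κ * wick (jjW G 2 2 κ (G.π c))))) := by
    intro κ
    rw [← (cls G).map_add, ← (cls G).map_smul, ← mul_add, ← add_mul, ← mul_smul_comm,
      ← smul_mul_assoc, neg_smul]
    rfl
  simp only [h, smul_comm _ (-Complex.I), ← Finset.smul_sum, smul_add, Finset.sum_add_distrib,
    (sum_cls_dK G hZ q c).1, (sum_cls_dK G hZ q c).2, add_zero, smul_zero]

end SQCD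

namespace SQCD

variable {N d : ℕ} (G : GaugeData N d)

/-! ### The second-order iteration of `U_1` -/

theorem clsL_perm_eq {τ : Equiv.Perm (Fin 3)} {P Q : Wick N d} (h : reindex τ P = Q)
    (E : Expr N d) : clsL G (perm τ E) Q = clsL G E P := by
  rw [← h, clsL_perm]

theorem map_swap_oDiff (ν κ : Fin 4) :
    perm (Equiv.swap 0 1) (oDiff 1 2 ν κ * delta 0 2 : Expr N d) = oDiff 0 2 ν κ * delta 1 2 := by
  rw [map_mul, oDiff, map_neg, map_smul, map_sub, dK, dK, map_smul, map_smul, perm_edge, perm_edge,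
    delta, K, perm_edge]
  rfl

theorem map_swap_plusKer (ν : Fin 4) :
    perm (Equiv.swap 0 1) (-(Complex.I • plusKer ν) : Expr N d) = oF_phi 0 1 ν * delta 1 2 := by
  rw [map_neg, map_smul, plusKer, map_mul, Iplus, map_add, delta, K, K, K, perm_edge, perm_edge,
    perm_edge, oF_phi, expr_neg_mul, smul_mul_assoc]
  rfl

theorem sum_eta_smul_comm {ι V : Type*} [Fintype ι] [AddCommGroup V] [Module ℂ V]
    (f : Fin 4 → ι → Fin 4 → V) : ∑ κ, (eta κ : ℂ) • ∑ a, ∑ ν, f κ a ν =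
      ∑ ν, ∑ a, ∑ κ, (eta κ : ℂ) • f κ a ν := by
  simp only [Finset.smul_sum]
  rw [sum_rotate]
  exact Finset.sum_congr rfl fun _ _ => Finset.sum_comm

theorem sum_derKer {E : Fin 4 → Fin 4 → Expr N d} (hE : ∀ ν, IsDerKer G (E ν) ν) :
    ∑ κ, (eta κ : ℂ) • ∑ a, ∑ ν, ∑ b, clsL G (E ν κ) (sigW G 1 ν a * phiW 0 b *
        (jjW G 2 0 κ (G.π a * G.π b) - jjW G 0 2 κ (G.π b * G.π a))) = bulkPlus G := by
  rw [sum_eta_smul_comm, bulkPlus_eq, ← Finset.sum_neg_distrib]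
  refine Finset.sum_congr rfl fun ν _ => ?_
  rw [← Finset.sum_neg_distrib]
  exact Finset.sum_congr rfl fun a _ => sum_clsL_derKer G (hE ν) a

/-- The part with σ' hit is an outer divergence; the part with the current hit is integrated by
parts along x = x''. The factor ½ is the one in front of σ in U_1. -/
theorem sum_cls_derivative_term :
    ∑ κ, (eta κ : ℂ) • ∑ a, ∑ ν, cls G (obst G (U1 G 0)
      ((((1 / 2 : ℂ) • sigW G 1 ν a) * jjW G 2 2 κ (G.π a)) • (oDiff 1 2 ν κ : Expr N d))) =
      (1 / 2 : ℂ) • bulkPlus G := by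
  have h : ∀ κ a ν, cls G (obst G (U1 G 0)
      ((((1 / 2 : ℂ) • sigW G 1 ν a) * jjW G 2 2 κ (G.π a)) • (oDiff 1 2 ν κ : Expr N d))) =
      cls G (obst G (U1 G 0) (wick ((1 / 2 : ℂ) • sigW G 1 ν a)) *
          (oDiff 1 2 ν κ * wick (jjW G 2 2 κ (G.π a)))) +
      (1 / 2 : ℂ) • ∑ b, clsL G (delta 0 2 * oDiff 1 2 ν κ) (sigW G 1 ν a * phiW 0 b *
          (jjW G 2 0 κ (G.π a * G.π b) - jjW G 0 2 κ (G.π b * G.π a))) := by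
    intro κ a ν
    rw [obst_derivative_term, (cls G).map_add, map_sum (cls G), Finset.smul_sum]
    congr 1
    refine Finset.sum_congr rfl fun b _ => ?_
    rw [← clsL_apply, smul_mul_assoc, smul_mul_assoc, (clsL G _).map_smul]
  simp only [h, Finset.sum_add_distrib, smul_add]
  rw [sum_eta_smul_comm]
  simp only [sum_cls_oDiff G (obst_sigW_mem_twoPoint G _ _), Finset.sum_const_zero, zero_add]
  rw [← sum_derKer G isDerKer_delta_mul]
  simp only [← Finset.smul_sum, smul_comm (eta _ : ℂ) (1 / 2 : ℂ)]

/-- Exchanging x and x' reduces this to the same integration by parts, now with δ_{xx''} as second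
factor. -/
theorem sum_cls_local_D :
    ∑ κ, (eta κ : ℂ) • ∑ a, ∑ ν, ∑ b, clsL G (oDiff 0 2 ν κ * delta 1 2)
      (((1 / 2 : ℂ) • sigW G 0 ν a) * phiW 1 b * (jjW G 2 1 κ (G.π a * G.π b) -
          jjW G 1 2 κ (G.π b * G.π a))) = (1 / 2 : ℂ) • bulkPlus G := by
  have h : ∀ κ a ν b, clsL G (oDiff 0 2 ν κ * delta 1 2)
      (((1 / 2 : ℂ) • sigW G 0 ν a) * phiW 1 b * (jjW G 2 1 κ (G.π a * G.π b) -
          jjW G 1 2 κ (G.π b * G.π a))) =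
      (1 / 2 : ℂ) • clsL G (oDiff 1 2 ν κ * delta 0 2) (sigW G 1 ν a * phiW 0 b *
          (jjW G 2 0 κ (G.π a * G.π b) - jjW G 0 2 κ (G.π b * G.π a))) := by
    intro κ a ν b
    rw [← map_swap_oDiff, smul_mul_assoc, smul_mul_assoc, (clsL G _).map_smul]
    refine congrArg _ (clsL_perm_eq G ?_ _)
    simp only [map_mul, map_sub, reindex_sigW, reindex_phiW, reindex_jjW]
    rfl
  simp only [h]
  rw [← sum_derKer G isDerKer_mul_delta]
  simp only [← Finset.smul_sum, smul_comm (eta _ : ℂ) (1 / 2 : ℂ)]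

/-- D is already present and the kernel is -i I^+ after the exchange of x and x', so no integration
by parts is needed. The commutator supplies the second factor i, and antisymmetry of `f` fixes the
sign. -/
theorem sum_cls_local_phi :
    ∑ κ, (eta κ : ℂ) • ∑ a, ∑ b, ∑ ν, clsL G (oF_phi 0 1 ν * delta 1 2)
      (((1 / 2 : ℂ) • sigW G 0 ν b) * DW 2 κ a * (jjW G 2 1 κ (G.π a * G.π b) -
          jjW G 1 2 κ (G.π b * G.π a))) = (1 / 2 : ℂ) • bulkPlus G := by
  have h : ∀ κ a ν b, clsL G (oF_phi 0 1 ν * delta 1 2)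
      (((1 / 2 : ℂ) • sigW G 0 ν b) * DW 2 κ a * (jjW G 2 1 κ (G.π a * G.π b) -
          jjW G 1 2 κ (G.π b * G.π a))) =
      (1 / 2 : ℂ) • ∑ c, (G.f a b c : ℂ) • clsL G (plusKer ν)
        (sigW G 1 ν b * DW 0 κ a * jjW G 0 0 κ (G.π c)) := by
    intro κ a ν b
    have h1 : clsL G (oF_phi 0 1 ν * delta 1 2) (sigW G 0 ν b * DW 2 κ a *
          (jjW G 2 1 κ (G.π a * G.π b) - jjW G 1 2 κ (G.π b * G.π a))) =
        clsL G (-(Complex.I • plusKer ν)) (sigW G 1 ν b * DW 2 κ a *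
          (jjW G 2 0 κ (G.π a * G.π b) - jjW G 0 2 κ (G.π b * G.π a))) := by
      rw [← map_swap_plusKer]
      apply clsL_perm_eq
      simp only [map_mul, map_sub, reindex_sigW, reindex_DW, reindex_jjW]
      rfl
    rw [smul_mul_assoc, smul_mul_assoc, (clsL G _).map_smul, h1, clsL_neg_left, clsL_smul_left,
      isDiagKer_plus G ν _ (sigW G 1 ν b * DW 0 κ a *
        (jjW G 0 0 κ (G.π a * G.π b) - jjW G 0 0 κ (G.π b * G.π a)))]
    · rw [jjW_comm, Finset.mul_sum, map_sum, Finset.smul_sum, ← Finset.sum_neg_distrib]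
      congr 1
      refine Finset.sum_congr rfl fun c _ => ?_
      rw [mul_smul_comm, (clsL G _).map_smul, smul_smul, ← neg_smul]
      congr 1
      linear_combination -(G.f a b c : ℂ) * Complex.I_mul_I
    · simp only [map_mul, map_sub, reindex_sigW, reindex_DW, reindex_jjW]
      rfl
  have h2 : ∀ ν a κ b c, (G.f b a c : ℂ) • clsL G (plusKer ν)
        (sigW G 1 ν a * DW 0 κ b * jjW G 0 0 κ (G.π c)) = -((G.f a b c : ℂ) • clsL G (plusKer ν)
        (sigW G 1 ν a * DW 0 κ b * jjW G 0 0 κ (G.π c))) := by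
    intro ν a κ b c
    rw [G.antisymm_left b a c, Complex.ofReal_neg, neg_smul]
  simp only [h, ← Finset.smul_sum, smul_comm (eta _ : ℂ) (1 / 2 : ℂ)]
  congr 1
  calc _ = ∑ κ, (eta κ : ℂ) • ∑ a, ∑ ν, ∑ b, ∑ c, (G.f b a c : ℂ) • clsL G (plusKer ν)
        (sigW G 1 ν a * DW 0 κ b * jjW G 0 0 κ (G.π c)) := by
        refine Finset.sum_congr rfl fun κ _ => ?_
        rw [Finset.sum_comm]
        exact congrArg _ (Finset.sum_congr rfl fun a _ => Finset.sum_comm)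
    _ = _ := by
        rw [sum_eta_smul_comm, bulkPlus_eq]
        simp only [h2, Finset.sum_neg_distrib, smul_neg]

theorem clsL_delta_collapse {p q r t : Fin 3}
    (h : Linked ⟨p, q, .delta, none⟩ ⟨r, t, .delta, none⟩) {P Q : Wick N d}
    (hPQ : reindex (fun _ => 0) P = Q) :
    clsL G (delta p q * delta r t) P = clsL G localKer Q := by
  rw [localKer, delta, delta, delta, delta, K, K, K, K, clsL_edge_mul_edge, clsL_edge_mul_edge]
  refine cls_collapse_delta h (by simp [Linked]) ?_
  have hr : (reindex fun _ => 0).comp (reindex fun _ => 0) =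
      (reindex fun _ => 0 : Wick N d →ₐ[ℂ] _) :=
    MvPolynomial.algHom_ext fun v => by obtain ⟨p, χ⟩ := v; simp
  rw [← hPQ, ← AlgHom.comp_apply, hr]

/-- The four products are those of [[π_a, π_b], π_c]; each commutator contributes a factor i. -/
theorem double_comm (a b c : Fin N) :
    G.π a * G.π b * G.π c + G.π c * (G.π b * G.π a) - (G.π c * (G.π a * G.π b) +
      G.π b * G.π a * G.π c) = -∑ e, ∑ g, (G.f a b e * G.f e c g : ℂ) • G.π g := by
  have h1 : G.π a * G.π b * G.π c + G.π c * (G.π b * G.π a) - (G.π c * (G.π a * G.π b) +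
      G.π b * G.π a * G.π c) = (G.π a * G.π b - G.π b * G.π a) * G.π c -
        G.π c * (G.π a * G.π b - G.π b * G.π a) := by noncomm_ring
  have h2 : ∀ e, G.π e * G.π c - G.π c * G.π e = Complex.I • ∑ g, (G.f e c g : ℂ) • G.π g :=
    fun e => G.π_comm e c
  rw [h1, G.π_comm, smul_mul_assoc, mul_smul_comm, ← smul_sub, Finset.sum_mul, Finset.mul_sum,
    ← Finset.sum_sub_distrib]
  simp only [smul_mul_assoc, mul_smul_comm, ← smul_sub, h2]
  rw [Finset.smul_sum, ← Finset.sum_neg_distrib]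
  refine Finset.sum_congr rfl fun e _ => ?_
  rw [smul_comm _ Complex.I, smul_smul, Complex.I_mul_I, neg_one_smul, Finset.smul_sum]
  simp only [smul_smul]

theorem bulkLocal_eq : bulkLocal G = ∑ κ, (eta κ : ℂ) • ∑ a, ∑ b, ∑ c, ∑ e, ∑ g,
    (G.f a b e * G.f e c g : ℂ) • clsL G localKer
      (DW 0 κ a * phiW 0 b * phiW 0 c * jjW G 0 0 κ (G.π g)) := by
  rw [bulkLocal]
  refine Finset.sum_congr rfl fun κ _ => ?_
  congr 1
  have h : ∀ c e g, (G.f c e g : ℂ) • clsL G localKer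
      (phiW 0 c * brW G (phiW 0) (DW 0 κ) e * jjW G 0 0 κ (G.π g)) =
      -∑ b, ∑ a, (G.f a b e * G.f e c g : ℂ) • clsL G localKer
      (DW 0 κ a * phiW 0 b * phiW 0 c * jjW G 0 0 κ (G.π g)) := by
    intro c e g
    simp only [brW, mul_neg, neg_mul, Finset.mul_sum, Finset.sum_mul, mul_smul_comm, smul_mul_assoc,
      map_neg, map_sum, (clsL G _).map_smul, smul_neg, Finset.smul_sum, smul_smul]
    refine congrArg _ (Finset.sum_congr rfl fun b _ => Finset.sum_congr rfl fun a _ => ?_)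
    -- Both structure constants are turned around, so the signs cancel each other and the minus sign
    -- comes from `brW` alone.
    rw [G.antisymm_left c e g, G.antisymm_left b a e]
    refine congrArg₂ (fun (r : ℂ) P => r • clsL G localKer P) ?_ ?_
    · push_cast
      ring
    · ring
  have hr : ∀ f : Fin N → Fin N → Fin N → Fin N → Expr N d ⧸ totalDer G,
      ∑ c, ∑ e, ∑ g, ∑ b, f c e g b = ∑ b, ∑ c, ∑ e, ∑ g, f c e g b := by
    exact fun f => (Finset.sum_congr rfl fun c _ => sum_rotate _).trans Finset.sum_comm
  rw [clsL_sum_brW]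
  simp only [h, Finset.sum_neg_distrib, neg_neg]
  rw [hr]
  exact (Finset.sum_congr rfl fun b _ => hr _).trans Finset.sum_comm

/-- Both products of delta functions are the delta function of the total diagonal. There all fields
come to one point and the double commutator becomes the nested bracket of φ, φ and D. -/
theorem sum_cls_local_delta :
    ∑ κ, (eta κ : ℂ) • ∑ a, ∑ b, ∑ c,
      (clsL G (delta 0 1 * delta 1 2) (DW 2 κ a * phiW 1 b * phiW 0 c *
          (jjW G 2 0 κ (G.π a * G.π b * G.π c) + jjW G 0 2 κ (G.π c * (G.π b * G.π a)))) -
        clsL G (delta 0 2 * delta 1 2) (DW 2 κ a * phiW 1 b * phiW 0 c *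
          (jjW G 0 1 κ (G.π c * (G.π a * G.π b)) + jjW G 1 0 κ (G.π b * G.π a * G.π c)))) =
      -bulkLocal G := by
  have h : ∀ κ a b c, clsL G (delta 0 1 * delta 1 2) (DW 2 κ a * phiW 1 b * phiW 0 c *
          (jjW G 2 0 κ (G.π a * G.π b * G.π c) + jjW G 0 2 κ (G.π c * (G.π b * G.π a)))) -
        clsL G (delta 0 2 * delta 1 2) (DW 2 κ a * phiW 1 b * phiW 0 c *
          (jjW G 0 1 κ (G.π c * (G.π a * G.π b)) + jjW G 1 0 κ (G.π b * G.π a * G.π c))) =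
      -∑ e, ∑ g, (G.f a b e * G.f e c g : ℂ) • clsL G localKer
        (DW 0 κ a * phiW 0 b * phiW 0 c * jjW G 0 0 κ (G.π g)) := by
    intro κ a b c
    have hm : jjW G 0 0 κ (G.π a * G.π b * G.π c) + jjW G 0 0 κ (G.π c * (G.π b * G.π a)) -
        (jjW G 0 0 κ (G.π c * (G.π a * G.π b)) + jjW G 0 0 κ (G.π b * G.π a * G.π c)) =
        -∑ e, ∑ g, (G.f a b e * G.f e c g : ℂ) • jjW G 0 0 κ (G.π g) := by
      have hs : ∀ T U : Matrix (Fin d) (Fin d) ℂ,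
          jjW G 0 0 κ (T + U) = jjW G 0 0 κ T + jjW G 0 0 κ U := by
        intro T U
        rw [← sub_neg_eq_add, jjW_sub, ← neg_one_smul ℂ U, jjW_smul, neg_one_smul, sub_neg_eq_add]
      rw [← hs, ← hs, ← jjW_sub, double_comm, ← neg_one_smul ℂ (∑ e, _), jjW_smul, neg_one_smul,
        jjW_sum]
      simp only [jjW_sum, jjW_smul]
    rw [clsL_delta_collapse G (by simp [Linked]) (Q := DW 0 κ a * phiW 0 b * phiW 0 c *
          (jjW G 0 0 κ (G.π a * G.π b * G.π c) + jjW G 0 0 κ (G.π c * (G.π b * G.π a)))),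
      clsL_delta_collapse G (by simp [Linked]) (Q := DW 0 κ a * phiW 0 b * phiW 0 c *
          (jjW G 0 0 κ (G.π c * (G.π a * G.π b)) + jjW G 0 0 κ (G.π b * G.π a * G.π c))),
      ← (clsL G _).map_sub, ← mul_sub, hm]
    · simp only [mul_neg, Finset.mul_sum, mul_smul_comm, map_neg, map_sum, (clsL G _).map_smul]
    · simp only [map_mul, map_add, reindex_DW, reindex_phiW, reindex_jjW]
    · simp only [map_mul, map_add, reindex_DW, reindex_phiW, reindex_jjW]
  simp only [h, bulkLocal_eq, Finset.sum_neg_distrib, smul_neg]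

/-- The three contributions ½ `bulkPlus` and the contribution -`bulkLocal` are multiplied by the
prefactor ½ of the iterated obstruction. -/
theorem cls_quarkPart_P3a : cls G (quarkPart (P3a G)) = cls G (bulk G) := by
  have h : ∀ κ a b, cls G (obst G (U1 G 0) ((DW 2 κ a * phiW 1 b * (jjW G 2 1 κ (G.π a * G.π b) -
          jjW G 1 2 κ (G.π b * G.π a))) • (delta 1 2 : Expr N d))) =
      ∑ ν, clsL G (oDiff 0 2 ν κ * delta 1 2)
        (((1 / 2 : ℂ) • sigW G 0 ν a) * phiW 1 b * (jjW G 2 1 κ (G.π a * G.π b) -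
          jjW G 1 2 κ (G.π b * G.π a))) +
      ∑ ν, clsL G (oF_phi 0 1 ν * delta 1 2)
        (((1 / 2 : ℂ) • sigW G 0 ν b) * DW 2 κ a * (jjW G 2 1 κ (G.π a * G.π b) -
          jjW G 1 2 κ (G.π b * G.π a))) +
      ∑ c, (clsL G (delta 0 1 * delta 1 2) (DW 2 κ a * phiW 1 b * phiW 0 c *
          (jjW G 2 0 κ (G.π a * G.π b * G.π c) + jjW G 0 2 κ (G.π c * (G.π b * G.π a)))) -
        clsL G (delta 0 2 * delta 1 2) (DW 2 κ a * phiW 1 b * phiW 0 c *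
          (jjW G 0 1 κ (G.π c * (G.π a * G.π b)) + jjW G 1 0 κ (G.π b * G.π a * G.π c)))) := by
    intro κ a b
    rw [obst_local_term, (cls G).map_add, (cls G).map_add, map_sum (cls G), map_sum (cls G),
      map_sum (cls G)]
    simp only [clsL_apply, (cls G).map_sub]
  have h0 := isObst_obst G (U1 G 0)
  have hD := sum_cls_local_D G
  have hc : ∀ κ a, ∑ ν, ∑ b, clsL G (oDiff 0 2 ν κ * delta 1 2)
      (((1 / 2 : ℂ) • sigW G 0 ν a) * phiW 1 b * (jjW G 2 1 κ (G.π a * G.π b) -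
          jjW G 1 2 κ (G.π b * G.π a))) = ∑ b, ∑ ν, clsL G (oDiff 0 2 ν κ * delta 1 2)
      (((1 / 2 : ℂ) • sigW G 0 ν a) * phiW 1 b * (jjW G 2 1 κ (G.π a * G.π b) -
          jjW G 1 2 κ (G.π b * G.π a))) := fun κ a => Finset.sum_comm
  simp only [hc] at hD
  rw [quarkPart_P3a, obst_U1_coupling, (cls G).map_smul, h0.map_sum, map_sum (cls G)]
  simp only [h0.smul, h0.map_sum, obst_U1_coupling_term, h0.add, (cls G).map_smul, map_sum (cls G),
    (cls G).map_add, h, Finset.sum_add_distrib, smul_add]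
  rw [sum_cls_derivative_term, hD, sum_cls_local_phi, sum_cls_local_delta, cls_bulk]
  module

end SQCD

namespace SQCD

variable {N d : ℕ} (G : GaugeData N d)

/-! ### The obstruction of second order -/

/-- The hypothesis on `Z` makes the derivative kernels in the obstruction of S outer, so they drop
out. The factor `Z` is 1 for the string part of U_2 and δ_{xx'} for its local part. -/
theorem cls_mul_obst_coupling (Y : Current N d) (hY : Y.pt = 0) (Z : Expr N d)
    (hZ : ∀ ν a, Z * Y.T ν a ∈ twoPoint N d) :
    cls G (Z * obst G Y (coupling G 2 (SW 2))) =
      ∑ κ, (eta κ : ℂ) • ∑ a, (((-(2 * Complex.I) * eta κ) •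
          cls G (Z * Y.T κ a * (delta 0 2 * wick (jjW G 2 2 κ (G.π a))))) +
        cls G (Z * ((SW 2 κ a : Wick N d) • obst G Y (wick (jjW G 2 2 κ (G.π a)))))) := by
  have hO := isObst_obst G Y
  have h : ∀ κ a, cls G (Z * obst G Y ((SW 2 κ a : Wick N d) • wick (jjW G 2 2 κ (G.π a)))) =
      ∑ ν, cls G (Z * Y.T ν a * (oSum 0 2 ν κ * wick (jjW G 2 2 κ (G.π a)))) +
      ((-(2 * Complex.I) * eta κ) •
          cls G (Z * Y.T κ a * (delta 0 2 * wick (jjW G 2 2 κ (G.π a)))) +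
        cls G (Z * ((SW 2 κ a : Wick N d) • obst G Y (wick (jjW G 2 2 κ (G.π a)))))) := by
    intro κ a
    rw [hO.leibniz, obst_SW, hY, add_mul, mul_add, mul_add, (cls G).map_add, (cls G).map_add,
      smul_mul_assoc, mul_smul_comm, (cls G).map_smul, Finset.sum_mul, Finset.mul_sum,
      map_sum (cls G)]
    simp only [mul_assoc]
    abel
  have h0 : ∑ κ, (eta κ : ℂ) • ∑ a, ∑ ν,
      cls G (Z * Y.T ν a * (oSum 0 2 ν κ * wick (jjW G 2 2 κ (G.π a)))) = 0 := by
    rw [sum_eta_smul_comm]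
    simp only [sum_cls_oSum G (hZ _ _), Finset.sum_const_zero]
  simp only [coupling, hO.map_sum, hO.smul, Finset.mul_sum, mul_smul_comm, map_sum (cls G),
    (cls G).map_smul, h]
  have hs : ∀ f g : Fin 4 → Fin N → Expr N d ⧸ totalDer G,
      ∑ κ, (eta κ : ℂ) • ∑ a, (f κ a + g κ a) =
        ∑ κ, (eta κ : ℂ) • ∑ a, f κ a + ∑ κ, (eta κ : ℂ) • ∑ a, g κ a := by
    intro f g
    simp only [Finset.sum_add_distrib, smul_add]
  refine (hs _ _).trans ?_
  rw [h0, zero_add]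

theorem U2string_T (ν : Fin 4) (a : Fin N) :
    (U2string G).T ν a = -((1 / 4 : ℂ) • ∑ l, (eta ν : ℂ) •
    (brW G (SW 0 ν) (sigW G 1 l) a • (Iminus l 0 1 : Expr N d) +
      brW G (DW 0 ν) (sigW G 1 l) a • (Iplus l 0 1 : Expr N d))) := by
  have hs : ∀ l, sig G 1 l = fun a => wick (sigW G 1 l a) := fun l => funext (sig_eq G 1 l)
  have hD : (D 0 ν : Fin N → Expr N d) = fun a => wick (DW 0 ν a) := funext (D_eq 0 ν)
  have hS : (S 0 ν : Fin N → Expr N d) = fun a => wick (SW 0 ν a) := funext (S_eq 0 ν)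
  simp only [U2string, hs, hD, hS, br_wick, wick_mul_eq_smul]

theorem U2string_R (b : Fin N) : (U2string G).R b =
    (1 / 2 : ℂ) • ∑ ν, sigW G 1 ν b • (Iminus ν 0 1 : Expr N d) := by
  simp only [U2string, sig_eq, wick_mul_eq_smul]

theorem U2local_T (ν : Fin 4) (a : Fin N) : (U2local G).T ν a =
    -((1 / 3 : ℂ) • (eta ν : ℂ) • wick (brW G (phiW 0) (brW G (phiW 0) (DW 0 ν)) a)) := by
  have hp : (phi 0 : Fin N → Expr N d) = fun a => wick (phiW 0 a) := rfl
  have hD : (D 0 ν : Fin N → Expr N d) = fun a => wick (DW 0 ν a) := funext (D_eq 0 ν)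
  simp only [U2local, hp, hD, br_wick]

theorem U2string_T_mem (ν : Fin 4) (a : Fin N) : (U2string G).T ν a ∈ twoPoint N d := by
  have h0 : (0 : Fin 3) ≠ 2 := by decide
  have h1 : (1 : Fin 3) ≠ 2 := by decide
  rw [U2string_T]
  refine Submodule.neg_mem _ (Submodule.smul_mem _ _ (Submodule.sum_mem _ fun l _ =>
    Submodule.smul_mem _ _ (Submodule.add_mem _ (smul_mem_twoPoint ?_ ?_ (Submodule.sub_mem _
      (K_mem_twoPoint _ h0 h1) (K_mem_twoPoint _ h1 h0))) (smul_mem_twoPoint ?_ ?_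
        (Submodule.add_mem _ (K_mem_twoPoint _ h0 h1) (K_mem_twoPoint _ h1 h0))))))
  · simp only [reindex_brW, reindex_SW, reindex_sigW]
    rfl
  · exact gluonW_brW G a (gluonW_SW 0 ν) (gluonW_sigW G 1 l)
  · simp only [reindex_brW, reindex_DW, reindex_sigW]
    rfl
  · exact gluonW_brW G a (gluonW_DW 0 ν) (gluonW_sigW G 1 l)

theorem delta_mul_U2local_T_mem (ν : Fin 4) (a : Fin N) :
    delta 0 1 * (U2local G).T ν a ∈ twoPoint N d := by
  rw [U2local_T, expr_mul_neg, mul_smul_comm, mul_smul_comm, mul_wick_eq_smul]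
  refine Submodule.neg_mem _ (Submodule.smul_mem _ _ (Submodule.smul_mem _ _
    (smul_mem_twoPoint ?_ ?_ (K_mem_twoPoint _ (by decide) (by decide)))))
  · simp only [reindex_brW, reindex_phiW, reindex_DW]
    rfl
  · exact gluonW_brW G a (gluonW_phiW 0) fun b => gluonW_brW G b (gluonW_phiW 0) (gluonW_DW 0 ν)

/-- The local part of U_2 has no j-coefficient, and its F-free component contributes nothing to an
obstruction. What remains is (-2i)(-1/3) = 2i/3. -/
theorem cls_U2local :
    cls G (delta 0 1 * obst G (U2local G) (coupling G 2 (SW 2))) =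
      (2 / 3 * Complex.I) • bulkLocal G := by
  have hj : ∀ κ a, obst G (U2local G) (wick (jjW G 2 2 κ (G.π a))) = 0 := by
    intro κ a
    rw [obst_jjW]
    exact Finset.sum_eq_zero fun b _ => zero_mul _
  have hT : ∀ κ a, cls G (delta 0 1 * (U2local G).T κ a * (delta 0 2 * wick (jjW G 2 2 κ (G.π a)))) =
      (-(1 / 3 : ℂ) * eta κ) • clsL G localKer
        (brW G (phiW 0) (brW G (phiW 0) (DW 0 κ)) a * jjW G 0 0 κ (G.π a)) := by
    intro κ a
    rw [isDiagKer_local G _ (brW G (phiW 0) (brW G (phiW 0) (DW 0 κ)) a * jjW G 2 2 κ (G.π a)),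
      clsL_apply, U2local_T, expr_mul_neg, mul_smul_comm, mul_smul_comm, mul_wick_eq_smul,
      mul_wick_eq_smul, expr_neg_mul, smul_mul_assoc, smul_mul_assoc, wick_smul_mul, mul_smul_comm,
      wick_smul_smul, map_neg, (cls G).map_smul, (cls G).map_smul, smul_smul, ← neg_smul, localKer,
      neg_mul]
    simp only [map_mul, reindex_brW, reindex_jjW, reindex_phiW, reindex_DW]
    rfl
  rw [cls_mul_obst_coupling G _ rfl _ (delta_mul_U2local_T_mem G), bulkLocal, Finset.smul_sum]
  refine Finset.sum_congr rfl fun κ _ => ?_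
  rw [smul_comm (2 / 3 * Complex.I) (eta κ : ℂ), map_sum (clsL G localKer),
    Finset.smul_sum (r := 2 / 3 * Complex.I)]
  refine congrArg _ (Finset.sum_congr rfl fun a _ => ?_)
  rw [hj, smul_zero, mul_zero, map_zero, add_zero, hT, smul_smul]
  congr 1
  linear_combination (2 / 3 * Complex.I) * eta_mul_eta κ

/-- The class of `⟨i[S_κ,σ'_ν]|j^κ⟩ I^{-ν}_{xx'} δ_{xx''}`. -/
noncomputable def bulkMinus : Expr N d ⧸ totalDer G :=
  ∑ κ, (eta κ : ℂ) • ∑ a, ∑ l, clsL G (minusKer l)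
    (brW G (SW 0 κ) (sigW G 1 l) a * jjW G 0 0 κ (G.π a))

theorem brW_comm (X Y : Fin N → Wick N d) (a : Fin N) : brW G X Y a = -brW G Y X a := by
  rw [brW, brW, Finset.sum_comm]
  refine congrArg _ ?_
  rw [← Finset.sum_neg_distrib]
  refine Finset.sum_congr rfl fun b _ => ?_
  rw [← Finset.sum_neg_distrib]
  refine Finset.sum_congr rfl fun c _ => ?_
  rw [G.antisymm_left c b a, mul_comm, Complex.ofReal_neg, neg_smul]

theorem sum_clsL_brW_D : ∑ κ, (eta κ : ℂ) • ∑ a, ∑ l, clsL G (plusKer l)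
    (brW G (DW 0 κ) (sigW G 1 l) a * jjW G 0 0 κ (G.π a)) = -bulkPlus G := by
  rw [bulkPlus, Finset.sum_comm, ← Finset.sum_neg_distrib]
  refine Finset.sum_congr rfl fun κ _ => ?_
  rw [← Finset.smul_sum, ← smul_neg, Finset.sum_comm, ← Finset.sum_neg_distrib]
  congr 1
  refine Finset.sum_congr rfl fun l _ => ?_
  rw [map_sum (clsL G (plusKer l)), ← Finset.sum_neg_distrib]
  refine Finset.sum_congr rfl fun a _ => ?_
  rw [brW_comm, neg_mul, map_neg]

theorem cls_U2string_T (κ : Fin 4) (a : Fin N) :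
    cls G ((U2string G).T κ a * (delta 0 2 * wick (jjW G 2 2 κ (G.π a)))) =
      (-(1 / 4 : ℂ) * eta κ) • (
        ∑ l, clsL G (minusKer l) (brW G (SW 0 κ) (sigW G 1 l) a * jjW G 0 0 κ (G.π a)) +
        ∑ l, clsL G (plusKer l) (brW G (DW 0 κ) (sigW G 1 l) a * jjW G 0 0 κ (G.π a))) := by
  have hm : ∀ l, clsL G (minusKer l) (brW G (SW 0 κ) (sigW G 1 l) a * jjW G 0 0 κ (G.π a)) =
      cls G (brW G (SW 0 κ) (sigW G 1 l) a • (Iminus l 0 1 : Expr N d) *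
        (delta 0 2 * wick (jjW G 2 2 κ (G.π a)))) := by
    intro l
    rw [isDiagKer_minus G l _ (brW G (SW 0 κ) (sigW G 1 l) a * jjW G 2 2 κ (G.π a)), clsL_apply,
      mul_wick_eq_smul, wick_smul_mul, mul_smul_comm, wick_smul_smul]
    · rfl
    · simp only [map_mul, reindex_brW, reindex_jjW, reindex_SW, reindex_sigW]
      rfl
  have hp : ∀ l, clsL G (plusKer l) (brW G (DW 0 κ) (sigW G 1 l) a * jjW G 0 0 κ (G.π a)) =
      cls G (brW G (DW 0 κ) (sigW G 1 l) a • (Iplus l 0 1 : Expr N d) *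
        (delta 0 2 * wick (jjW G 2 2 κ (G.π a)))) := by
    intro l
    rw [isDiagKer_plus G l _ (brW G (DW 0 κ) (sigW G 1 l) a * jjW G 2 2 κ (G.π a)), clsL_apply,
      mul_wick_eq_smul, wick_smul_mul, mul_smul_comm, wick_smul_smul]
    · rfl
    · simp only [map_mul, reindex_brW, reindex_jjW, reindex_DW, reindex_sigW]
      rfl
  rw [← Finset.sum_add_distrib]
  simp only [hm, hp, ← (cls G).map_add, ← add_mul]
  rw [← map_sum (cls G), ← (cls G).map_smul, ← Finset.sum_mul, ← smul_mul_assoc, U2string_T,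
    ← Finset.smul_sum, smul_smul, ← neg_smul, neg_mul]

/-- The commutator gives i f, whereas `brW` carries -f, hence the sign. This is the counterterm to
the I^- part of the F-coefficient. -/
theorem sum_cls_U2string_R :
    ∑ κ, (eta κ : ℂ) • ∑ a, cls G ((SW 2 κ a : Wick N d) •
      obst G (U2string G) (wick (jjW G 2 2 κ (G.π a)))) = (-(Complex.I / 2)) • bulkMinus G := by
  have h : ∀ κ a, cls G ((SW 2 κ a : Wick N d) •
      obst G (U2string G) (wick (jjW G 2 2 κ (G.π a)))) = (Complex.I / 2) • ∑ b, ∑ l, ∑ c,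
        (G.f a b c : ℂ) •
          clsL G (minusKer l) (SW 0 κ a * sigW G 1 l b * jjW G 0 0 κ (G.π c)) := by
    intro κ a
    have h1 : (SW 2 κ a : Wick N d) • obst G (U2string G) (wick (jjW G 2 2 κ (G.π a))) =
        (1 / 2 : ℂ) • ∑ b, ∑ l, (SW 2 κ a * sigW G 1 l b * (jjW G 2 0 κ (G.π a * G.π b) -
          jjW G 0 2 κ (G.π b * G.π a))) • (minusKer l : Expr N d) := by
      have hpt : (U2string G).pt = 0 := rfl
      rw [obst_jjW, hpt, Finset.smul_sum, Finset.smul_sum]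
      refine Finset.sum_congr rfl fun b _ => ?_
      rw [U2string_R, smul_mul_assoc, smul_comm, Finset.sum_mul, Finset.smul_sum]
      refine congrArg _ (Finset.sum_congr rfl fun l _ => ?_)
      rw [← wick_sub_smul, wick_smul_mul, mul_smul_comm, wick_smul_smul, wick_smul_smul, mul_assoc,
        minusKer]
    rw [h1, (cls G).map_smul, map_sum (cls G),
      show Complex.I / 2 = 1 / 2 * Complex.I by ring, mul_smul]
    refine congrArg _ ?_
    rw [Finset.smul_sum]
    refine Finset.sum_congr rfl fun b _ => ?_
    rw [map_sum (cls G), Finset.smul_sum]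
    refine Finset.sum_congr rfl fun l _ => ?_
    rw [← clsL_apply, isDiagKer_minus G l _ (SW 0 κ a * sigW G 1 l b *
      (jjW G 0 0 κ (G.π a * G.π b) - jjW G 0 0 κ (G.π b * G.π a)))]
    · rw [jjW_comm, Finset.mul_sum, map_sum, Finset.smul_sum]
      refine Finset.sum_congr rfl fun c _ => ?_
      rw [mul_smul_comm, (clsL G _).map_smul, smul_smul]
    · simp only [map_mul, map_sub, reindex_sigW, reindex_SW, reindex_jjW]
      rfl
  simp only [h, ← Finset.smul_sum, smul_comm (eta _ : ℂ) (Complex.I / 2)]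
  rw [neg_smul, ← smul_neg, bulkMinus, ← Finset.sum_neg_distrib]
  refine congrArg _ (Finset.sum_congr rfl fun κ _ => ?_)
  rw [← smul_neg]
  refine congrArg _ ?_
  rw [sum_rotate (fun a b l => ∑ c, _), Finset.sum_comm (s := (Finset.univ : Finset (Fin N)))
    (t := (Finset.univ : Finset (Fin 4))), ← Finset.sum_neg_distrib]
  refine Finset.sum_congr rfl fun l _ => ?_
  rw [← map_sum (clsL G (minusKer l)), clsL_sum_brW, neg_neg]

/-- The F-coefficient gives (-2i)(-1/4) = i/2 times the I^- and I^+ terms. The former cancels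
against the j-coefficient; the latter has its bracket reversed and yields -`bulkPlus`. -/
theorem cls_U2string :
    cls G (obst G (U2string G) (coupling G 2 (SW 2))) = (-(Complex.I / 2)) • bulkPlus G := by
  have h := cls_mul_obst_coupling G (U2string G) rfl 1 fun ν a => by
    rw [one_mul]
    exact U2string_T_mem G ν a
  simp only [one_mul] at h
  have hs : ∀ κ a, (-(2 * Complex.I) * eta κ) •
      cls G ((U2string G).T κ a * (delta 0 2 * wick (jjW G 2 2 κ (G.π a)))) = (Complex.I / 2) •
        (∑ l, clsL G (minusKer l) (brW G (SW 0 κ) (sigW G 1 l) a * jjW G 0 0 κ (G.π a)) +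
        ∑ l, clsL G (plusKer l) (brW G (DW 0 κ) (sigW G 1 l) a * jjW G 0 0 κ (G.π a))) := by
    intro κ a
    rw [cls_U2string_T, smul_smul]
    congr 1
    linear_combination (Complex.I / 2) * eta_mul_eta κ
  simp only [hs, Finset.sum_add_distrib, smul_add] at h
  simp only [← Finset.smul_sum, smul_comm (eta _ : ℂ) (Complex.I / 2)] at h
  rw [sum_clsL_brW_D, sum_cls_U2string_R, ← bulkMinus] at h
  rw [h]
  module

/-- The coefficients are (-3i/2)(-i/2) = -3/4 and (-3i/2)(1/2)(2i/3) = 1/2. -/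
theorem cls_quarkPart_P3b : cls G (quarkPart (P3b G)) = cls G (-bulk G) := by
  rw [quarkPart_P3b, (cls G).map_smul, (cls G).map_add, (cls G).map_smul, cls_U2string, cls_U2local,
    map_neg, cls_bulk]
  match_scalars
  · linear_combination (3 / 4 : ℂ) * Complex.I_mul_I
  · linear_combination (-1 / 2 : ℂ) * Complex.I_mul_I

end SQCD

/-! ### Cancellation of the bulk terms and solution of the third-order condition. -/

namespace SQCD

variable {N d : ℕ} (G : GaugeData N d)

theorem quarkPart_P3 : quarkPart (P3 G) = quarkPart (P3a G) + quarkPart (P3b G) := by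
  rw [P3, quarkPart_add, quarkPart_add, quarkPart_P3c, add_zero]

/-- If the quark part of the third-order obstruction is a total derivative, the third-order
condition is solved without third-order quark interactions. -/
theorem thirdOrderQuark_of_eqModDer (h : EqModDer G (quarkPart (P3 G)) 0) :
    ∃ ξ : Fin N → Expr N d, (∀ a, quarkPart (ξ a) = 0) ∧ ThirdOrderQuark G 0 0 (quarkU G ξ) := by
  obtain ⟨ξ, hξ, H⟩ := h
  -- The divergence of U_3 enters the third-order condition with a minus sign, opposite to the
  -- convention in `EqModDer`.
  refine ⟨(-1 : ℂ) • ξ, fun a => ?_, fun s C hC h' hs hc => ?_⟩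
  · rw [Pi.smul_apply, quarkPart_smul, hξ, smul_zero]
  · have h0 : wick (0 - 0 : Wick N d) * delta 0 1 * delta 0 2 = (0 : Expr N d) := by
      rw [sub_self, wick, MonoidAlgebra.single_zero, zero_mul, zero_mul]
    have hd : symm (divAt s C (quarkU G ((-1 : ℂ) • ξ))) h' =
        (-1) * symm (divAt s C (quarkU G ξ)) h' := by
      rw [← symm_const_mul]
      refine symm_congr (fun h hh => ?_) ⟨hs, hc⟩
      exact (congrArg (divAt s C · h) (quarkU_smul (-1) ξ)).trans (divAt_smul s hC.smooth hh _ _)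
    have hz : symm (evalAt s C (0 : Expr N d)) h' = 0 := by
      simp [symm, evalAt_zero]
    rw [H s C hC h' hs hc, h0, evalAt_zero, hd, hz]
    ring

end SQCD

theorem mainTheorem2 {N d : ℕ} (G : SQCD.GaugeData N d) :
    SQCD.EqModDer G (SQCD.quarkPart (SQCD.P3a G)) (SQCD.bulk G) ∧
    SQCD.EqModDer G (SQCD.quarkPart (SQCD.P3b G)) (-SQCD.bulk G) ∧
    SQCD.quarkPart (SQCD.P3c G) = 0 ∧
    ∃ ξ : Fin N → SQCD.Expr N d, (∀ a, SQCD.quarkPart (ξ a) = 0) ∧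
      SQCD.ThirdOrderQuark G 0 0 (SQCD.quarkU G ξ) := by
  refine ⟨SQCD.eqModDer_iff.mpr (SQCD.cls_quarkPart_P3a G),
    SQCD.eqModDer_iff.mpr (SQCD.cls_quarkPart_P3b G), SQCD.quarkPart_P3c G,
    SQCD.thirdOrderQuark_of_eqModDer G (SQCD.eqModDer_iff.mpr ?_)⟩
  rw [SQCD.quarkPart_P3, (SQCD.cls G).map_add, SQCD.cls_quarkPart_P3a, SQCD.cls_quarkPart_P3b,
    ← (SQCD.cls G).map_add, add_neg_cancel]
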